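/- Consider $m$ control loops sharing a communication network. Loop $j$ is $x^j_{k+1}=A_jx^j_k+B_ju^j_k+w^j_k$, $y^j_k=C_jx^j_k+v^j_k$, $k\ge 0$, where $(w^j_k)_k$ and $(v^j_k)_k$ are i.i.d. Gaussian with mean zero and positive definite covariances $W_j$, $V_j$, $Q_j\succeq 0$, $R_j\succ 0$ are cost weights, $(A_j,B_j)$ is controllable, and $(A_j,C_j)$ and $(A_j,Q_j^{1/2})$ are observable. The initial state $x^j_0$ is square integrable (e.g. Gaussian). Each scheduler internally generates a sequence of random vectors $(a^j_k)_k$, and all $x_0^j$, $w^j_k$, $v^j_k$ and sequences $(a^j_k)_k$ are mutually independent. Scheduler $j$ attempts a transmission at time $k$ if $\delta^j_k=1$ and does not if $\delta^j_k=0$. All schedulers are admissible: $\delta^j_k\in\{0,1\}$ is a measurable function of $x_0^j,w^j_{0:k-1},v^j_{0:k},a^j_{0:k}$. Put $\rho^j_k=\prod_{l\ne j}(1-\delta^l_k)$ and $\sigma^j_k=\rho^j_k\delta^j_k$; an attempt succeeds iff $\sigma^j_k=1$. All schedulers transmit with constant average probabilities: $\Pr[\delta^j_k=1\mid \mathsf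 T^j_k]=p^j$ for all $j,k$, where $\mathsf T^j_k$ consists of the $\delta^j_\ell$, $\ell<k$, and of the $\rho^j_\ell$, $\ell<k$, with $\delta^j_\ell=1$. Fix a loop $i$ with the purely stochastic transmission (PST) policy: $\delta^i_k$ is Bernoulli with parameter $p^i$ and depends only on $a^i_{0:k}$. Let $P_i\succeq0$ solve $P_i=A_i^{\top}P_iA_i+Q_i-K_i^{\top}(B_i^{\top}P_iB_i+R_i)K_i$ with $K_i=-(B_i^{\top}P_iB_i+R_i)^{-1}B_i^{\top}P_iA_i$, and put $Y_i=K_i^{\top}(B_i^{\top}P_iB_i+R_i)K_i$. Let $\Theta_i\succeq0$ solve $\Theta_i=\bar\Theta_i-L_i(C_i\bar\Theta_iC_i^{\top}+V_i)L_i^{\top}$ with $\bar\Theta_i=A_i\Theta_iA_i^{\top}+W_i$, $L_i=\bar\Theta_iC_i^{\top}(C_i\bar\Theta_iC_i^{\top}+V_i)^{-1}$. The scheduler runs the Kalman filter $\hat x^i_{k|k}=\hat x^i_{k|k-1}+L_i(y^i_k-C_i\hat x^i_{k|k-1})$, $\hat x^i_{k+1|k}=A_i\hat x^i_{k|k}+B_iu^i_k$,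 $\hat x^i_{0|-1}=0$, and transmits $\hat x^i_{k|k}$. The controller knows $\mathsf H^i_k=\{\sigma^i_\ell:\ell\le k\}\cup\{\hat x^i_{\ell|\ell}:\ell\le k,\ \sigma^i_\ell=1\}$. Its remote estimate is $\bar x^i_{k|k}=\hat x^i_{k|k}$ if $\sigma^i_k=1$ and $\bar x^i_{k|k}=\bar x^i_{k|k-1}$ otherwise, with $\bar x^i_{k+1|k}=A_i\bar x^i_{k|k}+B_iu^i_k$, $\bar x^i_{0|-1}=0$. Let $q^i=\prod_{j\neq i}(1-p^j)$, and suppose that the spectral radius satisfies $$\varrho\big(\sqrt{1-q^ip^i}\,A_i\big)<1 .$$ Then loop $i$ under the control $u^i_k=K_i\bar x^i_{k|k}$ is mean square stable: from every initial condition $x_0\in\mathbb R^{n_i}$, and also from the given random $x^i_0$, the second moments $\mathsf E[x^i_kx^{i\top}_k]$ are bounded uniformly in $k$. Moreover, this control minimizes the average cost $$J^i=\limsup_{T\to\infty}\frac1T\,\mathsf E\Big[\sum_{k=0}^{T-1}x_k^{i\top}Q_ix^i_k+u_k^{i\top}R_iu^i_k\Big]\in[0,\infty]$$ among all controls for which every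 $u^i_k$ is a measurable function of $\mathsf H^i_k$, and the minimal cost is $$J^i_{ps}=\operatorname{tr}(P_iW_i)+\sum_{j=0}^{\infty}\Big[(1-q^ip^i)^{j+1}\operatorname{tr}\big(A_i^jW_i(A_i^j)^{\top}Y_i\big)+q^ip^i(1-q^ip^i)^j\operatorname{tr}\big(A_i^j\Theta_i(A_i^j)^{\top}Y_i\big)\Big],$$ where the series converges. -/

import Mathlib

open MeasureTheory ProbabilityTheory Filter Matrix
open scoped ENNReal NNReal MatrixOrder

namespace SharedNetwork

/-- Column vectors of length `n`. -/
abbrev Vec (n : ℕ) : Type := EuclideanSpace ℝ (Fin n)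

/-- Matrix times column vector. -/
noncomputable def act {a b : ℕ} (M : Matrix (Fin a) (Fin b) ℝ) (z : Vec b) : Vec a :=
  Matrix.toEuclideanLin M z

/-- The quadratic form `zᵀ M z`. -/
noncomputable def quad {a : ℕ} (M : Matrix (Fin a) (Fin a) ℝ) (z : Vec a) : ℝ :=
  (WithLp.ofLp z) ⬝ᵥ (M *ᵥ (WithLp.ofLp z))

/-! ### Linear systems -/

/-- `(A, B)` is controllable: the reachable subspace `∑_{k < n} im (A ^ k B)` is everything. -/
def IsControllable {a b : ℕ} (A : Matrix (Fin a) (Fin a) ℝ) (B : Matrix (Fin a) (Fin b) ℝ) :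
    Prop :=
  (⨆ k : Fin a, LinearMap.range (A ^ (k : ℕ) * B).mulVecLin) = ⊤

/-- `(A, C)` is observable: the unobservable subspace `⋂_{k < n} ker (C A ^ k)` is zero. -/
def IsObservable {a b : ℕ} (A : Matrix (Fin a) (Fin a) ℝ) (C : Matrix (Fin b) (Fin a) ℝ) :
    Prop :=
  (⨅ k : Fin a, LinearMap.ker (C * A ^ (k : ℕ)).mulVecLin) = ⊥

/-- The spectral radius of a real square matrix (the largest modulus of a complex eigenvalue). -/
noncomputable def matSpectralRadius {a : ℕ} (A : Matrix (Fin a) (Fin a) ℝ) : ℝ≥0∞ :=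
  spectralRadius ℂ (A.map Complex.ofReal)

/-- The data of one control loop: the dimensions of state, input and output, the plant matrices
`A, B, C`, the covariances `W, V` of disturbance and measurement noise, the cost weights `Q, R`. -/
structure Loop where
  n : ℕ
  m : ℕ
  o : ℕ
  A : Matrix (Fin n) (Fin n) ℝ
  B : Matrix (Fin n) (Fin m) ℝ
  C : Matrix (Fin o) (Fin n) ℝ
  W : Matrix (Fin n) (Fin n) ℝ
  V : Matrix (Fin o) (Fin o) ℝ
  Q : Matrix (Fin n) (Fin n) ℝ
  R : Matrix (Fin m) (Fin m) ℝ

namespace Loop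

/-- The standing assumptions on a loop. -/
structure Regular (S : Loop) : Prop where
  W_posDef : S.W.PosDef
  V_posDef : S.V.PosDef
  Q_posSemidef : S.Q.PosSemidef
  R_posDef : S.R.PosDef
  controllable : IsControllable S.A S.B
  observable : IsObservable S.A S.C
  observable_cost : IsObservable S.A (CFC.sqrt S.Q)

variable (S : Loop)

/-- The control gain `K = -(Bᵀ P B + R)⁻¹ Bᵀ P A`. -/
noncomputable def controlGain (P : Matrix (Fin S.n) (Fin S.n) ℝ) :
    Matrix (Fin S.m) (Fin S.n) ℝ :=
  -((S.Bᵀ * P * S.B + S.R)⁻¹ * S.Bᵀ * P * S.A)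

/-- The matrix `Y = Kᵀ (Bᵀ P B + R) K`. -/
noncomputable def gainWeight (P : Matrix (Fin S.n) (Fin S.n) ℝ) :
    Matrix (Fin S.n) (Fin S.n) ℝ :=
  (S.controlGain P)ᵀ * (S.Bᵀ * P * S.B + S.R) * S.controlGain P

/-- `P` is the positive semidefinite solution of the control Riccati equation. -/
def IsControlRiccati (P : Matrix (Fin S.n) (Fin S.n) ℝ) : Prop :=
  P.PosSemidef ∧ P = S.Aᵀ * P * S.A + S.Q - S.gainWeight P

/-- The prediction error covariance `A Θ Aᵀ + W`. -/
def predCov (Θ : Matrix (Fin S.n) (Fin S.n) ℝ) : Matrix (Fin S.n) (Fin S.n) ℝ :=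
  S.A * Θ * S.Aᵀ + S.W

/-- The steady-state Kalman gain, in terms of the filtering error covariance `Θ`. -/
noncomputable def kalmanGain (Θ : Matrix (Fin S.n) (Fin S.n) ℝ) :
    Matrix (Fin S.n) (Fin S.o) ℝ :=
  S.predCov Θ * S.Cᵀ * (S.C * S.predCov Θ * S.Cᵀ + S.V)⁻¹

/-- `Θ` is the positive semidefinite fixed point of the Riccati equation of the Kalman filter. -/
def IsFilterRiccati (Θ : Matrix (Fin S.n) (Fin S.n) ℝ) : Prop :=
  Θ.PosSemidef ∧
    Θ = S.predCov Θ -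
      S.kalmanGain Θ * (S.C * S.predCov Θ * S.Cᵀ + S.V) * (S.kalmanGain Θ)ᵀ

/-! ### Trajectories along one sample path

`F` is the filter gain, `K` the feedback gain, `x0` the initial state, `w`, `v` are the
disturbance and noise sequences, `σ k = 1` means a successful transmission at time `k`,
and `u` is the input sequence. -/

/-- The state `x_k`. -/
noncomputable def state (x0 : Vec S.n) (w : ℕ → Vec S.n) (u : ℕ → Vec S.m) : ℕ → Vec S.n
  | 0 => x0
  | k + 1 => act S.A (state x0 w u k) + act S.B (u k) + w k

/-- The filter update `x̂_{k|k}`, computed from `x̂_{k|k-1}` and from `y_k = C x_k + v_k`. -/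
noncomputable def filterUpdate (F : Matrix (Fin S.n) (Fin S.o) ℝ) (xpred x : Vec S.n)
    (vk : Vec S.o) : Vec S.n :=
  xpred + act F ((act S.C x + vk) - act S.C xpred)

/-- The prediction `x̂_{k|k-1}` of the Kalman filter at the scheduler, started at `0`. -/
noncomputable def filterPred (F : Matrix (Fin S.n) (Fin S.o) ℝ) (x0 : Vec S.n)
    (w : ℕ → Vec S.n) (v : ℕ → Vec S.o) (u : ℕ → Vec S.m) : ℕ → Vec S.n
  | 0 => 0
  | k + 1 =>
    act S.A (S.filterUpdate F (filterPred F x0 w v u k) (S.state x0 w u k) (v k))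
      + act S.B (u k)

/-- The estimate `x̂_{k|k}` of the Kalman filter at the scheduler. -/
noncomputable def filterEst (F : Matrix (Fin S.n) (Fin S.o) ℝ) (x0 : Vec S.n)
    (w : ℕ → Vec S.n) (v : ℕ → Vec S.o) (u : ℕ → Vec S.m) (k : ℕ) : Vec S.n :=
  S.filterUpdate F (S.filterPred F x0 w v u k) (S.state x0 w u k) (v k)

open Classical in
/-- The remote update `x̄_{k|k}`: the received estimate `x̂_{k|k}` after a successful
transmission, the prediction `x̄_{k|k-1}` otherwise. -/
noncomputable def remoteUpdate (σk : ℝ) (xhat xpred : Vec S.n) : Vec S.n :=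
  if σk = 1 then xhat else xpred

/-- The remote prediction `x̄_{k|k-1}` at the controller, started at `0`. -/
noncomputable def remotePred (F : Matrix (Fin S.n) (Fin S.o) ℝ) (x0 : Vec S.n)
    (w : ℕ → Vec S.n) (v : ℕ → Vec S.o) (σ : ℕ → ℝ) (u : ℕ → Vec S.m) : ℕ → Vec S.n
  | 0 => 0
  | k + 1 =>
    act S.A (S.remoteUpdate (σ k) (S.filterEst F x0 w v u k) (remotePred F x0 w v σ u k))
      + act S.B (u k)

/-- The remote estimate `x̄_{k|k}` at the controller. -/
noncomputable def remoteEst (F : Matrix (Fin S.n) (Fin S.o) ℝ) (x0 : Vec S.n)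
    (w : ℕ → Vec S.n) (v : ℕ → Vec S.o) (σ : ℕ → ℝ) (u : ℕ → Vec S.m) (k : ℕ) : Vec S.n :=
  S.remoteUpdate (σ k) (S.filterEst F x0 w v u k) (S.remotePred F x0 w v σ u k)

/-- The triple `(x_k, x̂_{k|k-1}, x̄_{k|k-1})` of the loop closed by `u_k = K x̄_{k|k}`. -/
noncomputable def closedLoop (K : Matrix (Fin S.m) (Fin S.n) ℝ)
    (F : Matrix (Fin S.n) (Fin S.o) ℝ) (x0 : Vec S.n)
    (w : ℕ → Vec S.n) (v : ℕ → Vec S.o) (σ : ℕ → ℝ) : ℕ → Vec S.n × Vec S.n × Vec S.n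
  | 0 => (x0, 0, 0)
  | k + 1 =>
    let s := closedLoop K F x0 w v σ k
    let xhat := S.filterUpdate F s.2.1 s.1 (v k)
    let xbar := S.remoteUpdate (σ k) xhat s.2.2
    let u := act K xbar
    (act S.A s.1 + act S.B u + w k, act S.A xhat + act S.B u, act S.A xbar + act S.B u)

/-- The input sequence of the loop closed by `u_k = K x̄_{k|k}`. -/
noncomputable def feedbackInput (K : Matrix (Fin S.m) (Fin S.n) ℝ)
    (F : Matrix (Fin S.n) (Fin S.o) ℝ) (x0 : Vec S.n)
    (w : ℕ → Vec S.n) (v : ℕ → Vec S.o) (σ : ℕ → ℝ) (k : ℕ) : Vec S.m :=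
  let s := S.closedLoop K F x0 w v σ k
  act K (S.remoteUpdate (σ k) (S.filterUpdate F s.2.1 s.1 (v k)) s.2.2)

theorem closedLoop_eq (K : Matrix (Fin S.m) (Fin S.n) ℝ)
    (F : Matrix (Fin S.n) (Fin S.o) ℝ) (x0 : Vec S.n)
    (w : ℕ → Vec S.n) (v : ℕ → Vec S.o) (σ : ℕ → ℝ) (k : ℕ) :
    S.closedLoop K F x0 w v σ k =
      (S.state x0 w (S.feedbackInput K F x0 w v σ) k,
        S.filterPred F x0 w v (S.feedbackInput K F x0 w v σ) k,
        S.remotePred F x0 w v σ (S.feedbackInput K F x0 w v σ) k) := by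
  induction k with
  | zero => rfl
  | succ k ih =>
    simp only [closedLoop, state, filterPred, remotePred, filterEst, feedbackInput, ih]

/-- `feedbackInput` is the certainty equivalence controller: `u_k = K x̄_{k|k}`, where `x̄` is the
remote estimate along the trajectory that `u` itself generates. -/
theorem feedbackInput_eq (K : Matrix (Fin S.m) (Fin S.n) ℝ)
    (F : Matrix (Fin S.n) (Fin S.o) ℝ) (x0 : Vec S.n)
    (w : ℕ → Vec S.n) (v : ℕ → Vec S.o) (σ : ℕ → ℝ) (k : ℕ) :
    S.feedbackInput K F x0 w v σ k =
      act K (S.remoteEst F x0 w v σ (S.feedbackInput K F x0 w v σ) k) := by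
  conv_lhs => unfold feedbackInput
  simp only [closedLoop_eq, remoteEst, filterEst]

end Loop

/-! ### Randomness, network and schedulers -/

variable {N : ℕ} {L : Fin N → Loop} {Ω : Type*}

/-- The random variables of a network of `N` loops: initial states, disturbances, measurement
noises, and the variables `a` that the schedulers generate internally. -/
structure Primitives (L : Fin N → Loop) (Ω : Type*) where
  x0 : ∀ j, Ω → Vec (L j).n
  w : ∀ j, ℕ → Ω → Vec (L j).n
  v : ∀ j, ℕ → Ω → Vec (L j).o
  r : Fin N → ℕ
  a : ∀ j, ℕ → Ω → Vec (r j)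

/-- Names for the independent sources of randomness. -/
inductive Source (N : ℕ) : Type
  | init (j : Fin N)
  | dist (j : Fin N) (k : ℕ)
  | noise (j : Fin N) (k : ℕ)
  | sched (j : Fin N)

namespace Primitives

/-- The σ-algebra generated by a source; for `sched j` by the whole sequence `a^j`. -/
@[reducible]
def sigma (X : Primitives L Ω) : Source N → MeasurableSpace Ω
  | .init j => MeasurableSpace.comap (X.x0 j) inferInstance
  | .dist j k => MeasurableSpace.comap (X.w j k) inferInstance
  | .noise j k => MeasurableSpace.comap (X.v j k) inferInstance
  | .sched j => ⨆ k, MeasurableSpace.comap (X.a j k) inferInstance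

/-- The standing assumptions on the random variables: disturbances and noises are Gaussian with
mean zero and covariances `W`, `V`, initial states are square integrable, and all sources are
mutually independent. -/
structure Regular (X : Primitives L Ω) [MeasurableSpace Ω] (μ : Measure Ω) : Prop where
  measurable_x0 : ∀ j, Measurable (X.x0 j)
  measurable_w : ∀ j k, Measurable (X.w j k)
  measurable_v : ∀ j k, Measurable (X.v j k)
  measurable_a : ∀ j k, Measurable (X.a j k)
  memLp_x0 : ∀ j, MemLp (X.x0 j) 2 μ
  law_w : ∀ j k, HasLaw (X.w j k) (multivariateGaussian 0 (L j).W) μ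
  law_v : ∀ j k, HasLaw (X.v j k) (multivariateGaussian 0 (L j).V) μ
  indep : iIndep X.sigma μ

/-- An admissible scheduler of loop `j`: the `{0,1}`-valued decision at time `k` is a measurable
function of `x_0, w_0, …, w_{k-1}, v_0, …, v_k, a_0, …, a_k` of loop `j`. -/
def IsAdmissibleScheduler (X : Primitives L Ω) (j : Fin N) (δ : ℕ → Ω → ℝ) : Prop :=
  (∀ k ω, δ k ω = 0 ∨ δ k ω = 1) ∧
  ∀ k, Measurable[MeasurableSpace.comap (X.x0 j) inferInstance ⊔
      (⨆ l ∈ Set.Iio k, MeasurableSpace.comap (X.w j l) inferInstance) ⊔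
      (⨆ l ∈ Set.Iic k, MeasurableSpace.comap (X.v j l) inferInstance) ⊔
      (⨆ l ∈ Set.Iic k, MeasurableSpace.comap (X.a j l) inferInstance)] (δ k)

/-- A purely stochastic transmission (PST) scheduler of loop `j` with triggering probability `p`:
the decisions are Bernoulli with parameter `p` and depend only on the internally generated
variables `a_0, …, a_k`. -/
def IsPurelyStochastic (X : Primitives L Ω) [MeasurableSpace Ω] (μ : Measure Ω) (j : Fin N)
    (δ : ℕ → Ω → ℝ) (p : ℝ) : Prop :=
  (∀ k, Measurable[⨆ l ∈ Set.Iic k, MeasurableSpace.comap (X.a j l) inferInstance] (δ k)) ∧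
  ∀ k, μ {ω | δ k ω = 1} = ENNReal.ofReal p

end Primitives

/-- `ρ^i_k = ∏_{j ≠ i} (1 - δ^j_k)`: the network is available for user `i`. -/
def available (δ : Fin N → ℕ → Ω → ℝ) (i : Fin N) (k : ℕ) (ω : Ω) : ℝ :=
  ∏ j ∈ Finset.univ.erase i, (1 - δ j k ω)

/-- `σ^i_k = ρ^i_k δ^i_k`: user `i` transmits successfully. -/
def success (δ : Fin N → ℕ → Ω → ℝ) (i : Fin N) (k : ℕ) (ω : Ω) : ℝ :=
  available δ i k ω * δ i k ω

/-- The σ-algebra of the transmission history `T^i_k`: the decisions `δ^i_l` for `l < k`, and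
`ρ^i_l` for those `l < k` with `δ^i_l = 1`. -/
@[reducible]
def transmissionHistory (δ : Fin N → ℕ → Ω → ℝ) (i : Fin N) (k : ℕ) : MeasurableSpace Ω :=
  ⨆ l ∈ Set.Iio k,
    (MeasurableSpace.comap (δ i l) inferInstance ⊔
      MeasurableSpace.comap (fun ω => δ i l ω * available δ i l ω) inferInstance)

/-- The average transmission probability `Pr[δ^i_k = 1 | T^i_k]` is the constant `p` at every
time. -/
def HasTransmissionProb [MeasurableSpace Ω] (μ : Measure Ω) (δ : Fin N → ℕ → Ω → ℝ)
    (i : Fin N) (p : ℝ) : Prop :=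
  ∀ k, μ[Set.indicator {ω | δ i k ω = 1} (fun _ => (1 : ℝ)) | transmissionHistory δ i k]
    =ᵐ[μ] fun _ => p

/-! ### Controllers, stability and cost for one loop

Here `x0`, `w`, `v`, `σ`, `u` are random: functions (or sequences of functions) on `Ω`. -/

section OneLoop

variable (S : Loop)

/-- The σ-algebra of the information `H_k` of the controller: `σ_l` for `l ≤ k`, and `x̂_{l|l}` for
those `l ≤ k` with `σ_l = 1`. -/
@[reducible]
noncomputable def controllerInfo (F : Matrix (Fin S.n) (Fin S.o) ℝ) (x0 : Ω → Vec S.n)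
    (w : ℕ → Ω → Vec S.n) (v : ℕ → Ω → Vec S.o) (σ : ℕ → Ω → ℝ) (u : ℕ → Ω → Vec S.m)
    (k : ℕ) : MeasurableSpace Ω :=
  ⨆ l ∈ Set.Iic k,
    (MeasurableSpace.comap (σ l) inferInstance ⊔
      MeasurableSpace.comap
        (fun ω => σ l ω •
          S.filterEst F (x0 ω) (fun t => w t ω) (fun t => v t ω) (fun t => u t ω) l)
        inferInstance)

/-- An admissible control: `u_k` is a measurable function of the information `H_k`. -/
def IsAdmissibleControl (F : Matrix (Fin S.n) (Fin S.o) ℝ) (x0 : Ω → Vec S.n)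
    (w : ℕ → Ω → Vec S.n) (v : ℕ → Ω → Vec S.o) (σ : ℕ → Ω → ℝ) (u : ℕ → Ω → Vec S.m) : Prop :=
  ∀ k, Measurable[controllerInfo S F x0 w v σ u k] (u k)

/-- The random inputs `u_k = K x̄_{k|k}`. -/
noncomputable def feedbackControl (K : Matrix (Fin S.m) (Fin S.n) ℝ)
    (F : Matrix (Fin S.n) (Fin S.o) ℝ) (x0 : Ω → Vec S.n)
    (w : ℕ → Ω → Vec S.n) (v : ℕ → Ω → Vec S.o) (σ : ℕ → Ω → ℝ) (k : ℕ) (ω : Ω) : Vec S.m :=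
  S.feedbackInput K F (x0 ω) (fun t => w t ω) (fun t => v t ω) (fun t => σ t ω) k

/-- The random states `x_k` under the inputs `u`. -/
noncomputable def stateProc (x0 : Ω → Vec S.n) (w : ℕ → Ω → Vec S.n) (u : ℕ → Ω → Vec S.m)
    (k : ℕ) (ω : Ω) : Vec S.n :=
  S.state (x0 ω) (fun t => w t ω) (fun t => u t ω) k

/-- The second moments `E ‖x_k‖² = tr E[x_k x_kᵀ]` are bounded uniformly in `k`. -/
def BoundedSecondMoments [MeasurableSpace Ω] (μ : Measure Ω) (x : ℕ → Ω → Vec S.n) : Prop :=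
  ∃ c : ℝ≥0, ∀ k, ∫⁻ ω, ‖x k ω‖ₑ ^ 2 ∂μ ≤ c

/-- Mean square stability of the loop closed by `u_k = K x̄_{k|k}`: from every initial condition
in `ℝⁿ`, the second moments of the state are bounded uniformly in time. -/
def IsMeanSquareStable [MeasurableSpace Ω] (μ : Measure Ω) (K : Matrix (Fin S.m) (Fin S.n) ℝ)
    (F : Matrix (Fin S.n) (Fin S.o) ℝ) (w : ℕ → Ω → Vec S.n) (v : ℕ → Ω → Vec S.o)
    (σ : ℕ → Ω → ℝ) : Prop :=
  ∀ z : Vec S.n, BoundedSecondMoments S μ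
    (stateProc S (fun _ => z) w (feedbackControl S K F (fun _ => z) w v σ))

/-- The average quadratic cost `limsup_T (1/T) E[∑_{k<T} x_kᵀ Q x_k + u_kᵀ R u_k]`, a number in
`[0, ∞]`. -/
noncomputable def averageCost [MeasurableSpace Ω] (μ : Measure Ω) (x0 : Ω → Vec S.n)
    (w : ℕ → Ω → Vec S.n) (u : ℕ → Ω → Vec S.m) : ℝ≥0∞ :=
  limsup (fun T : ℕ => (T : ℝ≥0∞)⁻¹ *
    ∫⁻ ω, ENNReal.ofReal (∑ k ∈ Finset.range T,
      (quad S.Q (stateProc S x0 w u k ω) + quad S.R (u k ω))) ∂μ) atTop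

end OneLoop

/-- The `j`-th term of the cost series, for success probability `s`. -/
noncomputable def seriesTerm (S : Loop) (P Θ : Matrix (Fin S.n) (Fin S.n) ℝ) (s : ℝ) (j : ℕ) :
    ℝ :=
  (1 - s) ^ (j + 1) * (S.A ^ j * S.W * (S.A ^ j)ᵀ * S.gainWeight P).trace
    + s * (1 - s) ^ j * (S.A ^ j * Θ * (S.A ^ j)ᵀ * S.gainWeight P).trace

end SharedNetwork

namespace SharedNetwork

-- Matrices acting on vectors, and quadratic forms.

section LinearAlgebra

open scoped Matrix.Norms.L2Operator Topology

variable {a b c : ℕ}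

-- The dynamics are linear, so the estimation errors at the scheduler and at the controller do not
-- depend on the inputs (`state_sub_filterEst`, `state_sub_remoteEst`). Completing the square with
-- the control Riccati equation and telescoping gives `cost_identity`: up to the boundary terms
-- E[xᵀPx] at times 0 and T, the expected cost of T stages is T tr(PW) plus the sum of the mean
-- squares of u_k - K x_k in the weight Λ = BᵀPB + R. Control is thereby reduced to estimating K x_k
-- from the information of the controller.
--
-- A decision whose conditional probability given its own transmission history is constant is
-- independent of that history. Different loops use disjoint sources of randomness, and the PST
-- scheduler of loop i ignores its plant. Hence each success of loop i has probability s = qp and is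
-- independent of the earlier successes and of the plant (`loopNoise_of_regular`). The covariance D
-- of the remote error then satisfies D_{k+1} = (1-s)(A D_k Aᵀ + W) + s Θ_{k+1}, where Θ_k is the
-- covariance of the filtering error. This Lyapunov recursion for √(1-s) A is stable by the spectral
-- radius hypothesis, and the trace of Y against its limit `remoteCov` is the cost series. Under u =
-- K x̄ the deviation u - Kx is -K times the remote error. Since A + BK is stable, second moments
-- stay bounded, the terminal term is negligible after division by T, and the cost is the asserted
-- value.
--
-- The lower bound for other controls has two difficulties. The initial state need not be Gaussian,
-- so the filter estimates need not be conditional means. The remedy is to enlarge the information: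
-- the controller is also given x_0, all successes (future ones included), and the innovations up to
-- the last success of the time-varying Kalman filter that knows x_0. The errors and innovations of
-- that filter are Gaussian, and its filtering error is independent of its innovations. Its remote
-- error is therefore orthogonal to everything the enlarged information contains
-- (`crossMom_remoteErr_eq_zero`), and no admissible deviation can have smaller weighted mean square
-- (`le_integral_deviation`). Its Riccati recursion starts at 0 but converges to the same fixed
-- point (`tendsto_riccatiSeq`), so the bound has the same limit.
--
-- Secondly, E[x_TᵀPx_T]/T need not vanish for an arbitrary control. Observability of (A, Q^{1/2})
-- bounds this energy by the cost of the next n stages. If costs accumulated too slowly, the energy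
-- would have to tend to infinity while its averages stay bounded, a contradiction
-- (`le_rate_of_energy_balance`).

theorem act_add (M : Matrix (Fin a) (Fin b) ℝ) (x y : Vec b) :
    act M (x + y) = act M x + act M y := map_add _ _ _

theorem act_sub (M : Matrix (Fin a) (Fin b) ℝ) (x y : Vec b) :
    act M (x - y) = act M x - act M y := map_sub _ _ _

theorem add_act (M N : Matrix (Fin a) (Fin b) ℝ) (x : Vec b) :
    act (M + N) x = act M x + act N x := by
  simp [act, Matrix.toEuclideanLin, map_add]

theorem sub_act (M N : Matrix (Fin a) (Fin b) ℝ) (x : Vec b) :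
    act (M - N) x = act M x - act N x := by
  simp [act, Matrix.toEuclideanLin, map_sub]

theorem ofLp_act (M : Matrix (Fin a) (Fin b) ℝ) (x : Vec b) :
    WithLp.ofLp (act M x) = M *ᵥ WithLp.ofLp x := rfl

theorem act_apply (M : Matrix (Fin a) (Fin b) ℝ) (x : Vec b) (k : Fin a) :
    act M x k = ∑ l, M k l * x l := rfl

theorem mul_act (M : Matrix (Fin a) (Fin b) ℝ) (N : Matrix (Fin b) (Fin c) ℝ) (x : Vec c) :
    act (M * N) x = act M (act N x) := by
  apply (WithLp.ofLp_injective 2)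
  simp [ofLp_act]

theorem one_act (x : Vec a) : act (1 : Matrix (Fin a) (Fin a) ℝ) x = x := by
  apply (WithLp.ofLp_injective 2)
  simp [ofLp_act]

theorem pow_succ_act (M : Matrix (Fin a) (Fin a) ℝ) (k : ℕ) (x : Vec a) :
    act (M ^ (k + 1)) x = act M (act (M ^ k) x) := by
  rw [pow_succ', mul_act]

theorem norm_act_le (M : Matrix (Fin a) (Fin b) ℝ) (x : Vec b) : ‖act M x‖ ≤ ‖M‖ * ‖x‖ :=
  Matrix.l2_opNorm_mulVec M x

theorem continuous_act (M : Matrix (Fin a) (Fin b) ℝ) : Continuous (act M) :=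
  LinearMap.continuous_of_finiteDimensional (Matrix.toEuclideanLin M)

theorem measurable_act (M : Matrix (Fin a) (Fin b) ℝ) : Measurable (act M) :=
  (continuous_act M).measurable

theorem quad_eq_sum (M : Matrix (Fin a) (Fin a) ℝ) (x : Vec a) :
    quad M x = ∑ k, ∑ l, M k l * (x k * x l) := by
  simp only [quad, dotProduct, mulVec, Finset.mul_sum]
  refine Finset.sum_congr rfl fun k _ => Finset.sum_congr rfl fun l _ => by ring

theorem continuous_quad (M : Matrix (Fin a) (Fin a) ℝ) : Continuous (quad M) := by
  simp_rw [funext (quad_eq_sum M)]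
  fun_prop

theorem quad_zero (M : Matrix (Fin a) (Fin a) ℝ) : quad M 0 = 0 := by
  simp [quad]

theorem add_quad (M N : Matrix (Fin a) (Fin a) ℝ) (x : Vec a) :
    quad (M + N) x = quad M x + quad N x := by
  simp [quad, add_mulVec, dotProduct_add]

theorem sub_quad (M N : Matrix (Fin a) (Fin a) ℝ) (x : Vec a) :
    quad (M - N) x = quad M x - quad N x := by
  simp [quad, sub_mulVec, dotProduct_sub]

theorem quad_one (x : Vec a) : quad 1 x = ‖x‖ ^ 2 := by
  rw [EuclideanSpace.real_norm_sq_eq]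
  simp [quad, dotProduct, sq]

theorem quad_act (M : Matrix (Fin a) (Fin a) ℝ) (N : Matrix (Fin a) (Fin b) ℝ) (x : Vec b) :
    quad M (act N x) = quad (Nᵀ * M * N) x := by
  simp only [quad, ofLp_act]
  rw [Matrix.mul_assoc, ← mulVec_mulVec, ← mulVec_mulVec, dotProduct_mulVec x.ofLp,
    vecMul_transpose]

theorem quad_smul (M : Matrix (Fin a) (Fin a) ℝ) (r : ℝ) (x : Vec a) :
    quad M (r • x) = r ^ 2 * quad M x := by
  simp [quad, mulVec_smul, smul_eq_mul]; ring

theorem quad_nonneg {M : Matrix (Fin a) (Fin a) ℝ} (hM : M.PosSemidef) (x : Vec a) :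
    0 ≤ quad M x := by
  simpa [quad] using hM.dotProduct_mulVec_nonneg x.ofLp

theorem quad_pos {M : Matrix (Fin a) (Fin a) ℝ} (hM : M.PosDef) {x : Vec a} (hx : x ≠ 0) :
    0 < quad M x := by
  simpa [quad] using hM.dotProduct_mulVec_pos (x := x.ofLp) (by simpa using hx)

theorem transpose_eq_of_posSemidef {M : Matrix (Fin a) (Fin a) ℝ} (hM : M.PosSemidef) :
    Mᵀ = M := by
  simpa [IsHermitian] using hM.isHermitian

theorem quad_add {M : Matrix (Fin a) (Fin a) ℝ} (hM : Mᵀ = M) (x y : Vec a) :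
    quad M (x + y) = quad M x + 2 * (x.ofLp ⬝ᵥ (M *ᵥ y.ofLp)) + quad M y := by
  have : y.ofLp ⬝ᵥ (M *ᵥ x.ofLp) = x.ofLp ⬝ᵥ (M *ᵥ y.ofLp) := by
    conv_lhs => rw [← hM, mulVec_transpose, dotProduct_comm, ← dotProduct_mulVec]
  simp only [quad, WithLp.ofLp_add, mulVec_add, dotProduct_add, add_dotProduct, this]
  ring

theorem quad_neg (M : Matrix (Fin a) (Fin a) ℝ) (x : Vec a) : quad M (-x) = quad M x := by
  simp [quad, mulVec_neg]

theorem quad_add_le {M : Matrix (Fin a) (Fin a) ℝ} (hM : M.PosSemidef) (x y : Vec a) :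
    quad M (x + y) ≤ 2 * quad M x + 2 * quad M y := by
  have hs := transpose_eq_of_posSemidef hM
  have h := quad_nonneg hM (x - y)
  rw [sub_eq_add_neg, quad_add hs, quad_neg] at h
  rw [quad_add hs]
  simp only [WithLp.ofLp_neg, mulVec_neg, dotProduct_neg] at h
  linarith

theorem quad_le_norm (M : Matrix (Fin a) (Fin a) ℝ) (x : Vec a) :
    |quad M x| ≤ ‖M‖ * ‖x‖ ^ 2 := by
  have h : quad M x = inner ℝ (act M x) x := by
    simp [quad, PiLp.inner_apply, dotProduct, ofLp_act]
  rw [h]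
  refine (abs_real_inner_le_norm _ _).trans ?_
  nlinarith [norm_act_le M x, norm_nonneg x]

/-- The constant is the minimum over the compact unit sphere, extended by homogeneity. The sphere is
empty only in dimension zero. -/
theorem exists_pos_mul_le_quad {M : Matrix (Fin a) (Fin a) ℝ} (hM : ∀ x, x ≠ 0 → 0 < quad M x) :
    ∃ r > 0, ∀ x : Vec a, r * ‖x‖ ^ 2 ≤ quad M x := by
  obtain hne | hne := (Metric.sphere (0 : Vec a) 1).eq_empty_or_nonempty
  · refine ⟨1, one_pos, fun x => ?_⟩
    have : x = 0 := by
      by_contra hx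
      have : (‖x‖⁻¹ • x) ∈ Metric.sphere (0 : Vec a) 1 := by
        simp [norm_smul, hx]
      simp [hne] at this
    simp [this, quad_zero]
  · obtain ⟨z, hz, hmin⟩ := (isCompact_sphere (0 : Vec a) 1).exists_isMinOn hne
      (continuous_quad M).continuousOn
    have hz0 : z ≠ 0 := by
      rintro rfl
      simp at hz
    refine ⟨quad M z, hM z hz0, fun x => ?_⟩
    by_cases hx : x = 0
    · simp [hx, quad_zero]
    have hx' : 0 < ‖x‖ := norm_pos_iff.2 hx
    have h := hmin (show ‖x‖⁻¹ • x ∈ Metric.sphere (0 : Vec a) 1 by simp [norm_smul, hx])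
    simp only [Set.mem_ofPred_eq, quad_smul] at h
    calc quad M z * ‖x‖ ^ 2 ≤ ((‖x‖⁻¹) ^ 2 * quad M x) * ‖x‖ ^ 2 := by gcongr
      _ = quad M x := by field_simp

theorem exists_pos_mul_le_quad_of_posDef {M : Matrix (Fin a) (Fin a) ℝ} (hM : M.PosDef) :
    ∃ r > 0, ∀ x : Vec a, r * ‖x‖ ^ 2 ≤ quad M x :=
  exists_pos_mul_le_quad fun _ => quad_pos hM

/-! ### Summable powers -/

/-- If some power has norm at most `1 / 2`, the norms of all powers are summable. -/
theorem summable_norm_pow_of_norm_le {R : Type*} [NormedRing R] (x : R) (J : ℕ)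
    (hJ : ‖x ^ J‖ ≤ 1 / 2) : Summable fun j => ‖x ^ j‖ := by
  refine summable_of_sum_range_le (c := 2 * ∑ j ∈ Finset.range J, ‖x ^ j‖)
    (fun _ => norm_nonneg _) fun M => ?_
  have h1 : ∑ j ∈ Finset.range M, ‖x ^ j‖ ≤ ∑ j ∈ Finset.range (J + M), ‖x ^ j‖ :=
    Finset.sum_le_sum_of_subset_of_nonneg (Finset.range_mono (by omega))
      fun _ _ _ => norm_nonneg _
  -- Beyond the first `J` terms the sum is at most half of itself, so partial sums are at most twice
  -- the sum of the first `J` terms.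
  have h2 : ∑ j ∈ Finset.range M, ‖x ^ (J + j)‖ ≤ 1 / 2 * ∑ j ∈ Finset.range M, ‖x ^ j‖ := by
    rw [Finset.mul_sum]
    refine Finset.sum_le_sum fun j _ => ?_
    rw [pow_add]
    exact (norm_mul_le _ _).trans (by gcongr)
  rw [Finset.sum_range_add] at h1
  linarith

theorem summable_norm_pow_of_tendsto {R : Type*} [NormedRing R] {x : R}
    (hx : Tendsto (fun j => x ^ j) atTop (𝓝 0)) : Summable fun j => ‖x ^ j‖ := by
  have h := (tendsto_zero_iff_norm_tendsto_zero.1 hx).eventually (Iic_mem_nhds (by norm_num : (0:ℝ) < 1 / 2))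
  obtain ⟨J, hJ⟩ := h.exists
  exact summable_norm_pow_of_norm_le x J hJ

/-- Convergence of all orbits gives summable powers. -/
theorem summable_norm_pow_of_forall_act {M : Matrix (Fin a) (Fin a) ℝ}
    (h : ∀ x, Tendsto (fun j => act (M ^ j) x) atTop (𝓝 0)) : Summable fun j => ‖M ^ j‖ := by
  apply summable_norm_pow_of_tendsto
  refine tendsto_pi_nhds.2 fun k => tendsto_pi_nhds.2 fun l => ?_
  have h1 := h (EuclideanSpace.single l 1)
  have h2 : Continuous fun z : Vec a => z k := by fun_prop
  have h3 := (h2.tendsto 0).comp h1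
  refine h3.congr fun j => ?_
  simp [act_apply]

/-- Square summable orbits tend to zero, so some power of the matrix is small in norm, and
summability follows. This is how energy estimates are turned into stability. -/
theorem summable_norm_pow_of_sum_le {M : Matrix (Fin a) (Fin a) ℝ} {f : Vec a → ℝ}
    (h : ∀ x T, ∑ j ∈ Finset.range T, ‖act (M ^ j) x‖ ^ 2 ≤ f x) :
    Summable fun j => ‖M ^ j‖ := by
  refine summable_norm_pow_of_forall_act fun x => ?_
  have hs : Summable fun j => ‖act (M ^ j) x‖ ^ 2 :=
    summable_of_sum_range_le (fun _ => by positivity) (h x)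
  have h0 := hs.tendsto_atTop_zero
  rw [tendsto_zero_iff_norm_tendsto_zero]
  have := h0.sqrt
  simpa [Real.sqrt_sq (norm_nonneg _)] using this

/-- Lyapunov's criterion. -/
theorem summable_norm_pow_of_lyapunov {M X W : Matrix (Fin a) (Fin a) ℝ} (hX : X.PosSemidef)
    (hW : W.PosDef) (h : ∀ x, quad X (act M x) + quad W x ≤ quad X x) :
    Summable fun j => ‖M ^ j‖ := by
  obtain ⟨r, hr, hrW⟩ := exists_pos_mul_le_quad_of_posDef hW
  refine summable_norm_pow_of_sum_le (f := fun x => quad X x / r) fun x T => ?_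
  have key : ∀ T, r * ∑ j ∈ Finset.range T, ‖act (M ^ j) x‖ ^ 2 + quad X (act (M ^ T) x)
      ≤ quad X x := by
    intro T
    induction T with
    | zero => simp [one_act]
    | succ T ih =>
      rw [Finset.sum_range_succ, pow_succ_act]
      linarith [h (act (M ^ T) x), hrW (act (M ^ T) x)]
  rw [le_div_iff₀ hr]
  linarith [key T, quad_nonneg hX (act (M ^ T) x)]

theorem summable_norm_pow_transpose {M : Matrix (Fin a) (Fin a) ℝ}
    (h : Summable fun j => ‖(Mᵀ) ^ j‖) : Summable fun j => ‖M ^ j‖ := by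
  refine h.congr fun j => ?_
  rw [← transpose_pow, ← conjTranspose_eq_transpose_of_trivial, l2_opNorm_conjTranspose]

/-- Gelfand's formula over ℂ gives geometric decay of the complexified powers; real parts of entries
bring it back to ℝ. -/
theorem summable_norm_pow_of_spectralRadius {M : Matrix (Fin a) (Fin a) ℝ}
    (h : matSpectralRadius M < 1) : Summable fun j => ‖M ^ j‖ := by
  have hg := spectrum.pow_nnnorm_pow_one_div_tendsto_nhds_spectralRadius (M.map Complex.ofReal)
  obtain ⟨r, hr1, hr2⟩ := exists_between (show spectralRadius ℂ (M.map Complex.ofReal) < 1 from h)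
  have hr : r ≠ ∞ := (hr2.trans ENNReal.one_lt_top).ne
  lift r to ℝ≥0 using hr
  have hev : ∀ᶠ j : ℕ in atTop, ‖(M.map Complex.ofReal) ^ j‖ ≤ (r : ℝ) ^ j := by
    filter_upwards [hg.eventually (gt_mem_nhds hr1), eventually_gt_atTop 0] with j hj hj0
    have hj0' : (0 : ℝ) < j := by exact_mod_cast hj0
    have := ENNReal.rpow_le_rpow hj.le hj0'.le
    rw [← ENNReal.rpow_mul, one_div, inv_mul_cancel₀ hj0'.ne', ENNReal.rpow_one,
      ENNReal.rpow_natCast] at this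
    exact_mod_cast this
  have hr1' : (r : ℝ) < 1 := by exact_mod_cast hr2
  have h0 : Tendsto (fun j => (M.map Complex.ofReal) ^ j) atTop (𝓝 0) :=
    squeeze_zero_norm' hev (tendsto_pow_atTop_nhds_zero_of_lt_one r.2 hr1')
  apply summable_norm_pow_of_tendsto
  refine tendsto_pi_nhds.2 fun k => tendsto_pi_nhds.2 fun l => ?_
  have h1 := tendsto_pi_nhds.1 (tendsto_pi_nhds.1 h0 k) l
  have h2 := (Complex.continuous_re.tendsto 0).comp h1
  refine h2.congr fun j => ?_
  have : M.map Complex.ofReal ^ j = (M ^ j).map Complex.ofReal :=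
    (map_pow (Complex.ofRealHom.mapMatrix) M j).symm
  simp [this]

/-! ### Stable linear recursions -/

/-- Dominated convergence with bound `f j * sup g`: for fixed `j` the factor `g (k - 1 - j)` tends
to zero. -/
theorem tendsto_convolution {f g : ℕ → ℝ} (hf : Summable f) (hf0 : ∀ j, 0 ≤ f j)
    (hg0 : ∀ j, 0 ≤ g j) (hg : Tendsto g atTop (𝓝 0)) :
    Tendsto (fun k => ∑ j ∈ Finset.range k, f j * g (k - 1 - j)) atTop (𝓝 0) := by
  obtain ⟨B, hB⟩ := hg.bddAbove_range
  replace hB : ∀ j, g j ≤ B := fun j => hB ⟨j, rfl⟩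
  have hB0 : 0 ≤ B := (hg0 0).trans (hB 0)
  have := tendsto_tsum_of_dominated_convergence (𝓕 := atTop)
    (f := fun (k : ℕ) (j : ℕ) => if j < k then f j * g (k - 1 - j) else 0) (g := fun _ => (0 : ℝ))
    (bound := fun j => f j * B) (hf.mul_right B) ?_ ?_
  · simp only [tsum_zero] at this
    refine this.congr fun k => ?_
    rw [tsum_eq_sum (s := Finset.range k)]
    · exact Finset.sum_congr rfl fun j hj => by simp [Finset.mem_range.1 hj]
    · intro j hj
      simp [Finset.mem_range] at hj
      simp [hj]
  · intro j
    have h1 : Tendsto (fun k : ℕ => f j * g (k - 1 - j)) atTop (𝓝 (f j * 0)) :=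
      (hg.comp (tendsto_atTop_mono (fun k => (by omega : k - (1 + j) ≤ k - 1 - j))
        (tendsto_sub_atTop_nat (1 + j)))).const_mul _
    rw [mul_zero] at h1
    refine h1.congr' ?_
    filter_upwards [eventually_gt_atTop j] with k hk
    simp [hk]
  · refine Eventually.of_forall fun k j => ?_
    split_ifs
    · rw [Real.norm_of_nonneg (mul_nonneg (hf0 j) (hg0 _))]
      exact mul_le_mul_of_nonneg_left (hB _) (hf0 j)
    · simpa using mul_nonneg (hf0 j) hB0

/-- The solution of `d (k + 1) = T (d k) + e k`. -/
theorem linear_recursion_eq {E : Type*} [AddCommGroup E] [Module ℝ E] (T : E →ₗ[ℝ] E)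
    {d e : ℕ → E} (hd : ∀ k, d (k + 1) = T (d k) + e k) (k : ℕ) :
    d k = (T ^ k) (d 0) + ∑ j ∈ Finset.range k, (T ^ j) (e (k - 1 - j)) := by
  induction k with
  | zero => simp
  | succ k ih =>
    rw [hd, ih, Finset.sum_range_succ', map_add, map_sum]
    simp only [pow_succ', Module.End.mul_apply, pow_zero, Module.End.one_apply]
    rw [add_assoc]
    congr 2
    refine Finset.sum_congr rfl fun j _ => ?_
    rw [show k + 1 - 1 - (j + 1) = k - 1 - j by omega]

/-- Variation of constants: the initial value decays and the forcing enters as a convolution with a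
summable kernel. -/
theorem tendsto_linear_recursion {E : Type*} [NormedAddCommGroup E] [NormedSpace ℝ E]
    (T : E →ₗ[ℝ] E) {f : ℕ → ℝ} (hf : Summable f) (hT : ∀ j x, ‖(T ^ j) x‖ ≤ f j * ‖x‖)
    (hf0 : ∀ j, 0 ≤ f j)
    {d e : ℕ → E} (hd : ∀ k, d (k + 1) = T (d k) + e k) (he : Tendsto e atTop (𝓝 0)) :
    Tendsto d atTop (𝓝 0) := by
  rw [funext (linear_recursion_eq T hd)]
  rw [← add_zero (0 : E)]
  refine Tendsto.add ?_ ?_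
  · refine squeeze_zero_norm (fun k => hT k _) ?_
    simpa using hf.tendsto_atTop_zero.mul_const ‖d 0‖
  · refine squeeze_zero_norm (fun k => ?_)
      (tendsto_convolution hf hf0 (fun _ => norm_nonneg _) (tendsto_zero_iff_norm_tendsto_zero.1 he))
    exact (norm_sum_le _ _).trans (Finset.sum_le_sum fun j _ => hT j _)

/-- The map `X ↦ M X Mᵀ`. -/
def congrMap (M : Matrix (Fin a) (Fin a) ℝ) :
    Matrix (Fin a) (Fin a) ℝ →ₗ[ℝ] Matrix (Fin a) (Fin a) ℝ where
  toFun X := M * X * Mᵀ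
  map_add' X Y := by rw [Matrix.mul_add, Matrix.add_mul]
  map_smul' r X := by simp

theorem congrMap_apply (M X : Matrix (Fin a) (Fin a) ℝ) : congrMap M X = M * X * Mᵀ := rfl

theorem congrMap_pow_apply (M X : Matrix (Fin a) (Fin a) ℝ) (j : ℕ) :
    (congrMap M ^ j) X = M ^ j * X * (M ^ j)ᵀ := by
  induction j with
  | zero => simp
  | succ j ih =>
    rw [pow_succ', Module.End.mul_apply, ih, congrMap_apply, pow_succ' M, transpose_mul]
    simp only [Matrix.mul_assoc]

theorem norm_transpose (M : Matrix (Fin a) (Fin b) ℝ) : ‖Mᵀ‖ = ‖M‖ := by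
  rw [← conjTranspose_eq_transpose_of_trivial, l2_opNorm_conjTranspose]

theorem norm_congrMap_pow_le (M X : Matrix (Fin a) (Fin a) ℝ) (j : ℕ) :
    ‖(congrMap M ^ j) X‖ ≤ ‖M ^ j‖ ^ 2 * ‖X‖ := by
  rw [congrMap_pow_apply]
  calc _ ≤ ‖M ^ j‖ * ‖X‖ * ‖(M ^ j)ᵀ‖ := by
        refine (norm_mul_le _ _).trans ?_
        gcongr
        exact norm_mul_le _ _
    _ = _ := by rw [norm_transpose]; ring

theorem summable_sq {f : ℕ → ℝ} (hf0 : ∀ j, 0 ≤ f j) (hf : Summable f) :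
    Summable fun j => f j ^ 2 := by
  have h : ∀ᶠ j in cofinite, ‖f j ^ 2‖ ≤ f j := by
    rw [Nat.cofinite_eq_atTop]
    filter_upwards [hf.tendsto_atTop_zero.eventually (gt_mem_nhds one_pos)] with j hj
    rw [Real.norm_of_nonneg (by positivity)]
    nlinarith [hf0 j]
  exact Summable.of_norm_bounded_eventually hf h

/-- A stable Lyapunov recursion with a vanishing perturbation. -/
theorem tendsto_lyapunov_recursion {M : Matrix (Fin a) (Fin a) ℝ} (hM : Summable fun j => ‖M ^ j‖)
    {d e : ℕ → Matrix (Fin a) (Fin a) ℝ} (hd : ∀ k, d (k + 1) = M * d k * Mᵀ + e k)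
    (he : Tendsto e atTop (𝓝 0)) : Tendsto d atTop (𝓝 0) :=
  tendsto_linear_recursion (congrMap M) (summable_sq (fun _ => norm_nonneg _) hM)
    (fun j x => norm_congrMap_pow_le M x j) (fun _ => by positivity) hd he

end LinearAlgebra

namespace Loop

-- The Riccati equations of the filter and of the control.

section Riccati

open scoped Matrix.Norms.L2Operator Topology

variable (S : Loop)

/-- The innovation covariance `C X Cᵀ + V` for the prediction error covariance `X`. -/
def innovCov (X : Matrix (Fin S.n) (Fin S.n) ℝ) : Matrix (Fin S.o) (Fin S.o) ℝ :=
  S.C * X * S.Cᵀ + S.V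

/-- The Kalman gain for the prediction error covariance `X`. -/
noncomputable def filterGain (X : Matrix (Fin S.n) (Fin S.n) ℝ) : Matrix (Fin S.n) (Fin S.o) ℝ :=
  X * S.Cᵀ * (S.innovCov X)⁻¹

/-- The filtering error covariance for the prediction error covariance `X`. -/
noncomputable def filterCov (X : Matrix (Fin S.n) (Fin S.n) ℝ) : Matrix (Fin S.n) (Fin S.n) ℝ :=
  X - S.filterGain X * S.innovCov X * (S.filterGain X)ᵀ

/-- The filtering error covariance when the gain `G` is used. -/
def joseph (G : Matrix (Fin S.n) (Fin S.o) ℝ) (X : Matrix (Fin S.n) (Fin S.n) ℝ) :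
    Matrix (Fin S.n) (Fin S.n) ℝ :=
  (1 - G * S.C) * X * (1 - G * S.C)ᵀ + G * S.V * Gᵀ

/-- The prediction error covariances of the Kalman filter for a known initial state. -/
noncomputable def riccatiSeq : ℕ → Matrix (Fin S.n) (Fin S.n) ℝ
  | 0 => 0
  | k + 1 => S.predCov (S.filterCov (riccatiSeq k))

variable {S}

theorem posSemidef_mul_mul_transpose {a b : ℕ} {X : Matrix (Fin a) (Fin a) ℝ} (hX : X.PosSemidef)
    (M : Matrix (Fin b) (Fin a) ℝ) : (M * X * Mᵀ).PosSemidef := by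
  simpa using hX.mul_mul_conjTranspose_same M

theorem innovCov_posDef (hS : S.Regular) {X : Matrix (Fin S.n) (Fin S.n) ℝ} (hX : X.PosSemidef) :
    (S.innovCov X).PosDef :=
  PosDef.posSemidef_add (posSemidef_mul_mul_transpose hX S.C) hS.V_posDef

theorem filterGain_mul_innovCov (hS : S.Regular) {X : Matrix (Fin S.n) (Fin S.n) ℝ}
    (hX : X.PosSemidef) : S.filterGain X * S.innovCov X = X * S.Cᵀ := by
  have := (Matrix.isUnit_iff_isUnit_det _).1 (innovCov_posDef hS hX).isUnit
  rw [filterGain, Matrix.mul_assoc, nonsing_inv_mul _ this, Matrix.mul_one]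

theorem innovCov_mul_filterGain (hS : S.Regular) {X : Matrix (Fin S.n) (Fin S.n) ℝ}
    (hX : X.PosSemidef) : S.innovCov X * (S.filterGain X)ᵀ = S.C * X := by
  have h := congrArg transpose (filterGain_mul_innovCov hS hX)
  simpa [transpose_mul, transpose_eq_of_posSemidef (innovCov_posDef hS hX).posSemidef,
    transpose_eq_of_posSemidef hX] using h

/-- Completing the square in the gain. The excess over `filterCov` is positive semidefinite, which
is the optimality of the Kalman gain. -/
theorem joseph_eq (hS : S.Regular) (G : Matrix (Fin S.n) (Fin S.o) ℝ)
    {X : Matrix (Fin S.n) (Fin S.n) ℝ} (hX : X.PosSemidef) :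
    S.joseph G X = S.filterCov X
      + (G - S.filterGain X) * S.innovCov X * (G - S.filterGain X)ᵀ := by
  have h1 := filterGain_mul_innovCov hS hX
  have h2 := innovCov_mul_filterGain hS hX
  have h3 : (G - S.filterGain X) * S.innovCov X * (G - S.filterGain X)ᵀ =
      G * S.innovCov X * Gᵀ - G * (S.innovCov X * (S.filterGain X)ᵀ)
        - (S.filterGain X * S.innovCov X) * Gᵀ
        + S.filterGain X * S.innovCov X * (S.filterGain X)ᵀ := by
    simp only [transpose_sub, Matrix.sub_mul, Matrix.mul_sub, Matrix.mul_assoc]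
    abel
  rw [h3, h1, h2, filterCov, h1, joseph, innovCov]
  simp only [transpose_sub, transpose_mul, transpose_one, Matrix.sub_mul, Matrix.mul_sub,
    Matrix.mul_add, Matrix.add_mul, Matrix.mul_assoc, Matrix.one_mul, Matrix.mul_one]
  abel

theorem joseph_filterGain (hS : S.Regular) {X : Matrix (Fin S.n) (Fin S.n) ℝ} (hX : X.PosSemidef) :
    S.joseph (S.filterGain X) X = S.filterCov X := by
  simp [joseph_eq hS _ hX]

theorem joseph_posSemidef (hS : S.Regular) (G : Matrix (Fin S.n) (Fin S.o) ℝ)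
    {X : Matrix (Fin S.n) (Fin S.n) ℝ} (hX : X.PosSemidef) : (S.joseph G X).PosSemidef :=
  (posSemidef_mul_mul_transpose hX _).add (posSemidef_mul_mul_transpose hS.V_posDef.posSemidef _)

theorem filterCov_posSemidef (hS : S.Regular) {X : Matrix (Fin S.n) (Fin S.n) ℝ}
    (hX : X.PosSemidef) : (S.filterCov X).PosSemidef := by
  rw [← joseph_filterGain hS hX]
  exact joseph_posSemidef hS _ hX

theorem predCov_posSemidef (hS : S.Regular) {X : Matrix (Fin S.n) (Fin S.n) ℝ}
    (hX : X.PosSemidef) : (S.predCov X).PosSemidef :=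
  (posSemidef_mul_mul_transpose hX _).add hS.W_posDef.posSemidef

theorem filterCov_mul_transpose (hS : S.Regular) {X : Matrix (Fin S.n) (Fin S.n) ℝ}
    (hX : X.PosSemidef) : S.filterCov X * S.Cᵀ = S.filterGain X * S.V := by
  have h1 := filterGain_mul_innovCov hS hX
  have h2 := innovCov_mul_filterGain hS hX
  rw [filterCov, Matrix.mul_assoc (S.filterGain X), h2, Matrix.sub_mul, ← h1, innovCov]
  simp only [Matrix.mul_add, Matrix.mul_assoc]
  abel

/-- The nonlinear Riccati map has exactly bilinear differences: each side carries the optimal gain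
of its own argument. Iterating this reduces convergence to the behaviour of two products of
matrices. -/
theorem filterCov_sub (hS : S.Regular) {X Y : Matrix (Fin S.n) (Fin S.n) ℝ}
    (hX : X.PosSemidef) (hY : Y.PosSemidef) :
    S.filterCov X - S.filterCov Y =
      (1 - S.filterGain X * S.C) * (X - Y) * (1 - S.filterGain Y * S.C)ᵀ := by
  have hX1 : S.filterCov X = (1 - S.filterGain X * S.C) * X := by
    rw [filterCov, Matrix.mul_assoc, innovCov_mul_filterGain hS hX, Matrix.sub_mul,
      Matrix.one_mul, Matrix.mul_assoc]
  have hY1 : S.filterCov Y = Y * (1 - S.filterGain Y * S.C)ᵀ := by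
    rw [filterCov, filterGain_mul_innovCov hS hY, transpose_sub, transpose_mul, Matrix.mul_sub,
      transpose_one, Matrix.mul_one, Matrix.mul_assoc]
  have hX2 := filterCov_mul_transpose hS hX
  have hY2 : S.C * S.filterCov Y = S.V * (S.filterGain Y)ᵀ := by
    have := congrArg transpose (filterCov_mul_transpose hS hY)
    simpa [transpose_mul, transpose_eq_of_posSemidef (filterCov_posSemidef hS hY),
      transpose_eq_of_posSemidef hS.V_posDef.posSemidef] using this
  rw [Matrix.mul_sub, Matrix.sub_mul, ← hX1, Matrix.mul_assoc _ Y, ← hY1, transpose_sub,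
    transpose_mul, transpose_one, Matrix.mul_sub, Matrix.sub_mul, Matrix.mul_one, Matrix.one_mul,
    ← Matrix.mul_assoc, hX2, Matrix.mul_assoc _ S.C, hY2, Matrix.mul_assoc]
  abel

theorem riccatiSeq_posSemidef (hS : S.Regular) : ∀ k, (S.riccatiSeq k).PosSemidef
  | 0 => PosSemidef.zero
  | k + 1 => predCov_posSemidef hS (filterCov_posSemidef hS (riccatiSeq_posSemidef hS k))

theorem predCov_joseph (G : Matrix (Fin S.n) (Fin S.o) ℝ) (X : Matrix (Fin S.n) (Fin S.n) ℝ) :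
    S.predCov (S.joseph G X) = (S.A * (1 - G * S.C)) * X * (S.A * (1 - G * S.C))ᵀ
      + (S.A * G) * S.V * (S.A * G)ᵀ + S.W := by
  simp only [predCov, joseph, transpose_mul, Matrix.mul_add, Matrix.add_mul, Matrix.mul_assoc]

theorem quad_transpose_act {a b : ℕ} (X : Matrix (Fin a) (Fin a) ℝ) (M : Matrix (Fin b) (Fin a) ℝ)
    (x : Vec b) : quad X (act Mᵀ x) = quad (M * X * Mᵀ) x := by
  rw [quad_act, transpose_transpose]

-- Convergence of the filter Riccati recursion started at zero.

section FixedPoint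

variable {Θ : Matrix (Fin S.n) (Fin S.n) ℝ}

theorem IsFilterRiccati.filterCov_eq (h : S.IsFilterRiccati Θ) : S.filterCov (S.predCov Θ) = Θ :=
  h.2.symm

/-- The Riccati equation read as a Lyapunov equation for the closed error dynamics A(1 - FC). -/
theorem IsFilterRiccati.predCov_eq (hS : S.Regular) (h : S.IsFilterRiccati Θ) :
    S.predCov Θ = (S.A * (1 - S.filterGain (S.predCov Θ) * S.C)) * S.predCov Θ *
        (S.A * (1 - S.filterGain (S.predCov Θ) * S.C))ᵀ
      + (S.A * S.filterGain (S.predCov Θ)) * S.V * (S.A * S.filterGain (S.predCov Θ))ᵀ + S.W := by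
  rw [← predCov_joseph, joseph_filterGain hS (predCov_posSemidef hS h.1), h.filterCov_eq]

/-- The error dynamics of the stationary Kalman filter is stable. -/
theorem IsFilterRiccati.summable (hS : S.Regular) (h : S.IsFilterRiccati Θ) :
    Summable fun j => ‖(S.A * (1 - S.filterGain (S.predCov Θ) * S.C)) ^ j‖ := by
  have hX := predCov_posSemidef hS h.1
  -- As quadratic forms, the Lyapunov equation decreases along orbits of the transpose; the positive
  -- definite W makes the decrease strict.
  apply summable_norm_pow_transpose
  refine summable_norm_pow_of_lyapunov hX hS.W_posDef fun x => ?_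
  have h1 := h.predCov_eq hS
  rw [quad_transpose_act]
  conv_rhs => rw [h1]
  rw [add_quad, add_quad]
  have := quad_nonneg (posSemidef_mul_mul_transpose hS.V_posDef.posSemidef
    (S.A * S.filterGain (S.predCov Θ))) x
  linarith

/-- Using the stationary gain at each step is suboptimal for the sequence, and with that gain fixed
the update is monotone. Induction starts from 0, which lies below the fixed point. -/
theorem riccatiSeq_le (hS : S.Regular) (h : S.IsFilterRiccati Θ) (k : ℕ) (x : Vec S.n) :
    quad (S.riccatiSeq k) x ≤ quad (S.predCov Θ) x := by
  have hX := predCov_posSemidef hS h.1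
  induction k generalizing x with
  | zero => simpa [riccatiSeq, quad] using quad_nonneg hX x
  | succ k ih =>
    have h1 := h.predCov_eq hS
    have h2 := joseph_eq hS (S.filterGain (S.predCov Θ)) (riccatiSeq_posSemidef hS k)
    set D := (S.filterGain (S.predCov Θ) - S.filterGain (S.riccatiSeq k)) *
      S.innovCov (S.riccatiSeq k) *
        (S.filterGain (S.predCov Θ) - S.filterGain (S.riccatiSeq k))ᵀ with hD
    have hDp : D.PosSemidef := posSemidef_mul_mul_transpose
      (innovCov_posDef hS (riccatiSeq_posSemidef hS k)).posSemidef _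
    have h3 : S.predCov (S.joseph (S.filterGain (S.predCov Θ)) (S.riccatiSeq k)) =
        S.riccatiSeq (k + 1) + S.A * D * S.Aᵀ := by
      rw [h2, riccatiSeq, predCov, predCov, Matrix.mul_add, Matrix.add_mul]
      abel
    have h4 : quad (S.riccatiSeq (k + 1)) x ≤
        quad (S.predCov (S.joseph (S.filterGain (S.predCov Θ)) (S.riccatiSeq k))) x := by
      rw [h3, add_quad]
      linarith [quad_nonneg (posSemidef_mul_mul_transpose hDp S.A) x]
    refine h4.trans ?_
    conv_rhs => rw [h1]
    rw [predCov_joseph]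
    simp only [add_quad]
    have := ih (act (S.A * (1 - S.filterGain (S.predCov Θ) * S.C))ᵀ x)
    rw [quad_transpose_act, quad_transpose_act] at this
    linarith

/-- The error dynamics of the time-varying Kalman filter, from time `1` to time `k + 1`. -/
noncomputable def errorTransition (S : Loop) : ℕ → Matrix (Fin S.n) (Fin S.n) ℝ
  | 0 => 1
  | k + 1 => S.A * (1 - S.filterGain (S.riccatiSeq (k + 1)) * S.C) * errorTransition S k

/-- The disturbance entering at time 0 is carried along by the transition matrices and is only one
summand of the later covariance. Counting starts at time 1 because the covariance there dominates W,
while at time 0 it is 0. -/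
theorem errorTransition_le (hS : S.Regular) (k : ℕ) (x : Vec S.n) :
    quad S.W (act (S.errorTransition k)ᵀ x) ≤ quad (S.riccatiSeq (k + 1)) x := by
  induction k generalizing x with
  | zero =>
    have := quad_nonneg (posSemidef_mul_mul_transpose (filterCov_posSemidef hS PosSemidef.zero) S.A) x
    simp only [errorTransition, transpose_one, one_act, riccatiSeq, predCov, add_quad]
    linarith
  | succ k ih =>
    rw [riccatiSeq, ← joseph_filterGain hS (riccatiSeq_posSemidef hS _), predCov_joseph, add_quad,
      add_quad, errorTransition, transpose_mul, mul_act]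
    have h1 := ih (act (S.A * (1 - S.filterGain (S.riccatiSeq (k + 1)) * S.C))ᵀ x)
    rw [quad_transpose_act _ _ x] at h1
    have h2 := quad_nonneg (posSemidef_mul_mul_transpose hS.V_posDef.posSemidef
      (S.A * S.filterGain (S.riccatiSeq (k + 1)))) x
    have h3 := quad_nonneg hS.W_posDef.posSemidef x
    linarith

theorem norm_le_of_forall_act {a b : ℕ} {M : Matrix (Fin a) (Fin b) ℝ} {r : ℝ} (hr : 0 ≤ r)
    (h : ∀ x, ‖act M x‖ ≤ r * ‖x‖) : ‖M‖ ≤ r := by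
  rw [l2_opNorm_def]
  exact ContinuousLinearMap.opNorm_le_bound _ hr h

/-- Sandwich: the form of W along the transposed transitions lies below `riccatiSeq`, which lies
below the fixed point. Positive definiteness of W makes this a norm bound. -/
theorem exists_norm_errorTransition_le (hS : S.Regular) (h : S.IsFilterRiccati Θ) :
    ∃ B, ∀ k, ‖S.errorTransition k‖ ≤ B := by
  obtain ⟨r, hr, hW⟩ := exists_pos_mul_le_quad_of_posDef hS.W_posDef
  refine ⟨√(‖S.predCov Θ‖ / r), fun k => ?_⟩
  rw [← norm_transpose]
  refine norm_le_of_forall_act (by positivity) fun x => ?_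
  have h1 := (hW _).trans ((errorTransition_le hS k x).trans ((riccatiSeq_le hS h _ x).trans
    ((le_abs_self _).trans (quad_le_norm _ x))))
  rw [← Real.sqrt_sq (norm_nonneg x), ← Real.sqrt_mul (by positivity)]
  refine Real.le_sqrt_of_sq_le ?_
  rw [div_mul_eq_mul_div, le_div_iff₀ hr]
  linarith

/-- Iterated `filterCov_sub`. The left factor is bounded and the right one decays, so only the
stationary dynamics has to be known stable. -/
theorem riccatiSeq_sub (hS : S.Regular) (h : S.IsFilterRiccati Θ) (k : ℕ) :
    S.riccatiSeq (k + 1) - S.predCov Θ = S.errorTransition k * (S.riccatiSeq 1 - S.predCov Θ) *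
      ((S.A * (1 - S.filterGain (S.predCov Θ) * S.C)) ^ k)ᵀ := by
  induction k with
  | zero => simp [errorTransition]
  | succ k ih =>
    have h1 : S.predCov Θ = S.predCov (S.filterCov (S.predCov Θ)) := by rw [h.filterCov_eq]
    have h2 : ∀ X Y, S.predCov X - S.predCov Y = S.A * (X - Y) * S.Aᵀ := fun X Y => by
      simp only [predCov, Matrix.mul_sub, Matrix.sub_mul]
      abel
    conv_lhs => rw [riccatiSeq, h1, h2, filterCov_sub hS (riccatiSeq_posSemidef hS _)
      (predCov_posSemidef hS h.1), ih]
    rw [errorTransition, pow_succ' (S.A * _)]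
    simp only [transpose_mul, Matrix.mul_assoc]

theorem tendsto_riccatiSeq (hS : S.Regular) (h : S.IsFilterRiccati Θ) :
    Tendsto S.riccatiSeq atTop (𝓝 (S.predCov Θ)) := by
  obtain ⟨B, hB⟩ := exists_norm_errorTransition_le hS h
  rw [← tendsto_add_atTop_iff_nat 1, tendsto_iff_norm_sub_tendsto_zero]
  refine squeeze_zero (g := fun k => B * ‖S.riccatiSeq 1 - S.predCov Θ‖ *
    ‖(S.A * (1 - S.filterGain (S.predCov Θ) * S.C)) ^ k‖) (fun _ => norm_nonneg _) (fun k => ?_) ?_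
  · rw [riccatiSeq_sub hS h]
    refine (norm_mul_le _ _).trans ?_
    rw [norm_transpose]
    gcongr
    refine (norm_mul_le _ _).trans ?_
    gcongr
    exact hB k
  · simpa using (h.summable hS).tendsto_atTop_zero.const_mul (B * ‖S.riccatiSeq 1 - S.predCov Θ‖)

theorem continuousAt_matrix_mul {Z : Type*} [TopologicalSpace Z] {a b c : ℕ}
    {f : Z → Matrix (Fin a) (Fin b) ℝ} {g : Z → Matrix (Fin b) (Fin c) ℝ} {z : Z}
    (hf : ContinuousAt f z) (hg : ContinuousAt g z) : ContinuousAt (fun z => f z * g z) z :=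
  ContinuousAt.comp (g := fun p : Matrix (Fin a) (Fin b) ℝ × Matrix (Fin b) (Fin c) ℝ => p.1 * p.2)
    (continuous_fst.matrix_mul continuous_snd).continuousAt (hf.prodMk hg)

theorem tendsto_filterCov (hS : S.Regular) {X : ℕ → Matrix (Fin S.n) (Fin S.n) ℝ}
    {Y : Matrix (Fin S.n) (Fin S.n) ℝ} (hY : Y.PosSemidef) (hX : Tendsto X atTop (𝓝 Y)) :
    Tendsto (fun k => S.filterCov (X k)) atTop (𝓝 (S.filterCov Y)) := by
  have hI : Continuous S.innovCov := by
    unfold innovCov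
    fun_prop
  have hinv : ContinuousAt (fun X => (S.innovCov X)⁻¹) Y := by
    simp only [nonsing_inv_eq_ringInverse]
    obtain ⟨U, hU⟩ := (innovCov_posDef hS hY).isUnit
    refine ContinuousAt.comp (g := Ring.inverse) ?_ hI.continuousAt
    rw [← hU]
    exact NormedRing.inverse_continuousAt U
  have hg : ContinuousAt S.filterGain Y := by
    unfold filterGain
    exact continuousAt_matrix_mul (by fun_prop) hinv
  have hf : ContinuousAt S.filterCov Y := by
    unfold filterCov
    exact continuousAt_id.sub (continuousAt_matrix_mul
      (continuousAt_matrix_mul hg hI.continuousAt) (continuous_id.matrix_transpose.continuousAt.comp hg))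
  exact hf.tendsto.comp hX

end FixedPoint

/-! ### The control Riccati equation -/

section Control

variable {P : Matrix (Fin S.n) (Fin S.n) ℝ}

/-- The weight `Bᵀ P B + R` of the deviation from the optimal input. -/
def inputWeight (S : Loop) (P : Matrix (Fin S.n) (Fin S.n) ℝ) : Matrix (Fin S.m) (Fin S.m) ℝ :=
  S.Bᵀ * P * S.B + S.R

theorem inputWeight_posDef (hS : S.Regular) (hP : P.PosSemidef) : (S.inputWeight P).PosDef := by
  have := posSemidef_mul_mul_transpose hP S.Bᵀ
  rw [transpose_transpose] at this
  exact PosDef.posSemidef_add this hS.R_posDef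

theorem inputWeight_mul_controlGain (hS : S.Regular) (hP : P.PosSemidef) :
    S.inputWeight P * S.controlGain P = -(S.Bᵀ * P * S.A) := by
  have := (Matrix.isUnit_iff_isUnit_det _).1 (inputWeight_posDef hS hP).isUnit
  change S.inputWeight P * -((S.inputWeight P)⁻¹ * S.Bᵀ * P * S.A) = _
  rw [Matrix.mul_neg, Matrix.mul_assoc, Matrix.mul_assoc, ← Matrix.mul_assoc, mul_nonsing_inv _ this,
    Matrix.one_mul, Matrix.mul_assoc]

theorem dotProduct_mulVec_act {a b c : ℕ} (M : Matrix (Fin b) (Fin c) ℝ)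
    (N : Matrix (Fin b) (Fin a) ℝ) (x : Vec a) (y : Vec c) :
    (act N x).ofLp ⬝ᵥ (M *ᵥ y.ofLp) = x.ofLp ⬝ᵥ ((Nᵀ * M) *ᵥ y.ofLp) := by
  rw [ofLp_act, ← mulVec_mulVec, dotProduct_mulVec x.ofLp, vecMul_transpose]

/-- Completing the square. -/
theorem IsControlRiccati.complete_square (hS : S.Regular) (h : S.IsControlRiccati P) (x : Vec S.n)
    (u : Vec S.m) :
    quad P (act S.A x + act S.B u) + quad S.Q x + quad S.R u =
      quad P x + quad (S.inputWeight P) (u - act (S.controlGain P) x) := by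
  have hPs := transpose_eq_of_posSemidef h.1
  have hΛ := transpose_eq_of_posSemidef (inputWeight_posDef hS h.1).posSemidef
  have h1 := congrArg (fun M => quad M x) h.2
  simp only [add_quad, sub_quad] at h1
  have h2 : quad (S.gainWeight P) x = quad (S.inputWeight P) (act (S.controlGain P) x) := by
    rw [quad_act]; rfl
  have h3 : quad (S.inputWeight P) u = quad P (act S.B u) + quad S.R u := by
    rw [inputWeight, add_quad, quad_act]
  have h4 : u.ofLp ⬝ᵥ (S.inputWeight P *ᵥ (act (S.controlGain P) x).ofLp) =
      -((act S.B u).ofLp ⬝ᵥ (P *ᵥ (act S.A x).ofLp)) := by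
    rw [dotProduct_mulVec_act, ofLp_act, ofLp_act, mulVec_mulVec, mulVec_mulVec,
      inputWeight_mul_controlGain hS h.1, neg_mulVec, dotProduct_neg]
  rw [sub_eq_add_neg, quad_add hΛ, quad_neg, ← h2, add_comm (act S.A x), quad_add hPs, quad_act _ S.A,
    h3]
  simp only [WithLp.ofLp_neg, mulVec_neg, dotProduct_neg, h4]
  linarith

/-- The observability Gramian is positive definite: a vector with zero total weight is annihilated
by all Q^{1/2} A^k with k < n. -/
theorem exists_sum_quad_lower_bound (hS : S.Regular) :
    ∃ r > 0, ∀ x : Vec S.n,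
      r * ‖x‖ ^ 2 ≤ ∑ k ∈ Finset.range S.n, quad S.Q (act (S.A ^ k) x) := by
  have hsum : ∀ x, quad (∑ k ∈ Finset.range S.n, (S.A ^ k)ᵀ * S.Q * S.A ^ k) x =
      ∑ k ∈ Finset.range S.n, quad S.Q (act (S.A ^ k) x) := fun x => by
    simp only [quad_act]
    simp only [quad, sum_mulVec, dotProduct_sum]
  simp_rw [← hsum]
  refine exists_pos_mul_le_quad fun x hx => ?_
  rw [hsum]
  have hnn : ∀ k ∈ Finset.range S.n, 0 ≤ quad S.Q (act (S.A ^ k) x) :=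
    fun k _ => quad_nonneg hS.Q_posSemidef _
  refine (Finset.sum_nonneg hnn).lt_of_ne fun h0 => hx ?_
  have h1 := (Finset.sum_eq_zero_iff_of_nonneg hnn).1 h0.symm
  have hsq : CFC.sqrt S.Q * CFC.sqrt S.Q = S.Q := CFC.sqrt_mul_sqrt_self _ hS.Q_posSemidef.nonneg
  have hsT : (CFC.sqrt S.Q)ᵀ = CFC.sqrt S.Q :=
    transpose_eq_of_posSemidef (nonneg_iff_posSemidef.1 (CFC.sqrt_nonneg S.Q))
  have hmem : x.ofLp ∈ (⨅ k : Fin S.n, LinearMap.ker (CFC.sqrt S.Q * S.A ^ (k : ℕ)).mulVecLin) := by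
    simp only [Submodule.mem_iInf, LinearMap.mem_ker, mulVecLin_apply]
    intro k
    have h2 := h1 k (Finset.mem_range.2 k.2)
    have h3 : ‖act (CFC.sqrt S.Q * S.A ^ (k : ℕ)) x‖ ^ 2 = 0 := by
      rw [← quad_one, mul_act, quad_act, Matrix.mul_one, hsT, hsq, h2]
    have h4 : act (CFC.sqrt S.Q * S.A ^ (k : ℕ)) x = 0 := by simpa using h3
    exact congrArg WithLp.ofLp h4
  rw [hS.observable_cost] at hmem
  simpa using hmem

/-- The deviation from the free orbit is linear in the inputs and disturbances. The factor 3 comes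
from squaring a sum of three terms. -/
theorem exists_norm_sq_residual_le (S : Loop) (k : ℕ) :
    ∃ c, 0 ≤ c ∧ ∀ (x : ℕ → Vec S.n) (u : ℕ → Vec S.m) (w : ℕ → Vec S.n),
      (∀ k, x (k + 1) = act S.A (x k) + act S.B (u k) + w k) →
      ‖x k - act (S.A ^ k) (x 0)‖ ^ 2 ≤ c * ∑ l ∈ Finset.range k, (‖u l‖ ^ 2 + ‖w l‖ ^ 2) := by
  induction k with
  | zero => exact ⟨0, le_rfl, fun x u w _ => by simp [one_act]⟩
  | succ k ih =>
    obtain ⟨c, hc, h⟩ := ih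
    refine ⟨3 * (‖S.A‖ ^ 2 * c + ‖S.B‖ ^ 2 + 1), by positivity, fun x u w hx => ?_⟩
    have h1 := h x u w hx
    set E := ∑ l ∈ Finset.range k, (‖u l‖ ^ 2 + ‖w l‖ ^ 2) with hE
    have hE0 : 0 ≤ E := Finset.sum_nonneg fun _ _ => by positivity
    rw [Finset.sum_range_succ, ← hE]
    set r := x k - act (S.A ^ k) (x 0) with hr
    have h2 : x (k + 1) - act (S.A ^ (k + 1)) (x 0) = act S.A r + act S.B (u k) + w k := by
      rw [hx, pow_succ_act, hr, act_sub]
      abel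
    rw [h2]
    have h3 : ‖act S.A r + act S.B (u k) + w k‖ ≤ ‖S.A‖ * ‖r‖ + ‖S.B‖ * ‖u k‖ + ‖w k‖ :=
      (norm_add₃_le).trans (by gcongr <;> exact norm_act_le _ _)
    have h4 : ‖act S.A r + act S.B (u k) + w k‖ ^ 2 ≤
        3 * ((‖S.A‖ * ‖r‖) ^ 2 + (‖S.B‖ * ‖u k‖) ^ 2 + ‖w k‖ ^ 2) := by
      refine (pow_le_pow_left₀ (norm_nonneg _) h3 2).trans ?_
      nlinarith [sq_nonneg (‖S.A‖ * ‖r‖ - ‖S.B‖ * ‖u k‖), sq_nonneg (‖S.A‖ * ‖r‖ - ‖w k‖),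
        sq_nonneg (‖S.B‖ * ‖u k‖ - ‖w k‖)]
    have h5 : (‖S.A‖ * ‖r‖) ^ 2 ≤ ‖S.A‖ ^ 2 * (c * E) := by
      rw [mul_pow]; gcongr
    refine h4.trans ?_
    have p1 : 0 ≤ ‖S.A‖ ^ 2 * c := by positivity
    have p2 : 0 ≤ ‖S.B‖ ^ 2 := by positivity
    have p3 : 0 ≤ ‖u k‖ ^ 2 := by positivity
    have p4 : 0 ≤ ‖w k‖ ^ 2 := by positivity
    rw [mul_pow] at h5 ⊢
    nlinarith [mul_nonneg p1 p3, mul_nonneg p1 p4, mul_nonneg p2 hE0, mul_nonneg p2 p4]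

/-- Observability of the cost: the stage costs and disturbances over `n` steps bound the state. -/
theorem exists_norm_sq_le_sum (hS : S.Regular) :
    ∃ c, 0 ≤ c ∧ ∀ (x : ℕ → Vec S.n) (u : ℕ → Vec S.m) (w : ℕ → Vec S.n),
      (∀ k, x (k + 1) = act S.A (x k) + act S.B (u k) + w k) →
      ‖x 0‖ ^ 2 ≤ c * ∑ k ∈ Finset.range S.n,
        (quad S.Q (x k) + quad S.R (u k) + ‖w k‖ ^ 2) := by
  obtain ⟨r, hr, hQ⟩ := exists_sum_quad_lower_bound hS
  obtain ⟨ρ, hρ, hR⟩ := exists_pos_mul_le_quad_of_posDef hS.R_posDef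
  choose f hf0 hf using exists_norm_sq_residual_le S
  set c₁ := ∑ k ∈ Finset.range S.n, f k with hc₁
  have hc₁0 : 0 ≤ c₁ := Finset.sum_nonneg fun k _ => hf0 k
  -- `r` is the Gramian bound and the 2's come from `quad_add_le`. `c₁` collects the deviations from
  -- the free orbit, and `1 / ρ` converts ‖u‖² into the weight R.
  refine ⟨(2 + 2 * ‖S.Q‖ * c₁ * (1 / ρ + 1)) / r, by positivity, fun x u w hx => ?_⟩
  set E := ∑ l ∈ Finset.range S.n, (‖u l‖ ^ 2 + ‖w l‖ ^ 2) with hE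
  set Z := ∑ k ∈ Finset.range S.n, (quad S.Q (x k) + quad S.R (u k) + ‖w k‖ ^ 2) with hZ
  have hEZ : E ≤ (1 / ρ + 1) * Z := by
    rw [hE, hZ, Finset.mul_sum]
    refine Finset.sum_le_sum fun k _ => ?_
    have h1 : ‖u k‖ ^ 2 ≤ 1 / ρ * quad S.R (u k) := by
      rw [one_div, ← div_eq_inv_mul, le_div_iff₀ hρ, mul_comm]
      exact hR _
    have h2 := quad_nonneg hS.Q_posSemidef (x k)
    have h3 := quad_nonneg hS.R_posDef.posSemidef (u k)
    have h4 : 0 ≤ 1 / ρ := by positivity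
    nlinarith [sq_nonneg ‖w k‖, mul_nonneg h4 h2, mul_nonneg h4 (sq_nonneg ‖w k‖)]
  have hQZ : ∑ k ∈ Finset.range S.n, quad S.Q (x k) ≤ Z :=
    Finset.sum_le_sum fun k _ => by
      linarith [quad_nonneg hS.R_posDef.posSemidef (u k), sq_nonneg ‖w k‖]
  have hterm : ∀ k ∈ Finset.range S.n, quad S.Q (act (S.A ^ k) (x 0)) ≤
      2 * quad S.Q (x k) + 2 * ‖S.Q‖ * E * f k := by
    intro k hk
    have h1 : act (S.A ^ k) (x 0) = x k + -(x k - act (S.A ^ k) (x 0)) := by abel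
    have h2 := quad_add_le hS.Q_posSemidef (x k) (-(x k - act (S.A ^ k) (x 0)))
    rw [← h1, quad_neg] at h2
    have h3 := (le_abs_self _).trans (quad_le_norm S.Q (x k - act (S.A ^ k) (x 0)))
    have h4 : ∑ l ∈ Finset.range k, (‖u l‖ ^ 2 + ‖w l‖ ^ 2) ≤ E :=
      Finset.sum_le_sum_of_subset_of_nonneg (Finset.range_mono (Finset.mem_range.1 hk).le)
        fun _ _ _ => by positivity
    have h5 := (hf k x u w hx).trans (mul_le_mul_of_nonneg_left h4 (hf0 k))
    have h6 := mul_le_mul_of_nonneg_left h5 (norm_nonneg S.Q)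
    linarith
  have hfin := (hQ (x 0)).trans (Finset.sum_le_sum hterm)
  rw [Finset.sum_add_distrib, ← Finset.mul_sum, ← Finset.mul_sum, ← hc₁] at hfin
  rw [div_mul_eq_mul_div, le_div_iff₀ hr]
  have h7 : 2 * ‖S.Q‖ * c₁ * E ≤ 2 * ‖S.Q‖ * c₁ * ((1 / ρ + 1) * Z) := by gcongr
  linarith

/-- The closed loop matrix `A + B K` is stable. -/
theorem IsControlRiccati.summable (hS : S.Regular) (h : S.IsControlRiccati P) :
    Summable fun j => ‖(S.A + S.B * S.controlGain P) ^ j‖ := by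
  obtain ⟨c, hc, hobs⟩ := exists_norm_sq_le_sum hS
  set M := S.A + S.B * S.controlGain P with hM
  let ℓ : Vec S.n → ℝ := fun x => quad S.Q x + quad S.R (act (S.controlGain P) x)
  have hℓ : ∀ x, 0 ≤ ℓ x := fun x =>
    add_nonneg (quad_nonneg hS.Q_posSemidef _) (quad_nonneg hS.R_posDef.posSemidef _)
  have hMx : ∀ x, act M x = act S.A x + act S.B (act (S.controlGain P) x) := fun x => by
    rw [hM, add_act, mul_act]
  -- With u = Kx the square vanishes, so P decreases by exactly the stage cost. This cost may vanish
  -- at nonzero states; observability over `n` steps compensates.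
  have hstep : ∀ x, quad P (act M x) + ℓ x = quad P x := fun x => by
    have := h.complete_square hS x (act (S.controlGain P) x)
    rw [sub_self, quad_zero, add_zero, add_assoc] at this
    rw [hMx]
    exact this
  have hsum : ∀ x T, ∑ k ∈ Finset.range T, ℓ (act (M ^ k) x) ≤ quad P x := by
    intro x T
    have : ∑ k ∈ Finset.range T, ℓ (act (M ^ k) x) + quad P (act (M ^ T) x) = quad P x := by
      induction T with
      | zero => simp [one_act]
      | succ T ih =>
        rw [Finset.sum_range_succ, pow_succ_act]
        linarith [hstep (act (M ^ T) x)]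
    linarith [quad_nonneg h.1 (act (M ^ T) x)]
  have hone : ∀ x, ‖x‖ ^ 2 ≤ c * ∑ k ∈ Finset.range S.n, ℓ (act (M ^ k) x) := fun x => by
    have := hobs (fun k => act (M ^ k) x) (fun k => act (S.controlGain P) (act (M ^ k) x))
      (fun _ => 0) (fun k => by rw [pow_succ_act, hMx, add_zero])
    simpa [one_act, ℓ] using this
  -- Each ‖M^j x‖² is bounded by a window of `n` stage costs. After exchanging the sums, each of the
  -- `n` shifted orbits costs at most `quad P x`.
  refine summable_norm_pow_of_sum_le (f := fun x => c * (S.n * quad P x)) fun x T => ?_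
  calc ∑ j ∈ Finset.range T, ‖act (M ^ j) x‖ ^ 2
      ≤ ∑ j ∈ Finset.range T, c * ∑ k ∈ Finset.range S.n, ℓ (act (M ^ j) (act (M ^ k) x)) := by
        refine Finset.sum_le_sum fun j _ => (hone _).trans (le_of_eq ?_)
        congr 1
        refine Finset.sum_congr rfl fun k _ => ?_
        rw [← mul_act, ← mul_act, ← pow_add, ← pow_add, add_comm]
    _ = c * ∑ k ∈ Finset.range S.n, ∑ j ∈ Finset.range T, ℓ (act (M ^ j) (act (M ^ k) x)) := by
        rw [← Finset.mul_sum, Finset.sum_comm]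
    _ ≤ c * ∑ k ∈ Finset.range S.n, quad P x := by
        gcongr with k
        refine (hsum _ _).trans ?_
        have : ∀ k, quad P (act (M ^ k) x) ≤ quad P x := by
          intro k
          induction k with
          | zero => simp [one_act]
          | succ k ih =>
            rw [pow_succ_act]
            linarith [hstep (act (M ^ k) x), hℓ (act (M ^ k) x)]
        exact this k
    _ = _ := by simp

end Control

end Riccati

end Loop

-- Regrouping independent σ-algebras.

section Independence

variable {Ω : Type*} {m0 : MeasurableSpace Ω} {μ : Measure Ω} [IsProbabilityMeasure μ]

/-- If `m₁ ⟂ m₂` and `m₁ ⊔ m₂ ⟂ m₃`, then `m₁ ⟂ m₂ ⊔ m₃`. -/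
theorem indep_sup_right {m₁ m₂ m₃ : MeasurableSpace Ω} (h₁ : m₁ ≤ m0) (h₂ : m₂ ≤ m0) (h₃ : m₃ ≤ m0)
    (h12 : Indep m₁ m₂ μ) (h123 : Indep (m₁ ⊔ m₂) m₃ μ) : Indep m₁ (m₂ ⊔ m₃) μ := by
  have hpi : IsPiSystem {s | ∃ t u, MeasurableSet[m₂] t ∧ MeasurableSet[m₃] u ∧ s = t ∩ u} := by
    rintro s ⟨t, u, ht, hu, rfl⟩ s' ⟨t', u', ht', hu', rfl⟩ -
    exact ⟨t ∩ t', u ∩ u', @MeasurableSet.inter Ω m₂ _ _ ht ht', @MeasurableSet.inter Ω m₃ _ _ hu hu', Set.inter_inter_inter_comm _ _ _ _⟩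
  refine IndepSets.indep h₁ (sup_le h₂ h₃) (@MeasurableSpace.isPiSystem_measurableSet Ω m₁) hpi
    (@MeasurableSpace.generateFrom_measurableSet Ω m₁).symm ?_ ?_
  · refine le_antisymm (sup_le ?_ ?_) (MeasurableSpace.generateFrom_le ?_)
    · exact fun t ht => .basic _ ⟨t, Set.univ, ht, @MeasurableSet.univ Ω m₃, by simp⟩
    · exact fun u hu => .basic _ ⟨Set.univ, u, @MeasurableSet.univ Ω m₂, hu, by simp⟩
    · rintro s ⟨t, u, ht, hu, rfl⟩
      exact @MeasurableSet.inter Ω (m₂ ⊔ m₃) _ _ (le_sup_left (a := m₂) (b := m₃) t ht) (le_sup_right (a := m₂) (b := m₃) u hu)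
  · rw [IndepSets_iff]
    rintro s _ hs ⟨t, u, ht, hu, rfl⟩
    have e1 := (Indep_iff _ _ _).1 h12 s t hs ht
    have e2 := (Indep_iff _ _ _).1 h123 (s ∩ t) u
      (@MeasurableSet.inter Ω (m₁ ⊔ m₂) _ _ (le_sup_left (a := m₁) (b := m₂) s hs) (le_sup_right (a := m₁) (b := m₂) t ht)) hu
    have e3 := (Indep_iff _ _ _).1 h123 t u (le_sup_right (a := m₁) (b := m₂) t ht) hu
    rw [← Set.inter_assoc, e2, e1, e3, mul_assoc]

/-- Regroups two independent blocks, each split into present and past, into a joint present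
independent of the joint past. -/
theorem indep_sup_sup {m₁ m₂ n₁ n₂ : MeasurableSpace Ω} (h₁ : m₁ ≤ m0) (h₂ : m₂ ≤ m0)
    (h₃ : n₁ ≤ m0) (h₄ : n₂ ≤ m0) (hm : Indep m₁ m₂ μ) (hn : Indep n₁ n₂ μ)
    (h : Indep (m₁ ⊔ m₂) (n₁ ⊔ n₂) μ) : Indep (m₁ ⊔ n₁) (m₂ ⊔ n₂) μ := by
  have h5 : Indep n₁ (n₂ ⊔ m₂) μ := indep_of_indep_of_le_right
    (indep_sup_right h₃ h₄ (sup_le h₁ h₂) hn h.symm) (sup_le_sup_left le_sup_right _)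
  have h6 : Indep m₁ (m₂ ⊔ (n₁ ⊔ n₂)) μ := indep_sup_right h₁ h₂ (sup_le h₃ h₄) hm h
  have h7 : Indep (n₂ ⊔ m₂) (n₁ ⊔ m₁) μ := by
    refine indep_sup_right (sup_le h₄ h₂) h₃ h₁ h5.symm ?_
    refine indep_of_indep_of_le_left h6.symm ?_
    refine sup_le (sup_le ?_ ?_) ?_
    · exact le_sup_right.trans le_sup_right
    · exact le_sup_left
    · exact le_sup_left.trans le_sup_right
  rw [sup_comm m₁, sup_comm m₂]
  exact h7.symm

/-- The conditional expectation of `f` given `m₂` is the constant E f. -/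
theorem setIntegral_eq_mul_of_indep {m₁ m₂ : MeasurableSpace Ω} (h₁ : m₁ ≤ m0) (h₂ : m₂ ≤ m0)
    (h : Indep m₁ m₂ μ) {f : Ω → ℝ} (hf : Measurable[m₁] f) (hfi : Integrable f μ) {E : Set Ω}
    (hE : MeasurableSet[m₂] E) : ∫ ω in E, f ω ∂μ = μ.real E * ∫ ω, f ω ∂μ := by
  rw [← setIntegral_condExp h₂ hfi hE]
  rw [setIntegral_congr_ae (g := fun _ => ∫ ω, f ω ∂μ) (h₂ _ hE)
    ((condExp_indep_eq h₁ h₂ hf.stronglyMeasurable h).mono fun ω hω _ => hω)]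
  simp

omit [IsProbabilityMeasure μ] in
theorem integral_mul_eq_mul_of_indep {m₁ m₂ : MeasurableSpace Ω} (h : Indep m₁ m₂ μ)
    {f g : Ω → ℝ} (hf : Measurable[m₁] f) (hg : Measurable[m₂] g) (h₁ : m₁ ≤ m0) (h₂ : m₂ ≤ m0) :
    ∫ ω, f ω * g ω ∂μ = (∫ ω, f ω ∂μ) * ∫ ω, g ω ∂μ := by
  have hfg : IndepFun f g μ := (IndepFun_iff_Indep _ _ _).2
    (indep_of_indep_of_le h hf.comap_le hg.comap_le)
  exact hfg.integral_fun_mul_eq_mul_integral (hf.mono h₁ le_rfl).aestronglyMeasurable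
    (hg.mono h₂ le_rfl).aestronglyMeasurable

end Independence

-- Matrices of second moments, orthogonality, and Gaussian vectors.

section SecondMoments

variable {Ω : Type*} {m0 : MeasurableSpace Ω} {μ : Measure Ω} {a b c : ℕ}

/-- The matrix of mixed moments `E[X Yᵀ]`. -/
noncomputable def crossMom (μ : Measure Ω) (X : Ω → Vec a) (Y : Ω → Vec b) :
    Matrix (Fin a) (Fin b) ℝ :=
  Matrix.of fun k l => ∫ ω, X ω k * Y ω l ∂μ

theorem memLp_coord {X : Ω → Vec a} (hX : MemLp X 2 μ) (k : Fin a) :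
    MemLp (fun ω => X ω k) 2 μ :=
  hX.mono ((EuclideanSpace.proj k : Vec a →L[ℝ] ℝ).continuous.comp_aestronglyMeasurable hX.1)
    (Eventually.of_forall fun ω => PiLp.norm_apply_le (X ω) k)

theorem memLp_act (M : Matrix (Fin b) (Fin a) ℝ) {X : Ω → Vec a} (hX : MemLp X 2 μ) :
    MemLp (fun ω => act M (X ω)) 2 μ := by
  open scoped Matrix.Norms.L2Operator in
  exact hX.of_le_mul (c := ‖M‖) ((continuous_act M).comp_aestronglyMeasurable hX.1)
    (Eventually.of_forall fun ω => norm_act_le M (X ω))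

theorem integrable_coord_mul {X : Ω → Vec a} {Y : Ω → Vec b} (hX : MemLp X 2 μ) (hY : MemLp Y 2 μ)
    (k : Fin a) (l : Fin b) : Integrable (fun ω => X ω k * Y ω l) μ :=
  (memLp_coord hX k).integrable_mul (memLp_coord hY l)

theorem crossMom_transpose (X : Ω → Vec a) (Y : Ω → Vec b) :
    (crossMom μ X Y)ᵀ = crossMom μ Y X := by
  ext k l
  simp [crossMom, mul_comm]

theorem crossMom_add_left {X X' : Ω → Vec a} {Y : Ω → Vec b} (hX : MemLp X 2 μ) (hX' : MemLp X' 2 μ)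
    (hY : MemLp Y 2 μ) :
    crossMom μ (fun ω => X ω + X' ω) Y = crossMom μ X Y + crossMom μ X' Y := by
  ext k l
  simp only [crossMom, of_apply, PiLp.add_apply, add_mul, Matrix.add_apply]
  exact integral_add (integrable_coord_mul hX hY k l) (integrable_coord_mul hX' hY k l)

theorem crossMom_sub_left {X X' : Ω → Vec a} {Y : Ω → Vec b} (hX : MemLp X 2 μ) (hX' : MemLp X' 2 μ)
    (hY : MemLp Y 2 μ) :
    crossMom μ (fun ω => X ω - X' ω) Y = crossMom μ X Y - crossMom μ X' Y := by
  ext k l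
  simp only [crossMom, of_apply, PiLp.sub_apply, sub_mul, Matrix.sub_apply]
  exact integral_sub (integrable_coord_mul hX hY k l) (integrable_coord_mul hX' hY k l)

theorem crossMom_act_left (M : Matrix (Fin c) (Fin a) ℝ) {X : Ω → Vec a} {Y : Ω → Vec b}
    (hX : MemLp X 2 μ) (hY : MemLp Y 2 μ) :
    crossMom μ (fun ω => act M (X ω)) Y = M * crossMom μ X Y := by
  ext k l
  simp only [crossMom, of_apply, act_apply, Matrix.mul_apply, Finset.sum_mul, mul_assoc]
  rw [integral_finsetSum _ fun r _ => (integrable_coord_mul hX hY r l).const_mul _]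
  simp_rw [integral_const_mul]

theorem crossMom_add_right {X : Ω → Vec a} {Y Y' : Ω → Vec b} (hX : MemLp X 2 μ) (hY : MemLp Y 2 μ)
    (hY' : MemLp Y' 2 μ) :
    crossMom μ X (fun ω => Y ω + Y' ω) = crossMom μ X Y + crossMom μ X Y' := by
  rw [← crossMom_transpose, crossMom_add_left hY hY' hX, transpose_add, crossMom_transpose,
    crossMom_transpose]

theorem crossMom_sub_right {X : Ω → Vec a} {Y Y' : Ω → Vec b} (hX : MemLp X 2 μ) (hY : MemLp Y 2 μ)
    (hY' : MemLp Y' 2 μ) :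
    crossMom μ X (fun ω => Y ω - Y' ω) = crossMom μ X Y - crossMom μ X Y' := by
  rw [← crossMom_transpose, crossMom_sub_left hY hY' hX, transpose_sub, crossMom_transpose,
    crossMom_transpose]

theorem crossMom_act_right (M : Matrix (Fin c) (Fin b) ℝ) {X : Ω → Vec a} {Y : Ω → Vec b}
    (hX : MemLp X 2 μ) (hY : MemLp Y 2 μ) :
    crossMom μ X (fun ω => act M (Y ω)) = crossMom μ X Y * Mᵀ := by
  rw [← crossMom_transpose, crossMom_act_left M hY hX, transpose_mul, crossMom_transpose]

/-- Pythagoras for orthogonal random vectors; the covariance recursions rest on this. -/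
theorem crossMom_add_self {X Y : Ω → Vec a} (hX : MemLp X 2 μ) (hY : MemLp Y 2 μ)
    (h : crossMom μ X Y = 0) :
    crossMom μ (fun ω => X ω + Y ω) (fun ω => X ω + Y ω) = crossMom μ X X + crossMom μ Y Y := by
  have h' : crossMom μ Y X = 0 := by rw [← crossMom_transpose, h, transpose_zero]
  have hXY : MemLp (fun ω => X ω + Y ω) 2 μ := hX.add hY
  rw [crossMom_add_left hX hY hXY, crossMom_add_right hX hX hY, crossMom_add_right hY hX hY,
    h, h', add_zero, zero_add]

theorem crossMom_sub_self {X Y : Ω → Vec a} (hX : MemLp X 2 μ) (hY : MemLp Y 2 μ)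
    (h : crossMom μ X Y = 0) :
    crossMom μ (fun ω => X ω - Y ω) (fun ω => X ω - Y ω) = crossMom μ X X + crossMom μ Y Y := by
  have h' : crossMom μ Y X = 0 := by rw [← crossMom_transpose, h, transpose_zero]
  have hXY : MemLp (fun ω => X ω - Y ω) 2 μ := hX.sub hY
  rw [crossMom_sub_left hX hY hXY, crossMom_sub_right hX hX hY, crossMom_sub_right hY hX hY,
    h, h', sub_zero, zero_sub, sub_neg_eq_add]

theorem crossMom_act_self (M : Matrix (Fin b) (Fin a) ℝ) {X : Ω → Vec a} (hX : MemLp X 2 μ) :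
    crossMom μ (fun ω => act M (X ω)) (fun ω => act M (X ω)) = M * crossMom μ X X * Mᵀ := by
  rw [crossMom_act_left M hX (memLp_act M hX), crossMom_act_right M hX hX, Matrix.mul_assoc]

theorem integrable_quad (M : Matrix (Fin a) (Fin a) ℝ) {X : Ω → Vec a} (hX : MemLp X 2 μ) :
    Integrable (fun ω => quad M (X ω)) μ := by
  simp_rw [quad_eq_sum]
  exact integrable_finsetSum _ fun k _ => integrable_finsetSum _ fun l _ =>
    (integrable_coord_mul hX hX k l).const_mul _

theorem integral_sum_mul (M : Matrix (Fin a) (Fin b) ℝ) {X : Ω → Vec a} {Y : Ω → Vec b}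
    (hX : MemLp X 2 μ) (hY : MemLp Y 2 μ) :
    ∫ ω, ∑ k, ∑ l, M k l * (X ω k * Y ω l) ∂μ = ∑ k, ∑ l, M k l * crossMom μ X Y k l := by
  refine (integral_finsetSum _ fun k _ => integrable_finsetSum _ fun l _ =>
    (integrable_coord_mul hX hY k l).const_mul _).trans (Finset.sum_congr rfl fun k _ => ?_)
  refine (integral_finsetSum _ fun l _ =>
    (integrable_coord_mul hX hY k l).const_mul _).trans (Finset.sum_congr rfl fun l _ => ?_)
  exact integral_const_mul _ _

theorem integral_quad (M : Matrix (Fin a) (Fin a) ℝ) {X : Ω → Vec a} (hX : MemLp X 2 μ) :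
    ∫ ω, quad M (X ω) ∂μ = (M * crossMom μ X X).trace := by
  have h1 : ∫ ω, quad M (X ω) ∂μ = ∫ ω, ∑ k, ∑ l, M k l * (X ω k * X ω l) ∂μ := by
    simp only [quad_eq_sum]
  rw [h1, integral_sum_mul M hX hX]
  conv_rhs => rw [← crossMom_transpose]
  simp only [trace, diag_apply, Matrix.mul_apply, transpose_apply]

theorem integrable_norm_sq {X : Ω → Vec a} (hX : MemLp X 2 μ) :
    Integrable (fun ω => ‖X ω‖ ^ 2) μ := by
  simpa only [quad_one] using integrable_quad 1 hX

theorem dotProduct_mulVec_eq_sum (M : Matrix (Fin a) (Fin b) ℝ) (x : Vec a) (y : Vec b) :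
    x.ofLp ⬝ᵥ (M *ᵥ y.ofLp) = ∑ k, ∑ l, M k l * (x k * y l) := by
  simp only [dotProduct, mulVec, Finset.mul_sum]
  refine Finset.sum_congr rfl fun k _ => Finset.sum_congr rfl fun l _ => by ring

theorem integral_dotProduct_mulVec_eq_zero (M : Matrix (Fin a) (Fin b) ℝ) {X : Ω → Vec a}
    {Y : Ω → Vec b} (hX : MemLp X 2 μ) (hY : MemLp Y 2 μ) (h : crossMom μ X Y = 0) :
    ∫ ω, (X ω).ofLp ⬝ᵥ (M *ᵥ (Y ω).ofLp) ∂μ = 0 := by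
  have h1 : ∫ ω, (X ω).ofLp ⬝ᵥ (M *ᵥ (Y ω).ofLp) ∂μ =
      ∫ ω, ∑ k, ∑ l, M k l * (X ω k * Y ω l) ∂μ := by
    simp only [dotProduct_mulVec_eq_sum]
  rw [h1, integral_sum_mul M hX hY, h]
  simp

variable [IsProbabilityMeasure μ]

omit [IsProbabilityMeasure μ] in
theorem crossMom_eq_zero_of_indep {m₁ m₂ : MeasurableSpace Ω} (h₁ : m₁ ≤ m0) (h₂ : m₂ ≤ m0)
    (h : Indep m₁ m₂ μ) {X : Ω → Vec a} {Y : Ω → Vec b} (hX : Measurable[m₁] X)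
    (hY : Measurable[m₂] Y) (hY0 : ∀ l, ∫ ω, Y ω l ∂μ = 0) : crossMom μ X Y = 0 := by
  ext k l
  have e1 : Measurable fun x : Vec a => x k := by fun_prop
  have e2 : Measurable fun x : Vec b => x l := by fun_prop
  simp only [crossMom, of_apply, Matrix.zero_apply]
  have := integral_mul_eq_mul_of_indep h (e1.comp hX) (e2.comp hY) h₁ h₂
  simp only [Function.comp_def] at this
  rw [this, hY0, mul_zero]

theorem integral_coord_act (M : Matrix (Fin b) (Fin a) ℝ) {X : Ω → Vec a} (hX : MemLp X 2 μ)
    (h0 : ∀ l, ∫ ω, X ω l ∂μ = 0) (k : Fin b) : ∫ ω, act M (X ω) k ∂μ = 0 := by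
  simp_rw [act_apply]
  rw [integral_finsetSum _ fun l _ => ((memLp_coord hX l).integrable one_le_two).const_mul _]
  simp [integral_const_mul, h0]

theorem integral_coord_add {X Y : Ω → Vec a} (hX : MemLp X 2 μ) (hY : MemLp Y 2 μ)
    (hX0 : ∀ l, ∫ ω, X ω l ∂μ = 0) (hY0 : ∀ l, ∫ ω, Y ω l ∂μ = 0) (k : Fin a) :
    ∫ ω, (X ω + Y ω) k ∂μ = 0 := by
  simp only [PiLp.add_apply]
  rw [integral_add ((memLp_coord hX k).integrable one_le_two)
    ((memLp_coord hY k).integrable one_le_two), hX0, hY0, add_zero]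

theorem integral_coord_sub {X Y : Ω → Vec a} (hX : MemLp X 2 μ) (hY : MemLp Y 2 μ)
    (hX0 : ∀ l, ∫ ω, X ω l ∂μ = 0) (hY0 : ∀ l, ∫ ω, Y ω l ∂μ = 0) (k : Fin a) :
    ∫ ω, (X ω - Y ω) k ∂μ = 0 := by
  simp only [PiLp.sub_apply]
  rw [integral_sub ((memLp_coord hX k).integrable one_le_two)
    ((memLp_coord hY k).integrable one_le_two), hX0, hY0, sub_zero]

/-- For jointly Gaussian vectors vanishing covariance implies independence. Centring one of the two
already turns the mixed moment into the covariance. -/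
theorem indepFun_of_crossMom_eq_zero {X : Ω → Vec a} {Y : Ω → Vec b}
    (hXY : HasGaussianLaw (fun ω => (X ω, Y ω)) μ) (hX : MemLp X 2 μ) (hY : MemLp Y 2 μ)
    (hX0 : ∀ l, ∫ ω, X ω l ∂μ = 0) (h : crossMom μ X Y = 0) : IndepFun X Y μ := by
  refine hXY.indepFun_of_covariance_inner fun x y => ?_
  have hinner : ∀ {d : ℕ} (z z' : Vec d), inner ℝ z z' = ∑ k, z k * z' k := fun z z' => by
    simp [PiLp.inner_apply, mul_comm]
  have hx : MemLp (fun ω => inner ℝ x (X ω)) 2 μ := hX.const_inner x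
  have hy : MemLp (fun ω => inner ℝ y (Y ω)) 2 μ := hY.const_inner y
  rw [covariance_eq_sub hx hy]
  have h1 : ∫ ω, inner ℝ x (X ω) ∂μ = 0 := by
    simp_rw [hinner]
    rw [integral_finsetSum _ fun l _ => ((memLp_coord hX l).integrable one_le_two).const_mul _]
    simp [integral_const_mul, hX0]
  have h2 := integral_dotProduct_mulVec_eq_zero (Matrix.of fun k l => x k * y l) hX hY h
  rw [h1, zero_mul, sub_zero, ← h2]
  refine integral_congr_ae (Eventually.of_forall fun ω => ?_)
  simp only [Pi.mul_apply, hinner, dotProduct_mulVec_eq_sum, of_apply, Finset.sum_mul_sum]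
  refine Finset.sum_congr rfl fun k _ => Finset.sum_congr rfl fun l _ => by ring

section Gaussian

variable {X : Ω → Vec a} {W : Matrix (Fin a) (Fin a) ℝ}

omit [IsProbabilityMeasure μ] in
theorem integral_coord_of_hasLaw (h : HasLaw X (multivariateGaussian 0 W) μ) (k : Fin a) :
    ∫ ω, X ω k ∂μ = 0 := by
  have h1 := h.integral_comp (f := fun x : Vec a => x k) (by fun_prop)
  have h2 := (EuclideanSpace.proj k : Vec a →L[ℝ] ℝ).integral_comp_comm
    (IsGaussian.integrable_id (μ := multivariateGaussian (0 : Vec a) W))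
  simp only [Function.comp_def] at h1
  rw [h1]
  simpa using h2

theorem crossMom_self_of_hasLaw (hW : W.PosSemidef) (h : HasLaw X (multivariateGaussian 0 W) μ) :
    crossMom μ X X = W := by
  ext k l
  have hX : MemLp X 2 μ := h.hasGaussianLaw.memLp_two
  have h1 := covariance_eq_sub (memLp_coord hX k) (memLp_coord hX l)
  rw [integral_coord_of_hasLaw h, zero_mul, sub_zero] at h1
  have h2 := covariance_eval_multivariateGaussian (μ := (0 : Vec a)) hW k l
  rw [← h.map_eq, covariance_map (by fun_prop) (by fun_prop) h.aemeasurable] at h2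
  simp only [crossMom, of_apply]
  rw [← h2]
  exact h1.symm

end Gaussian

end SecondMoments

-- Zero-one variables with constant conditional probability.

section BernoulliVariables

variable {Ω : Type*} {m0 : MeasurableSpace Ω} {μ : Measure Ω}

theorem comap_le_generateFrom_of_zero_or_one {f : Ω → ℝ} (hf : ∀ ω, f ω = 0 ∨ f ω = 1) :
    MeasurableSpace.comap f inferInstance ≤ MeasurableSpace.generateFrom {{ω | f ω = 1}} := by
  have h1 : f = Set.indicator {ω | f ω = 1} (fun _ => (1 : ℝ)) := by
    ext ω
    obtain h | h := hf ω <;> simp [h]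
  rw [← measurable_iff_comap_le, h1]
  refine Measurable.indicator measurable_const ?_
  rw [← h1]
  exact .basic _ rfl

theorem zero_or_one_integral {f : Ω → ℝ} (hf : ∀ ω, f ω = 0 ∨ f ω = 1) (hm : Measurable f) :
    ∫ ω, f ω ∂μ = μ.real {ω | f ω = 1} := by
  have h1 : f = Set.indicator {ω | f ω = 1} (fun _ => (1 : ℝ)) := by
    ext ω
    obtain h | h := hf ω <;> simp [h]
  conv_lhs => rw [h1]
  have h2 : MeasurableSet {ω | f ω = 1} := hm (measurableSet_singleton 1)
  rw [integral_indicator_const _ h2]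
  simp

variable [IsProbabilityMeasure μ]

/-- A `{0,1}`-valued variable with constant conditional expectation is independent of the
conditioning σ-algebra. -/
theorem indep_of_condExp_const {m : MeasurableSpace Ω} (hm : m ≤ m0) {f : Ω → ℝ}
    (hf : ∀ ω, f ω = 0 ∨ f ω = 1) (hfm : Measurable[m0] f) {p : ℝ}
    (h : μ[Set.indicator {ω | f ω = 1} (fun _ => (1 : ℝ)) | m] =ᵐ[μ] fun _ => p) :
    μ.real {ω | f ω = 1} = p ∧ Indep (MeasurableSpace.comap f inferInstance) m μ := by
  have hA : MeasurableSet[m0] {ω | f ω = 1} := hfm (measurableSet_singleton 1)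
  have hint : Integrable (Set.indicator {ω | f ω = 1} (fun _ => (1 : ℝ))) μ :=
    (integrable_const 1).indicator hA
  have key : ∀ s, MeasurableSet[m] s → μ.real ({ω | f ω = 1} ∩ s) = p * μ.real s := by
    intro s hs
    have h1 := setIntegral_condExp hm hint hs
    rw [setIntegral_congr_ae (g := fun _ => p) (hm _ hs) (h.mono fun ω hω _ => hω),
      setIntegral_const, integral_indicator_const _ hA] at h1
    simp only [smul_eq_mul, mul_one] at h1
    rw [measureReal_restrict_apply hA] at h1
    rw [← h1, mul_comm]
  have hp : μ.real {ω | f ω = 1} = p := by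
    simpa using key Set.univ (@MeasurableSet.univ Ω m)
  refine ⟨hp, indep_of_indep_of_le_left ?_ (comap_le_generateFrom_of_zero_or_one hf)⟩
  refine IndepSets.indep (MeasurableSpace.generateFrom_le ?_) hm (IsPiSystem.singleton _)
    (@MeasurableSpace.isPiSystem_measurableSet Ω m) rfl
    (@MeasurableSpace.generateFrom_measurableSet Ω m).symm ?_
  · rintro _ rfl
    exact hA
  · rw [IndepSets_iff]
    rintro _ s rfl hs
    have h2 := key s hs
    rw [← hp] at h2
    rw [← ENNReal.toReal_eq_toReal_iff' (measure_ne_top _ _)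
      (ENNReal.mul_ne_top (measure_ne_top _ _) (measure_ne_top _ _)), ENNReal.toReal_mul]
    exact h2

end BernoulliVariables

/-! ### The randomness seen by one loop -/

section LoopNoise

variable {Ω : Type*} {S : Loop}

/-- The σ-algebra generated by `x_0`, all transmission successes, and the disturbances and
measurement noises before time `k`. -/
@[reducible]
def pastInfo (x0 : Ω → Vec S.n) (w : ℕ → Ω → Vec S.n) (v : ℕ → Ω → Vec S.o) (σ : ℕ → Ω → ℝ) :
    ℕ → MeasurableSpace Ω
  | 0 => MeasurableSpace.comap x0 inferInstance ⊔ ⨆ l, MeasurableSpace.comap (σ l) inferInstance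
  | k + 1 => pastInfo x0 w v σ k ⊔ MeasurableSpace.comap (v k) inferInstance ⊔
      MeasurableSpace.comap (w k) inferInstance

/-- The σ-algebra generated by the successes before time `k` and by `x_0`, `w`, `v`. -/
@[reducible]
def plantInfo (x0 : Ω → Vec S.n) (w : ℕ → Ω → Vec S.n) (v : ℕ → Ω → Vec S.o) (σ : ℕ → Ω → ℝ)
    (k : ℕ) : MeasurableSpace Ω :=
  (⨆ l ∈ Set.Iio k, MeasurableSpace.comap (σ l) inferInstance) ⊔
    (MeasurableSpace.comap x0 inferInstance ⊔
      ⨆ l, (MeasurableSpace.comap (w l) inferInstance ⊔ MeasurableSpace.comap (v l) inferInstance))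

/-- The probabilistic assumptions on a single loop whose transmissions succeed independently
with probability `s`. -/
structure LoopNoise (S : Loop) {m0 : MeasurableSpace Ω} (μ : Measure Ω) (x0 : Ω → Vec S.n)
    (w : ℕ → Ω → Vec S.n) (v : ℕ → Ω → Vec S.o) (σ : ℕ → Ω → ℝ) (s : ℝ) : Prop where
  measurable_x0 : Measurable x0
  measurable_w : ∀ k, Measurable (w k)
  measurable_v : ∀ k, Measurable (v k)
  measurable_σ : ∀ k, Measurable (σ k)
  memLp_x0 : MemLp x0 2 μ
  law_w : ∀ k, HasLaw (w k) (multivariateGaussian 0 S.W) μ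
  law_v : ∀ k, HasLaw (v k) (multivariateGaussian 0 S.V) μ
  zero_or_one : ∀ k ω, σ k ω = 0 ∨ σ k ω = 1
  prob : ∀ k, μ.real {ω | σ k ω = 1} = s
  indep_v : ∀ k, Indep (MeasurableSpace.comap (v k) inferInstance) (pastInfo x0 w v σ k) μ
  indep_w : ∀ k, Indep (MeasurableSpace.comap (w k) inferInstance)
    (pastInfo x0 w v σ k ⊔ MeasurableSpace.comap (v k) inferInstance) μ
  indep_σ : ∀ k, Indep (MeasurableSpace.comap (σ k) inferInstance) (plantInfo x0 w v σ k) μ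

theorem pastInfo_mono_init {x0 x0' : Ω → Vec S.n}
    (h : MeasurableSpace.comap x0' inferInstance ≤ MeasurableSpace.comap x0 inferInstance)
    (w : ℕ → Ω → Vec S.n) (v : ℕ → Ω → Vec S.o) (σ : ℕ → Ω → ℝ) (k : ℕ) :
    pastInfo x0' w v σ k ≤ pastInfo x0 w v σ k := by
  induction k with
  | zero => exact sup_le_sup_right h _
  | succ k ih => exact sup_le_sup_right (sup_le_sup_right ih _) _

/-- The initial state may be replaced by a deterministic one. -/
theorem LoopNoise.const {m0 : MeasurableSpace Ω} {μ : Measure Ω} [IsProbabilityMeasure μ]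
    {x0 : Ω → Vec S.n} {w : ℕ → Ω → Vec S.n} {v : ℕ → Ω → Vec S.o} {σ : ℕ → Ω → ℝ} {s : ℝ}
    (h : LoopNoise S μ x0 w v σ s) (z : Vec S.n) : LoopNoise S μ (fun _ => z) w v σ s := by
  have hle : MeasurableSpace.comap (fun _ : Ω => z) inferInstance ≤
      MeasurableSpace.comap x0 inferInstance := by
    rw [MeasurableSpace.comap_const]
    exact bot_le
  exact
    { h with
      measurable_x0 := measurable_const
      memLp_x0 := memLp_const z
      indep_v := fun k => indep_of_indep_of_le_right (h.indep_v k) (pastInfo_mono_init hle _ _ _ _)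
      indep_w := fun k => indep_of_indep_of_le_right (h.indep_w k)
        (sup_le_sup_right (pastInfo_mono_init hle _ _ _ _) _)
      indep_σ := fun k => indep_of_indep_of_le_right (h.indep_σ k)
        (sup_le_sup_left (sup_le_sup_right hle _) _) }

end LoopNoise

/-! ### From the network to a single loop -/

section Network

variable {N : ℕ} {L : Fin N → Loop} {Ω : Type*} [m0 : MeasurableSpace Ω] {μ : Measure Ω}
  {X : Primitives L Ω}

/-- The loop to which a source belongs. -/
def Source.loop {N : ℕ} : Source N → Fin N
  | .init j => j
  | .dist j _ => j
  | .noise j _ => j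
  | .sched j => j

/-- The σ-algebra generated by a set of sources. -/
@[reducible]
def sourceInfo (X : Primitives L Ω) (T : Set (Source N)) : MeasurableSpace Ω :=
  ⨆ t ∈ T, X.sigma t

omit m0 in
theorem sourceInfo_mono {T T' : Set (Source N)} (h : T ⊆ T') : sourceInfo X T ≤ sourceInfo X T' :=
  biSup_mono h

omit m0 in
theorem sigma_le_sourceInfo {T : Set (Source N)} {t : Source N} (h : t ∈ T) :
    X.sigma t ≤ sourceInfo X T := le_biSup X.sigma h

theorem Primitives.Regular.sigma_le (hX : X.Regular μ) (t : Source N) : X.sigma t ≤ m0 := by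
  cases t with
  | init j => exact (hX.measurable_x0 j).comap_le
  | dist j k => exact (hX.measurable_w j k).comap_le
  | noise j k => exact (hX.measurable_v j k).comap_le
  | sched j => exact iSup_le fun k => (hX.measurable_a j k).comap_le

theorem Primitives.Regular.sourceInfo_le (hX : X.Regular μ) (T : Set (Source N)) :
    sourceInfo X T ≤ m0 :=
  iSup₂_le fun t _ => hX.sigma_le t

theorem Primitives.Regular.indep_sourceInfo (hX : X.Regular μ) {T T' : Set (Source N)}
    (h : Disjoint T T') : Indep (sourceInfo X T) (sourceInfo X T') μ :=
  indep_iSup_of_disjoint hX.sigma_le hX.indep h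

omit m0 in
theorem Primitives.IsAdmissibleScheduler.measurable_sourceInfo {j : Fin N} {d : ℕ → Ω → ℝ}
    (h : X.IsAdmissibleScheduler j d) (k : ℕ) :
    Measurable[sourceInfo X {t | t.loop = j}] (d k) := by
  refine (h.2 k).mono (sup_le (sup_le (sup_le ?_ ?_) ?_) ?_) le_rfl
  · exact sigma_le_sourceInfo (X := X) (t := .init j) rfl
  · exact iSup₂_le fun l _ => sigma_le_sourceInfo (X := X) (t := .dist j l) rfl
  · exact iSup₂_le fun l _ => sigma_le_sourceInfo (X := X) (t := .noise j l) rfl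
  · refine iSup₂_le fun l _ => le_trans ?_ (sigma_le_sourceInfo (X := X) (t := .sched j) rfl)
    exact le_iSup (fun k => MeasurableSpace.comap (X.a j k) inferInstance) l

theorem Primitives.IsPurelyStochastic.measurable_sigma {j : Fin N} {d : ℕ → Ω → ℝ} {p : ℝ}
    (h : X.IsPurelyStochastic μ j d p) (k : ℕ) : Measurable[X.sigma (.sched j)] (d k) :=
  (h.1 k).mono (iSup₂_le fun l _ =>
    le_iSup (fun k => MeasurableSpace.comap (X.a j k) inferInstance) l) le_rfl

variable {δ : Fin N → ℕ → Ω → ℝ}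

omit m0 in
theorem measurable_available {m : MeasurableSpace Ω} {i : Fin N} {k : ℕ}
    (h : ∀ j, j ≠ i → Measurable[m] (δ j k)) : Measurable[m] (available δ i k) := by
  unfold available
  exact Finset.measurable_prod _ fun j hj => measurable_const.sub (h j (Finset.ne_of_mem_erase hj))

omit m0 in
theorem measurable_success {m : MeasurableSpace Ω} {i : Fin N} {k : ℕ}
    (h : ∀ j, Measurable[m] (δ j k)) : Measurable[m] (success δ i k) :=
  (measurable_available fun j _ => h j).mul (h i)

omit m0 in
theorem success_zero_or_one (hδ : ∀ j k ω, δ j k ω = 0 ∨ δ j k ω = 1) (i : Fin N) (k : ℕ) (ω : Ω) :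
    success δ i k ω = 0 ∨ success δ i k ω = 1 := by
  have h1 : available δ i k ω = 0 ∨ available δ i k ω = 1 := by
    unfold available
    refine Finset.prod_induction _ (fun x => x = 0 ∨ x = 1) ?_ (Or.inr rfl) fun j _ => ?_
    · rintro a b (rfl | rfl) (rfl | rfl) <;> simp
    · obtain h | h := hδ j k ω <;> simp [h]
  obtain h1 | h1 := h1 <;> obtain h2 | h2 := hδ i k ω <;> simp [success, h1, h2]

theorem measurable_of_admissible (hX : X.Regular μ) (hδ : ∀ j, X.IsAdmissibleScheduler j (δ j))
    (j : Fin N) (k : ℕ) : Measurable (δ j k) :=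
  ((hδ j).measurable_sourceInfo k).mono (hX.sourceInfo_le _) le_rfl

theorem transmissionHistory_le (hX : X.Regular μ) (hδ : ∀ j, X.IsAdmissibleScheduler j (δ j))
    (j : Fin N) (k : ℕ) : transmissionHistory δ j k ≤ m0 :=
  iSup₂_le fun l _ => sup_le (measurable_of_admissible hX hδ j l).comap_le
    ((measurable_of_admissible hX hδ j l).mul
      (measurable_available fun j' _ => measurable_of_admissible hX hδ j' l)).comap_le

/-- The past decisions of scheduler `j`. -/
@[reducible]
def pastDecisions (δ : Fin N → ℕ → Ω → ℝ) (k : ℕ) (j : Fin N) : MeasurableSpace Ω :=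
  ⨆ l ∈ Set.Iio k, MeasurableSpace.comap (δ j l) inferInstance

variable [IsProbabilityMeasure μ] {p : Fin N → ℝ}

/-- A constant conditional probability means independence of the whole transmission history; only
its part consisting of own decisions is retained. -/
theorem decision_indep (hX : X.Regular μ) (hδ : ∀ j, X.IsAdmissibleScheduler j (δ j))
    (hp : ∀ j, HasTransmissionProb μ δ j (p j)) (j : Fin N) (k : ℕ) :
    μ.real {ω | δ j k ω = 1} = p j ∧
      Indep (MeasurableSpace.comap (δ j k) inferInstance) (pastDecisions δ k j) μ := by
  obtain ⟨h1, h2⟩ := indep_of_condExp_const (transmissionHistory_le hX hδ j k) ((hδ j).1 k)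
    (measurable_of_admissible hX hδ j k) (hp j k)
  exact ⟨h1, indep_of_indep_of_le_right h2 (iSup₂_mono fun l _ => le_sup_left)⟩

/-- Induction over the loops. Each present decision is independent of its own past, and distinct
loops draw on disjoint sources, so `indep_sup_sup` applies. Decisions may still depend on the plant
of their own loop. -/
theorem decisions_indep (hX : X.Regular μ) (hδ : ∀ j, X.IsAdmissibleScheduler j (δ j))
    (hp : ∀ j, HasTransmissionProb μ δ j (p j)) (k : ℕ) (s : Finset (Fin N)) :
    Indep (⨆ j ∈ s, MeasurableSpace.comap (δ j k) inferInstance) (⨆ j ∈ s, pastDecisions δ k j)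
      μ := by
  have hJ : ∀ j l, MeasurableSpace.comap (δ j l) inferInstance ≤
      sourceInfo X {t | t.loop = j} := fun j l => ((hδ j).measurable_sourceInfo l).comap_le
  have hJ' : ∀ j, pastDecisions δ k j ≤ sourceInfo X {t | t.loop = j} := fun j =>
    iSup₂_le fun l _ => hJ j l
  induction s using Finset.induction_on with
  | empty => simpa using indep_bot_left ⊥
  | insert j s hj ih =>
    rw [Finset.iSup_insert, Finset.iSup_insert]
    have hs : ∀ j' ∈ s, sourceInfo X {t | t.loop = j'} ≤ sourceInfo X {t | t.loop ∈ s} :=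
      fun j' hj' => sourceInfo_mono fun t ht => by rw [Set.mem_ofPred_eq] at ht ⊢; rwa [ht]
    refine indep_sup_sup ((hJ j k).trans (hX.sourceInfo_le _)) ((hJ' j).trans (hX.sourceInfo_le _))
      (iSup₂_le fun j' _ => (hJ j' k).trans (hX.sourceInfo_le _))
      (iSup₂_le fun j' _ => (hJ' j').trans (hX.sourceInfo_le _))
      (decision_indep hX hδ hp j k).2 ih ?_
    have hd : Disjoint {t : Source N | t.loop = j} {t | t.loop ∈ s} :=
      Set.disjoint_left.2 fun t (ht : t.loop = j) (ht' : t.loop ∈ s) => hj (ht ▸ ht')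
    exact indep_of_indep_of_le (hX.indep_sourceInfo hd) (sup_le (hJ j k) (hJ' j))
      (sup_le (iSup₂_le fun j' hj' => (hJ j' k).trans (hs j' hj'))
        (iSup₂_le fun j' hj' => (hJ' j').trans (hs j' hj')))

theorem integral_prod_of_sources (hX : X.Regular μ) {g : Fin N → Ω → ℝ}
    (hg : ∀ j, Measurable[sourceInfo X {t | t.loop = j}] (g j)) (s : Finset (Fin N)) :
    ∫ ω, ∏ j ∈ s, g j ω ∂μ = ∏ j ∈ s, ∫ ω, g j ω ∂μ := by
  induction s using Finset.induction_on with
  | empty => simp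
  | insert j s hj ih =>
    simp_rw [Finset.prod_insert hj]
    have hd : Disjoint {t : Source N | t.loop = j} {t | t.loop ∈ s} :=
      Set.disjoint_left.2 fun t (ht : t.loop = j) (ht' : t.loop ∈ s) => hj (ht ▸ ht')
    rw [integral_mul_eq_mul_of_indep (hX.indep_sourceInfo hd) (hg j) ?_ (hX.sourceInfo_le _)
      (hX.sourceInfo_le _), ih]
    refine Finset.measurable_prod _ fun j' hj' => (hg j').mono (sourceInfo_mono ?_) le_rfl
    intro t ht
    rw [Set.mem_ofPred_eq] at ht ⊢
    rwa [ht]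

theorem success_prob (hX : X.Regular μ) (hδ : ∀ j, X.IsAdmissibleScheduler j (δ j))
    (hp : ∀ j, HasTransmissionProb μ δ j (p j)) (i : Fin N) (k : ℕ) :
    μ.real {ω | success δ i k ω = 1} = (∏ j ∈ Finset.univ.erase i, (1 - p j)) * p i := by
  have hm := measurable_of_admissible hX hδ
  have h01 := fun j => (hδ j).1
  rw [← zero_or_one_integral (success_zero_or_one h01 i k) (measurable_success fun j => hm j k)]
  have hE : ∀ j, ∫ ω, δ j k ω ∂μ = p j := fun j => by
    rw [zero_or_one_integral (h01 j k) (hm j k), (decision_indep hX hδ hp j k).1]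
  have hI : ∀ j, Integrable (δ j k) μ := fun j =>
    Integrable.of_bound (hm j k).aestronglyMeasurable 1 (Eventually.of_forall fun ω => by
      obtain h | h := h01 j k ω <;> simp [h])
  -- One factor per loop, so that the success becomes a single product over independent loops.
  let g : Fin N → Ω → ℝ := fun j ω => if j = i then δ j k ω else 1 - δ j k ω
  have hg : ∀ j, Measurable[sourceInfo X {t | t.loop = j}] (g j) := fun j => by
    by_cases h : j = i
    · simpa [g, h] using h ▸ (hδ j).measurable_sourceInfo k
    · simp only [g, if_neg h]
      exact measurable_const.sub ((hδ j).measurable_sourceInfo k)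
  have h1 := integral_prod_of_sources hX hg Finset.univ
  have h2 : ∀ ω, ∏ j, g j ω = success δ i k ω := fun ω => by
    rw [← Finset.prod_erase_mul _ _ (Finset.mem_univ i)]
    simp only [g, success, available, if_true]
    congr 1
    exact Finset.prod_congr rfl fun j hj => by rw [if_neg (Finset.ne_of_mem_erase hj)]
  simp_rw [h2] at h1
  rw [h1, ← Finset.prod_erase_mul _ _ (Finset.mem_univ i)]
  congr 1
  · refine Finset.prod_congr rfl fun j hj => ?_
    simp only [g, if_neg (Finset.ne_of_mem_erase hj)]
    rw [integral_sub (integrable_const _) (hI j), hE]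
    simp
  · simp [g, hE]

/-- Transmissions of a loop with a purely stochastic scheduler succeed independently of each other
and of the plant. -/
theorem loopNoise_of_regular (hX : X.Regular μ) (hδ : ∀ j, X.IsAdmissibleScheduler j (δ j))
    (hp : ∀ j, HasTransmissionProb μ δ j (p j)) (i : Fin N)
    (hi : X.IsPurelyStochastic μ i (δ i) (p i)) :
    LoopNoise (L i) μ (X.x0 i) (X.w i) (X.v i) (success δ i)
      ((∏ j ∈ Finset.univ.erase i, (1 - p j)) * p i) := by
  -- The sources that can influence the successes of loop `i`. Its own plant is absent because its
  -- scheduler is purely stochastic.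
  let O : Set (Source N) := {t | t.loop ≠ i ∨ t = .sched i}
  have hO : ∀ k, MeasurableSpace.comap (success δ i k) inferInstance ≤ sourceInfo X O := by
    intro k
    refine (measurable_success (m := sourceInfo X O) fun j => ?_).comap_le
    by_cases hj : j = i
    · subst hj
      exact (hi.measurable_sigma k).mono (sigma_le_sourceInfo (Or.inr rfl)) le_rfl
    · refine ((hδ j).measurable_sourceInfo k).mono (sourceInfo_mono fun t ht => Or.inl ?_) le_rfl
      rw [Set.mem_ofPred_eq] at ht
      rwa [ht]
  -- The sources behind `pastInfo` at time `k`: all of `O`, the initial state, and the noises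
  -- strictly before `k`.
  let T : ℕ → Set (Source N) := fun k =>
    {t | t ∈ O ∨ t = .init i ∨ ∃ l < k, t = .dist i l ∨ t = .noise i l}
  have hT : ∀ k, pastInfo (X.x0 i) (X.w i) (X.v i) (success δ i) k ≤ sourceInfo X (T k) := by
    intro k
    induction k with
    | zero =>
      refine sup_le (sigma_le_sourceInfo (X := X) (t := .init i) (Or.inr (Or.inl rfl)))
        (iSup_le fun l => (hO l).trans (sourceInfo_mono fun t ht => Or.inl ht))
    | succ k ih =>
      refine sup_le (sup_le (ih.trans (sourceInfo_mono ?_)) ?_) ?_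
      · rintro t (h | h | ⟨l, hl, h⟩)
        · exact Or.inl h
        · exact Or.inr (Or.inl h)
        · exact Or.inr (Or.inr ⟨l, by omega, h⟩)
      · exact sigma_le_sourceInfo (X := X) (t := .noise i k)
          (Or.inr (Or.inr ⟨k, by omega, Or.inr rfl⟩))
      · exact sigma_le_sourceInfo (X := X) (t := .dist i k)
          (Or.inr (Or.inr ⟨k, by omega, Or.inl rfl⟩))
  refine
    { measurable_x0 := hX.measurable_x0 i
      measurable_w := hX.measurable_w i
      measurable_v := hX.measurable_v i
      measurable_σ := fun k => measurable_success fun j => measurable_of_admissible hX hδ j k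
      memLp_x0 := hX.memLp_x0 i
      law_w := hX.law_w i
      law_v := hX.law_v i
      zero_or_one := success_zero_or_one (fun j => (hδ j).1) i
      prob := success_prob hX hδ hp i
      indep_v := fun k => ?_
      indep_w := fun k => ?_
      indep_σ := fun k => ?_ }
  · have hd : Disjoint {Source.noise i k} (T k) := by
      rw [Set.disjoint_singleton_left]
      rintro ((h | h) | h | ⟨l, hl, h | h⟩)
      · exact h rfl
      · simp at h
      · simp at h
      · simp at h
      · simp only [Source.noise.injEq, true_and] at h
        omega
    exact indep_of_indep_of_le (hX.indep_sourceInfo hd)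
      (sigma_le_sourceInfo (X := X) (t := .noise i k) rfl) (hT k)
  · have hd : Disjoint {Source.dist i k} (T k ∪ {.noise i k}) := by
      rw [Set.disjoint_singleton_left]
      rintro (((h | h) | h | ⟨l, hl, h | h⟩) | h)
      · exact h rfl
      · simp at h
      · simp at h
      · simp only [Source.dist.injEq, true_and] at h
        omega
      · simp at h
      · simp at h
    exact indep_of_indep_of_le (hX.indep_sourceInfo hd)
      (sigma_le_sourceInfo (X := X) (t := .dist i k) rfl)
      (sup_le ((hT k).trans (sourceInfo_mono Set.subset_union_left))
        (sigma_le_sourceInfo (X := X) (t := .noise i k) (Or.inr rfl)))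
  -- Independence in time comes from the joint decisions of all loops, and independence of the plant
  -- from disjoint sources. `indep_sup_right` merges the two.
  · have h1 : Indep (MeasurableSpace.comap (success δ i k) inferInstance)
        (⨆ l ∈ Set.Iio k, MeasurableSpace.comap (success δ i l) inferInstance) μ := by
      refine indep_of_indep_of_le (decisions_indep hX hδ hp k Finset.univ)
        (measurable_success fun j => ?_).comap_le
        (iSup₂_le fun l hl => (measurable_success fun j => ?_).comap_le)
      · exact measurable_iff_comap_le.2
          (le_iSup₂_of_le j (Finset.mem_univ j) le_rfl)
      · exact measurable_iff_comap_le.2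
          (le_iSup₂_of_le j (Finset.mem_univ j) (le_iSup₂_of_le l hl le_rfl))
    have hd : Disjoint O {t | t = .init i ∨ ∃ l, t = .dist i l ∨ t = .noise i l} := by
      refine Set.disjoint_left.2 ?_
      rintro t (h | h) (rfl | ⟨l, rfl | rfl⟩)
      · exact h rfl
      · exact h rfl
      · exact h rfl
      · simp at h
      · simp at h
      · simp at h
    have hN : MeasurableSpace.comap (X.x0 i) inferInstance ⊔
        ⨆ l, (MeasurableSpace.comap (X.w i l) inferInstance ⊔
          MeasurableSpace.comap (X.v i l) inferInstance) ≤
        sourceInfo X {t | t = .init i ∨ ∃ l, t = .dist i l ∨ t = .noise i l} :=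
      sup_le (sigma_le_sourceInfo (X := X) (t := .init i) (Or.inl rfl)) (iSup_le fun l => sup_le
        (sigma_le_sourceInfo (X := X) (t := .dist i l) (Or.inr ⟨l, Or.inl rfl⟩))
        (sigma_le_sourceInfo (X := X) (t := .noise i l) (Or.inr ⟨l, Or.inr rfl⟩)))
    exact indep_sup_right ((hO k).trans (hX.sourceInfo_le _))
      (iSup₂_le fun l _ => (hO l).trans (hX.sourceInfo_le _)) (hN.trans (hX.sourceInfo_le _)) h1
      (indep_of_indep_of_le (hX.indep_sourceInfo hd)
        (sup_le (hO k) (iSup₂_le fun l _ => hO l)) hN)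

end Network

/-! ### Estimation errors -/

section Errors

variable {Ω : Type*} (S : Loop) (G : ℕ → Matrix (Fin S.n) (Fin S.o) ℝ) (e0 : Ω → Vec S.n)
  (w : ℕ → Ω → Vec S.n) (v : ℕ → Ω → Vec S.o) (σ : ℕ → Ω → ℝ)

/-- The prediction error of a filter with gains `G k` and initial error `e0`. -/
noncomputable def predErr : ℕ → Ω → Vec S.n
  | 0 => e0
  | k + 1 => fun ω =>
    act S.A (predErr k ω - act (G k) (act S.C (predErr k ω) + v k ω)) + w k ω

/-- The innovation of a filter with gains `G k` and initial error `e0`. -/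
noncomputable def innov (k : ℕ) (ω : Ω) : Vec S.o := act S.C (predErr S G e0 w v k ω) + v k ω

/-- The filtering error of a filter with gains `G k` and initial error `e0`. -/
noncomputable def filtErr (k : ℕ) (ω : Ω) : Vec S.n :=
  predErr S G e0 w v k ω - act (G k) (innov S G e0 w v k ω)

/-- The prediction error of a remote estimator that receives the filter estimate when `σ k = 1`. -/
noncomputable def remotePredErr : ℕ → Ω → Vec S.n
  | 0 => e0
  | k + 1 => fun ω =>
    act S.A (S.remoteUpdate (σ k ω) (filtErr S G e0 w v k ω) (remotePredErr k ω)) + w k ω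

/-- The error of a remote estimator that receives the filter estimate when `σ k = 1`. -/
noncomputable def remoteErr (k : ℕ) (ω : Ω) : Vec S.n :=
  S.remoteUpdate (σ k ω) (filtErr S G e0 w v k ω) (remotePredErr S G e0 w v σ k ω)

theorem predErr_succ (k : ℕ) (ω : Ω) :
    predErr S G e0 w v (k + 1) ω = act S.A (filtErr S G e0 w v k ω) + w k ω := rfl

theorem remotePredErr_succ (k : ℕ) (ω : Ω) :
    remotePredErr S G e0 w v σ (k + 1) ω = act S.A (remoteErr S G e0 w v σ k ω) + w k ω := rfl

theorem filtErr_eq (k : ℕ) (ω : Ω) : filtErr S G e0 w v k ω =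
    act (1 - G k * S.C) (predErr S G e0 w v k ω) - act (G k) (v k ω) := by
  rw [filtErr, innov, sub_act, one_act, mul_act, act_add]
  abel

/-- The input enters the state and its prediction identically and cancels: control has no effect on
the quality of estimation. -/
theorem state_sub_filterPred (F : Matrix (Fin S.n) (Fin S.o) ℝ) (x0 : Ω → Vec S.n)
    (u : ℕ → Ω → Vec S.m) (k : ℕ) (ω : Ω) :
    stateProc S x0 w u k ω -
      S.filterPred F (x0 ω) (fun t => w t ω) (fun t => v t ω) (fun t => u t ω) k =
      predErr S (fun _ => F) x0 w v k ω := by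
  induction k with
  | zero => simp [stateProc, Loop.state, Loop.filterPred, predErr]
  | succ k ih =>
    rw [predErr_succ, filtErr, innov, ← ih]
    simp only [stateProc, Loop.state, Loop.filterPred, Loop.filterUpdate, act_sub, act_add]
    abel

theorem state_sub_filterEst (F : Matrix (Fin S.n) (Fin S.o) ℝ) (x0 : Ω → Vec S.n)
    (u : ℕ → Ω → Vec S.m) (k : ℕ) (ω : Ω) :
    stateProc S x0 w u k ω -
      S.filterEst F (x0 ω) (fun t => w t ω) (fun t => v t ω) (fun t => u t ω) k =
      filtErr S (fun _ => F) x0 w v k ω := by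
  rw [filtErr, innov, ← state_sub_filterPred S w v F x0 u k ω]
  simp only [stateProc, Loop.filterEst, Loop.filterUpdate, act_sub, act_add]
  abel

theorem state_sub_remotePred (F : Matrix (Fin S.n) (Fin S.o) ℝ) (x0 : Ω → Vec S.n)
    (u : ℕ → Ω → Vec S.m) (k : ℕ) (ω : Ω) :
    stateProc S x0 w u k ω - S.remotePred F (x0 ω) (fun t => w t ω) (fun t => v t ω)
      (fun t => σ t ω) (fun t => u t ω) k = remotePredErr S (fun _ => F) x0 w v σ k ω := by
  induction k with
  | zero => simp [stateProc, Loop.state, Loop.remotePred, remotePredErr]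
  | succ k ih =>
    rw [remotePredErr_succ, remoteErr, ← ih, ← state_sub_filterEst S w v F x0 u k ω]
    simp only [stateProc, Loop.state, Loop.remotePred, Loop.remoteUpdate]
    split_ifs <;> simp only [act_sub] <;> abel

theorem state_sub_remoteEst (F : Matrix (Fin S.n) (Fin S.o) ℝ) (x0 : Ω → Vec S.n)
    (u : ℕ → Ω → Vec S.m) (k : ℕ) (ω : Ω) :
    stateProc S x0 w u k ω - S.remoteEst F (x0 ω) (fun t => w t ω) (fun t => v t ω)
      (fun t => σ t ω) (fun t => u t ω) k = remoteErr S (fun _ => F) x0 w v σ k ω := by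
  rw [remoteErr, ← state_sub_remotePred S w v σ F x0 u k ω, ← state_sub_filterEst S w v F x0 u k ω]
  simp only [Loop.remoteEst, Loop.remoteUpdate]
  split_ifs <;> rfl

variable {S G e0 w v σ}

theorem measurable_filtErr {m : MeasurableSpace Ω} {k : ℕ}
    (h : Measurable[m] (predErr S G e0 w v k)) (hv : Measurable[m] (v k)) :
    Measurable[m] (filtErr S G e0 w v k) :=
  h.sub ((measurable_act _).comp (((measurable_act _).comp h).add hv))

theorem measurable_predErr_succ {m : MeasurableSpace Ω} {k : ℕ}
    (h : Measurable[m] (filtErr S G e0 w v k)) (hw : Measurable[m] (w k)) :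
    Measurable[m] (predErr S G e0 w v (k + 1)) :=
  ((measurable_act _).comp h).add hw

theorem measurable_remoteErr {m : MeasurableSpace Ω} {k : ℕ}
    (h : Measurable[m] (filtErr S G e0 w v k)) (h' : Measurable[m] (remotePredErr S G e0 w v σ k))
    (hσ : Measurable[m] (σ k)) : Measurable[m] (remoteErr S G e0 w v σ k) := by
  unfold remoteErr Loop.remoteUpdate
  exact Measurable.ite (hσ (measurableSet_singleton 1)) h h'

end Errors

-- Measurability, integrability and covariance recursions of the errors.

section ErrorStatistics

variable {Ω : Type*} {m0 : MeasurableSpace Ω} {μ : Measure Ω}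
  {S : Loop} {G : ℕ → Matrix (Fin S.n) (Fin S.o) ℝ} {x0 e0 : Ω → Vec S.n}
  {w : ℕ → Ω → Vec S.n} {v : ℕ → Ω → Vec S.o} {σ : ℕ → Ω → ℝ} {s : ℝ}

namespace LoopNoise

/-- Every success, also a future one, belongs to the past information from time 0 on; this is
harmless since v and w stay independent of it. -/
theorem comap_σ_le_pastInfo (l k : ℕ) :
    MeasurableSpace.comap (σ l) inferInstance ≤ pastInfo x0 w v σ k := by
  induction k with
  | zero => exact le_sup_of_le_right (le_iSup (fun l => MeasurableSpace.comap (σ l) inferInstance) l)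
  | succ k ih => exact ih.trans (le_sup_left.trans le_sup_left)

theorem pastInfo_le (h : LoopNoise S μ x0 w v σ s) (k : ℕ) : pastInfo x0 w v σ k ≤ m0 := by
  induction k with
  | zero => exact sup_le h.measurable_x0.comap_le (iSup_le fun l => (h.measurable_σ l).comap_le)
  | succ k ih => exact sup_le (sup_le ih (h.measurable_v k).comap_le) (h.measurable_w k).comap_le

theorem pastInfo_sup_le (h : LoopNoise S μ x0 w v σ s) (k : ℕ) :
    pastInfo x0 w v σ k ⊔ MeasurableSpace.comap (v k) inferInstance ≤ m0 :=
  sup_le (h.pastInfo_le k) (h.measurable_v k).comap_le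

theorem plantInfo_le (h : LoopNoise S μ x0 w v σ s) (k : ℕ) : plantInfo x0 w v σ k ≤ m0 :=
  sup_le (iSup₂_le fun l _ => (h.measurable_σ l).comap_le) (sup_le h.measurable_x0.comap_le
    (iSup_le fun l => sup_le (h.measurable_w l).comap_le (h.measurable_v l).comap_le))

theorem measurable_predErr_pastInfo
    (he : Measurable[MeasurableSpace.comap x0 inferInstance] e0) (k : ℕ) :
    Measurable[pastInfo x0 w v σ k] (predErr S G e0 w v k) := by
  induction k with
  | zero => exact he.mono le_sup_left le_rfl
  | succ k ih =>
    refine measurable_predErr_succ (measurable_filtErr (ih.mono ?_ le_rfl)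
      (measurable_iff_comap_le.2 ?_)) (measurable_iff_comap_le.2 le_sup_right)
    · exact le_sup_left.trans le_sup_left
    · exact le_sup_right.trans le_sup_left

theorem measurable_filtErr_pastInfo
    (he : Measurable[MeasurableSpace.comap x0 inferInstance] e0) (k : ℕ) :
    Measurable[pastInfo x0 w v σ k ⊔ MeasurableSpace.comap (v k) inferInstance]
      (filtErr S G e0 w v k) :=
  measurable_filtErr ((measurable_predErr_pastInfo he k).mono le_sup_left le_rfl)
    (measurable_iff_comap_le.2 le_sup_right)

theorem measurable_remotePredErr_pastInfo
    (he : Measurable[MeasurableSpace.comap x0 inferInstance] e0) (k : ℕ) :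
    Measurable[pastInfo x0 w v σ k] (remotePredErr S G e0 w v σ k) := by
  induction k with
  | zero => exact he.mono le_sup_left le_rfl
  | succ k ih =>
    refine ((measurable_act S.A).comp (measurable_remoteErr ?_ (ih.mono ?_ le_rfl)
      (measurable_iff_comap_le.2 (comap_σ_le_pastInfo k (k + 1))))).add
      (measurable_iff_comap_le.2 le_sup_right)
    · exact (measurable_filtErr_pastInfo he k).mono le_sup_left le_rfl
    · exact le_sup_left.trans le_sup_left

theorem measurable_remoteErr_pastInfo
    (he : Measurable[MeasurableSpace.comap x0 inferInstance] e0) (k : ℕ) :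
    Measurable[pastInfo x0 w v σ k ⊔ MeasurableSpace.comap (v k) inferInstance]
      (remoteErr S G e0 w v σ k) :=
  measurable_remoteErr (measurable_filtErr_pastInfo he k)
    ((measurable_remotePredErr_pastInfo he k).mono le_sup_left le_rfl)
    (measurable_iff_comap_le.2 ((comap_σ_le_pastInfo k k).trans le_sup_left))

theorem measurable_w_plantInfo (l k : ℕ) : Measurable[plantInfo x0 w v σ k] (w l) :=
  measurable_iff_comap_le.2 (le_sup_of_le_right (le_sup_of_le_right (le_sup_left.trans
    (le_iSup (fun l => MeasurableSpace.comap (w l) inferInstance ⊔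
      MeasurableSpace.comap (v l) inferInstance) l))))

theorem measurable_v_plantInfo (l k : ℕ) : Measurable[plantInfo x0 w v σ k] (v l) :=
  measurable_iff_comap_le.2 (le_sup_of_le_right (le_sup_of_le_right (le_sup_right.trans
    (le_iSup (fun l => MeasurableSpace.comap (w l) inferInstance ⊔
      MeasurableSpace.comap (v l) inferInstance) l))))

theorem measurable_predErr_plantInfo
    (he : Measurable[MeasurableSpace.comap x0 inferInstance] e0) (l k : ℕ) :
    Measurable[plantInfo x0 w v σ k] (predErr S G e0 w v l) := by
  induction l with
  | zero => exact he.mono (le_sup_of_le_right le_sup_left) le_rfl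
  | succ l ih =>
    exact measurable_predErr_succ (measurable_filtErr ih (measurable_v_plantInfo l k))
      (measurable_w_plantInfo l k)

theorem measurable_filtErr_plantInfo
    (he : Measurable[MeasurableSpace.comap x0 inferInstance] e0) (l k : ℕ) :
    Measurable[plantInfo x0 w v σ k] (filtErr S G e0 w v l) :=
  measurable_filtErr (measurable_predErr_plantInfo he l k) (measurable_v_plantInfo l k)

theorem measurable_remotePredErr_plantInfo
    (he : Measurable[MeasurableSpace.comap x0 inferInstance] e0) {l k : ℕ} (hl : l ≤ k) :
    Measurable[plantInfo x0 w v σ k] (remotePredErr S G e0 w v σ l) := by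
  induction l with
  | zero => exact he.mono (le_sup_of_le_right le_sup_left) le_rfl
  | succ l ih =>
    refine ((measurable_act S.A).comp (measurable_remoteErr (measurable_filtErr_plantInfo he l k)
      (ih (by omega)) (measurable_iff_comap_le.2 (le_sup_of_le_left ?_)))).add
      (measurable_w_plantInfo l k)
    exact le_iSup₂_of_le l (by exact hl) le_rfl

theorem memLp_w (h : LoopNoise S μ x0 w v σ s) (k : ℕ) : MemLp (w k) 2 μ :=
  (h.law_w k).hasGaussianLaw.memLp_two

theorem memLp_v (h : LoopNoise S μ x0 w v σ s) (k : ℕ) : MemLp (v k) 2 μ :=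
  (h.law_v k).hasGaussianLaw.memLp_two

theorem memLp_predErr (h : LoopNoise S μ x0 w v σ s) (he : MemLp e0 2 μ) (k : ℕ) :
    MemLp (predErr S G e0 w v k) 2 μ := by
  induction k with
  | zero => exact he
  | succ k ih =>
    exact (memLp_act S.A (ih.sub (memLp_act (G k) ((memLp_act S.C ih).add (h.memLp_v k))))).add
      (h.memLp_w k)

theorem memLp_innov (h : LoopNoise S μ x0 w v σ s) (he : MemLp e0 2 μ) (k : ℕ) :
    MemLp (innov S G e0 w v k) 2 μ :=
  (memLp_act S.C (h.memLp_predErr he k)).add (h.memLp_v k)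

theorem memLp_filtErr (h : LoopNoise S μ x0 w v σ s) (he : MemLp e0 2 μ) (k : ℕ) :
    MemLp (filtErr S G e0 w v k) 2 μ :=
  (h.memLp_predErr he k).sub (memLp_act (G k) (h.memLp_innov he k))

theorem memLp_remoteUpdate {τ : Ω → ℝ} (hτ : Measurable τ) {X Y : Ω → Vec S.n} (hX : MemLp X 2 μ)
    (hY : MemLp Y 2 μ) : MemLp (fun ω => S.remoteUpdate (τ ω) (X ω) (Y ω)) 2 μ := by
  classical
  refine (hX.norm.add hY.norm).mono ?_ (Eventually.of_forall fun ω => ?_)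
  · have := AEStronglyMeasurable.piecewise (hτ (measurableSet_singleton 1)) hX.1.restrict
      hY.1.restrict
    exact this.congr (Eventually.of_forall fun ω => by
      simp [Set.piecewise, Loop.remoteUpdate])
  · simp only [Pi.add_apply, Loop.remoteUpdate]
    rw [Real.norm_of_nonneg (by positivity)]
    split_ifs
    · linarith [norm_nonneg (Y ω)]
    · linarith [norm_nonneg (X ω)]

theorem memLp_remotePredErr (h : LoopNoise S μ x0 w v σ s) (he : MemLp e0 2 μ) (k : ℕ) :
    MemLp (remotePredErr S G e0 w v σ k) 2 μ := by
  induction k with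
  | zero => exact he
  | succ k ih =>
    exact (memLp_act S.A (memLp_remoteUpdate (h.measurable_σ k) (h.memLp_filtErr he k) ih)).add
      (h.memLp_w k)

theorem memLp_remoteErr (h : LoopNoise S μ x0 w v σ s) (he : MemLp e0 2 μ) (k : ℕ) :
    MemLp (remoteErr S G e0 w v σ k) 2 μ :=
  memLp_remoteUpdate (h.measurable_σ k) (h.memLp_filtErr he k) (h.memLp_remotePredErr he k)

theorem crossMom_w (h : LoopNoise S μ x0 w v σ s) {X : Ω → Vec S.n} {k : ℕ}
    (hX : Measurable[pastInfo x0 w v σ k ⊔ MeasurableSpace.comap (v k) inferInstance] X) :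
    crossMom μ X (w k) = 0 :=
  crossMom_eq_zero_of_indep (h.pastInfo_sup_le k) (h.measurable_w k).comap_le (h.indep_w k).symm hX
    (comap_measurable _) (integral_coord_of_hasLaw (h.law_w k))

theorem crossMom_v (h : LoopNoise S μ x0 w v σ s) {X : Ω → Vec S.n} {k : ℕ}
    (hX : Measurable[pastInfo x0 w v σ k] X) : crossMom μ X (v k) = 0 :=
  crossMom_eq_zero_of_indep (h.pastInfo_le k) (h.measurable_v k).comap_le (h.indep_v k).symm hX
    (comap_measurable _) (integral_coord_of_hasLaw (h.law_v k))

variable [IsProbabilityMeasure μ]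

/-- The measurement noise at time `k` is orthogonal to the prediction error, so the covariances add.
The gain is arbitrary here. -/
theorem crossMom_filtErr (h : LoopNoise S μ x0 w v σ s) (hS : S.Regular)
    (hm : Measurable[MeasurableSpace.comap x0 inferInstance] e0) (he : MemLp e0 2 μ) (k : ℕ) :
    crossMom μ (filtErr S G e0 w v k) (filtErr S G e0 w v k) =
      S.joseph (G k) (crossMom μ (predErr S G e0 w v k) (predErr S G e0 w v k)) := by
  have hp := h.memLp_predErr (G := G) he k
  have hv := h.memLp_v k
  rw [funext (filtErr_eq S G e0 w v k), crossMom_sub_self (memLp_act _ hp) (memLp_act _ hv),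
    crossMom_act_self _ hp, crossMom_act_self _ hv,
    crossMom_self_of_hasLaw hS.V_posDef.posSemidef (h.law_v k), Loop.joseph]
  rw [crossMom_act_left _ hp (memLp_act _ hv), crossMom_act_right _ hp hv,
    h.crossMom_v (measurable_predErr_pastInfo hm k), Matrix.zero_mul, Matrix.mul_zero]

theorem crossMom_predErr_succ (h : LoopNoise S μ x0 w v σ s) (hS : S.Regular)
    (hm : Measurable[MeasurableSpace.comap x0 inferInstance] e0) (he : MemLp e0 2 μ) (k : ℕ) :
    crossMom μ (predErr S G e0 w v (k + 1)) (predErr S G e0 w v (k + 1)) =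
      S.predCov (crossMom μ (filtErr S G e0 w v k) (filtErr S G e0 w v k)) := by
  have hf := h.memLp_filtErr (G := G) he k
  rw [funext (predErr_succ S G e0 w v k), crossMom_add_self (memLp_act _ hf) (h.memLp_w k),
    crossMom_act_self _ hf, crossMom_self_of_hasLaw hS.W_posDef.posSemidef (h.law_w k),
    Loop.predCov]
  exact h.crossMom_w ((measurable_act _).comp (measurable_filtErr_pastInfo hm k))

theorem crossMom_remotePredErr_succ (h : LoopNoise S μ x0 w v σ s) (hS : S.Regular)
    (hm : Measurable[MeasurableSpace.comap x0 inferInstance] e0) (he : MemLp e0 2 μ) (k : ℕ) :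
    crossMom μ (remotePredErr S G e0 w v σ (k + 1)) (remotePredErr S G e0 w v σ (k + 1)) =
      S.predCov (crossMom μ (remoteErr S G e0 w v σ k) (remoteErr S G e0 w v σ k)) := by
  have hf := h.memLp_remoteErr (G := G) he k
  rw [funext (remotePredErr_succ S G e0 w v σ k), crossMom_add_self (memLp_act _ hf) (h.memLp_w k),
    crossMom_act_self _ hf, crossMom_self_of_hasLaw hS.W_posDef.posSemidef (h.law_w k),
    Loop.predCov]
  exact h.crossMom_w ((measurable_act _).comp (measurable_remoteErr_pastInfo hm k))

/-- The filtering error and the remote prediction error involve only plant noise and earlier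
successes. They are thus independent of σ_k, and the integrals over success and failure factor with
weights s and 1 - s. -/
theorem crossMom_remoteErr (h : LoopNoise S μ x0 w v σ s)
    (hm : Measurable[MeasurableSpace.comap x0 inferInstance] e0) (he : MemLp e0 2 μ) (k : ℕ) :
    crossMom μ (remoteErr S G e0 w v σ k) (remoteErr S G e0 w v σ k) =
      s • crossMom μ (filtErr S G e0 w v k) (filtErr S G e0 w v k) +
        (1 - s) • crossMom μ (remotePredErr S G e0 w v σ k) (remotePredErr S G e0 w v σ k) := by
  ext a b
  have hE' : MeasurableSet[MeasurableSpace.comap (σ k) inferInstance] {ω | σ k ω = 1} :=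
    ⟨{1}, measurableSet_singleton 1, rfl⟩
  have hE : MeasurableSet {ω | σ k ω = 1} := (h.measurable_σ k).comap_le _ hE'
  have hr := h.memLp_remoteErr (G := G) he k
  have hf := h.memLp_filtErr (G := G) he k
  have hp := h.memLp_remotePredErr (G := G) he k
  have c : ∀ l, Measurable fun x : Vec S.n => x l := fun l => by fun_prop
  have e1 := setIntegral_eq_mul_of_indep (h.plantInfo_le k) (h.measurable_σ k).comap_le
    (h.indep_σ k).symm (((c a).comp (measurable_filtErr_plantInfo hm k k)).mul
      ((c b).comp (measurable_filtErr_plantInfo (G := G) hm k k))) (integrable_coord_mul hf hf a b) hE'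
  have e2 := setIntegral_eq_mul_of_indep (h.plantInfo_le k) (h.measurable_σ k).comap_le
    (h.indep_σ k).symm (((c a).comp (measurable_remotePredErr_plantInfo hm le_rfl)).mul
      ((c b).comp (measurable_remotePredErr_plantInfo (G := G) hm le_rfl)))
    (integrable_coord_mul hp hp a b)
    (@MeasurableSet.compl Ω _ (MeasurableSpace.comap (σ k) inferInstance) hE')
  rw [probReal_compl_eq_one_sub hE, h.prob] at e2
  rw [h.prob] at e1
  have e3 := integral_add_compl hE (integrable_coord_mul hr hr a b)
  simp only [crossMom, of_apply, Matrix.add_apply, Matrix.smul_apply, smul_eq_mul]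
  rw [← e3]
  congr 1
  · refine Eq.trans ?_ e1
    refine setIntegral_congr_fun hE fun ω hω => ?_
    have hω' : σ k ω = 1 := hω
    simp [remoteErr, Loop.remoteUpdate, hω']
  · refine Eq.trans ?_ e2
    refine setIntegral_congr_fun hE.compl fun ω hω => ?_
    have hω' : ¬ σ k ω = 1 := hω
    simp [remoteErr, Loop.remoteUpdate, hω']

end LoopNoise

end ErrorStatistics

/-! ### Stationary error covariances -/

section Limits

open scoped Matrix.Norms.L2Operator Topology

variable {a : ℕ}

theorem summable_congrMap {M : Matrix (Fin a) (Fin a) ℝ} (hM : Summable fun j => ‖M ^ j‖)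
    (X : Matrix (Fin a) (Fin a) ℝ) : Summable fun j => M ^ j * X * (M ^ j)ᵀ := by
  refine Summable.of_norm_bounded (((summable_sq (fun _ => norm_nonneg _) hM)).mul_right ‖X‖)
    fun j => ?_
  rw [← congrMap_pow_apply]
  exact norm_congrMap_pow_le M X j

theorem tsum_congrMap_eq {M : Matrix (Fin a) (Fin a) ℝ} (hM : Summable fun j => ‖M ^ j‖)
    (X : Matrix (Fin a) (Fin a) ℝ) :
    ∑' j, M ^ j * X * (M ^ j)ᵀ = M * (∑' j, M ^ j * X * (M ^ j)ᵀ) * Mᵀ + X := by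
  have h := summable_congrMap hM X
  conv_lhs => rw [h.tsum_eq_zero_add]
  rw [← h.tsum_mul_left, ← (h.mul_left M).tsum_mul_right, add_comm]
  simp [pow_succ', Matrix.mul_assoc, transpose_mul]

/-- The solutions of a stable Lyapunov recursion converge. -/
theorem tendsto_lyapunov {M X : Matrix (Fin a) (Fin a) ℝ} (hM : Summable fun j => ‖M ^ j‖)
    {d e : ℕ → Matrix (Fin a) (Fin a) ℝ} (hd : ∀ k, d (k + 1) = M * d k * Mᵀ + e k)
    (he : Tendsto e atTop (𝓝 X)) : Tendsto d atTop (𝓝 (∑' j, M ^ j * X * (M ^ j)ᵀ)) := by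
  rw [← tendsto_sub_nhds_zero_iff]
  refine tendsto_lyapunov_recursion hM (e := fun k => e k - X) (fun k => ?_)
    (tendsto_sub_nhds_zero_iff.2 he)
  conv_lhs => rw [hd, tsum_congrMap_eq hM X]
  rw [Matrix.mul_sub, Matrix.sub_mul]
  abel

/-- Splitting (1-s)^j symmetrically as √(1-s)^j twice turns the cost series into the Lyapunov series
of √(1-s) A. -/
theorem seriesTerm_eq (S : Loop) (P Θ : Matrix (Fin S.n) (Fin S.n) ℝ) {s : ℝ} (hs : s ≤ 1) (j : ℕ) :
    seriesTerm S P Θ s j = (S.gainWeight P * ((√(1 - s) • S.A) ^ j * ((1 - s) • S.W + s • Θ) *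
      ((√(1 - s) • S.A) ^ j)ᵀ)).trace := by
  have h1 : √(1 - s) ^ j * √(1 - s) ^ j = (1 - s) ^ j := by
    rw [← mul_pow, Real.mul_self_sqrt (by linarith)]
  rw [trace_mul_comm, smul_pow, seriesTerm]
  simp only [Matrix.mul_add, Matrix.add_mul, trace_add, transpose_smul, Matrix.smul_mul,
    Matrix.mul_smul, trace_smul, smul_eq_mul]
  rw [pow_succ, ← h1]
  ring

/-- The stationary error covariance of the remote estimator. -/
noncomputable def remoteCov (S : Loop) (Θ : Matrix (Fin S.n) (Fin S.n) ℝ) (s : ℝ) :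
    Matrix (Fin S.n) (Fin S.n) ℝ :=
  ∑' j, (√(1 - s) • S.A) ^ j * ((1 - s) • S.W + s • Θ) * ((√(1 - s) • S.A) ^ j)ᵀ

theorem hasSum_seriesTerm (S : Loop) (P Θ : Matrix (Fin S.n) (Fin S.n) ℝ) {s : ℝ} (hs : s ≤ 1)
    (hM : Summable fun j => ‖(√(1 - s) • S.A) ^ j‖) :
    HasSum (seriesTerm S P Θ s) (S.gainWeight P * remoteCov S Θ s).trace := by
  have h := (summable_congrMap hM ((1 - s) • S.W + s • Θ)).hasSum
  have h2 := (h.mul_left (S.gainWeight P)).map (traceAddMonoidHom (Fin S.n) ℝ)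
    (continuous_id.matrix_trace)
  exact h2.congr_fun fun j => seriesTerm_eq S P Θ hs j

end Limits

-- Limits of the error covariances for the stationary and the time-varying gains.

section RemoteErrorLimits

open scoped Matrix.Norms.L2Operator Topology

variable {Ω : Type*} {m0 : MeasurableSpace Ω} {μ : Measure Ω} [IsProbabilityMeasure μ]
  {S : Loop} {G : ℕ → Matrix (Fin S.n) (Fin S.o) ℝ} {x0 e0 : Ω → Vec S.n}
  {w : ℕ → Ω → Vec S.n} {v : ℕ → Ω → Vec S.o} {σ : ℕ → Ω → ℝ} {s : ℝ}
  {Θ : Matrix (Fin S.n) (Fin S.n) ℝ}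

namespace LoopNoise

theorem s_le_one (h : LoopNoise S μ x0 w v σ s) : s ≤ 1 := by
  rw [← h.prob 0]; exact measureReal_le_one

/-- Holds for any gains and any initial error determined by x_0, as long as the filtering covariance
converges. It therefore serves both the actual filter and the comparison filter that knows x_0. -/
theorem tendsto_crossMom_remoteErr (h : LoopNoise S μ x0 w v σ s) (hS : S.Regular)
    (hM : Summable fun j => ‖(√(1 - s) • S.A) ^ j‖)
    (hm : Measurable[MeasurableSpace.comap x0 inferInstance] e0) (he : MemLp e0 2 μ)
    (hΘ : Tendsto (fun k => crossMom μ (filtErr S G e0 w v k) (filtErr S G e0 w v k)) atTop (𝓝 Θ)) :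
    Tendsto (fun k => crossMom μ (remoteErr S G e0 w v σ k) (remoteErr S G e0 w v σ k)) atTop
      (𝓝 (remoteCov S Θ s)) := by
  have hs : √(1 - s) * √(1 - s) = 1 - s := Real.mul_self_sqrt (by linarith [h.s_le_one])
  refine tendsto_lyapunov hM (e := fun k => (1 - s) • S.W +
    s • crossMom μ (filtErr S G e0 w v (k + 1)) (filtErr S G e0 w v (k + 1))) (fun k => ?_) ?_
  · rw [h.crossMom_remoteErr hm he (k + 1), h.crossMom_remotePredErr_succ hS hm he k, Loop.predCov]
    simp only [transpose_smul, Matrix.smul_mul, Matrix.mul_smul, smul_smul, hs, smul_add]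
    abel
  · exact tendsto_const_nhds.add ((hΘ.comp (tendsto_add_atTop_nat 1)).const_smul s)

/-- The error covariance of the stationary Kalman filter. -/
theorem tendsto_crossMom_filtErr_stationary (h : LoopNoise S μ x0 w v σ s) (hS : S.Regular)
    (hΘ : S.IsFilterRiccati Θ) :
    Tendsto (fun k => crossMom μ (filtErr S (fun _ => S.filterGain (S.predCov Θ)) x0 w v k)
      (filtErr S (fun _ => S.filterGain (S.predCov Θ)) x0 w v k)) atTop (𝓝 Θ) := by
  set F := S.filterGain (S.predCov Θ) with hF
  have hX := Loop.predCov_posSemidef hS hΘ.1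
  have h1 : Tendsto (fun k => crossMom μ (predErr S (fun _ => F) x0 w v k)
      (predErr S (fun _ => F) x0 w v k)) atTop (𝓝 (S.predCov Θ)) := by
    rw [← tendsto_sub_nhds_zero_iff]
    refine tendsto_lyapunov_recursion (hΘ.summable hS) (e := fun _ => 0) (fun k => ?_)
      tendsto_const_nhds
    rw [h.crossMom_predErr_succ hS (comap_measurable x0) h.memLp_x0,
      h.crossMom_filtErr hS (comap_measurable x0) h.memLp_x0, Loop.predCov_joseph]
    have h5 := hΘ.predCov_eq hS
    rw [← hF] at h5
    conv_lhs => rw [h5]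
    generalize S.A * (1 - F * S.C) = M
    rw [Matrix.mul_sub, Matrix.sub_mul]
    abel
  have h2 : Continuous (S.joseph F) := by
    unfold Loop.joseph
    fun_prop
  have h3 := (h2.tendsto _).comp h1
  rw [Loop.joseph_filterGain hS hX, hΘ.filterCov_eq] at h3
  refine h3.congr fun k => ?_
  rw [h.crossMom_filtErr hS (comap_measurable x0) h.memLp_x0]
  rfl

variable (S) in
/-- The gains of the Kalman filter for a known initial state. -/
noncomputable abbrev tvGain (k : ℕ) : Matrix (Fin S.n) (Fin S.o) ℝ := S.filterGain (S.riccatiSeq k)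

/-- With initial error 0 the true covariance follows the Riccati recursion exactly, so each gain is
the optimal one for the actual error. -/
theorem crossMom_predErr_tv (h : LoopNoise S μ x0 w v σ s) (hS : S.Regular) (k : ℕ) :
    crossMom μ (predErr S (tvGain S) (fun _ => 0) w v k) (predErr S (tvGain S) (fun _ => 0) w v k) =
      S.riccatiSeq k := by
  induction k with
  | zero =>
    ext a b
    simp [predErr, crossMom, Loop.riccatiSeq]
  | succ k ih =>
    rw [h.crossMom_predErr_succ hS measurable_const (memLp_const 0),
      h.crossMom_filtErr hS measurable_const (memLp_const 0), ih,
      Loop.joseph_filterGain hS (Loop.riccatiSeq_posSemidef hS k)]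
    rfl

theorem tendsto_crossMom_filtErr_tv (h : LoopNoise S μ x0 w v σ s) (hS : S.Regular)
    (hΘ : S.IsFilterRiccati Θ) :
    Tendsto (fun k => crossMom μ (filtErr S (tvGain S) (fun _ => 0) w v k)
      (filtErr S (tvGain S) (fun _ => 0) w v k)) atTop (𝓝 Θ) := by
  have h1 := Loop.tendsto_filterCov hS (Loop.predCov_posSemidef hS hΘ.1)
    (Loop.tendsto_riccatiSeq hS hΘ)
  rw [hΘ.filterCov_eq] at h1
  refine h1.congr fun k => ?_
  rw [h.crossMom_filtErr hS measurable_const (memLp_const 0), h.crossMom_predErr_tv hS,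
    Loop.joseph_filterGain hS (Loop.riccatiSeq_posSemidef hS k)]

end LoopNoise

end RemoteErrorLimits

/-! ### The Kalman filter for a known initial state -/

section Innovations

variable {Ω : Type*} {S : Loop}

/-- The σ-algebra generated by the initial state, the transmission successes, and the innovations
before time `k`. -/
@[reducible]
noncomputable def innovInfo (x0 : Ω → Vec S.n) (w : ℕ → Ω → Vec S.n) (v : ℕ → Ω → Vec S.o)
    (σ : ℕ → Ω → ℝ) : ℕ → MeasurableSpace Ω
  | 0 => MeasurableSpace.comap x0 inferInstance ⊔ ⨆ l, MeasurableSpace.comap (σ l) inferInstance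
  | k + 1 => MeasurableSpace.comap (innov S (LoopNoise.tvGain S) (fun _ => 0) w v k) inferInstance ⊔
      innovInfo x0 w v σ k

variable {m0 : MeasurableSpace Ω} {μ : Measure Ω} {x0 : Ω → Vec S.n}
  {w : ℕ → Ω → Vec S.n} {v : ℕ → Ω → Vec S.o} {σ : ℕ → Ω → ℝ} {s : ℝ}

/-- `act M` as a continuous linear map. -/
noncomputable def actL {a b : ℕ} (M : Matrix (Fin a) (Fin b) ℝ) : Vec b →L[ℝ] Vec a :=
  LinearMap.toContinuousLinearMap (Matrix.toEuclideanLin M)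

namespace LoopNoise

theorem measurable_innov {m : MeasurableSpace Ω} {k : ℕ}
    {G : ℕ → Matrix (Fin S.n) (Fin S.o) ℝ} {e0 : Ω → Vec S.n}
    (h : Measurable[m] (predErr S G e0 w v k)) (hv : Measurable[m] (v k)) :
    Measurable[m] (innov S G e0 w v k) :=
  ((measurable_act _).comp h).add hv

theorem innovInfo_le_pastInfo (k : ℕ) : innovInfo x0 w v σ k ≤ pastInfo x0 w v σ k := by
  induction k with
  | zero => exact le_rfl
  | succ k ih =>
    refine sup_le ?_ (ih.trans (le_sup_left.trans le_sup_left))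
    refine (measurable_innov ((measurable_predErr_pastInfo (x0 := x0) (σ := σ) measurable_const k).mono ?_ le_rfl)
      (measurable_iff_comap_le.2 ?_)).comap_le
    · exact le_sup_left.trans le_sup_left
    · exact le_sup_right.trans le_sup_left

theorem innovInfo_succ_le (k : ℕ) : innovInfo x0 w v σ (k + 1) ≤
    pastInfo x0 w v σ k ⊔ MeasurableSpace.comap (v k) inferInstance :=
  sup_le (measurable_innov ((measurable_predErr_pastInfo measurable_const k).mono le_sup_left le_rfl)
    (measurable_iff_comap_le.2 le_sup_right)).comap_le ((innovInfo_le_pastInfo k).trans le_sup_left)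

theorem innovInfo_mono {k l : ℕ} (hkl : k ≤ l) : innovInfo x0 w v σ k ≤ innovInfo x0 w v σ l :=
  monotone_nat_of_le_succ (fun _ => le_sup_right) hkl

variable [IsProbabilityMeasure μ]

theorem integral_coord_predErr_tv (h : LoopNoise S μ x0 w v σ s) (k : ℕ) :
    ∀ l, ∫ ω, predErr S (tvGain S) (fun _ => 0) w v k ω l ∂μ = 0 := by
  induction k with
  | zero => simp [predErr]
  | succ k ih =>
    have e1 := h.memLp_predErr (G := tvGain S) (memLp_const 0) k
    have e2 := h.memLp_innov (G := tvGain S) (memLp_const 0) k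
    have e3 := h.memLp_filtErr (G := tvGain S) (memLp_const 0) k
    refine integral_coord_add (memLp_act _ e3) (h.memLp_w k) (integral_coord_act _ e3 ?_)
      (integral_coord_of_hasLaw (h.law_w k))
    refine integral_coord_sub e1 (memLp_act _ e2) ih (integral_coord_act _ e2 ?_)
    exact integral_coord_add (memLp_act _ e1) (h.memLp_v k) (integral_coord_act _ e1 ih)
      (integral_coord_of_hasLaw (h.law_v k))

theorem integral_coord_filtErr_tv (h : LoopNoise S μ x0 w v σ s) (k : ℕ) (l : Fin S.n) :
    ∫ ω, filtErr S (tvGain S) (fun _ => 0) w v k ω l ∂μ = 0 := by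
  have e1 := h.memLp_predErr (G := tvGain S) (memLp_const 0) k
  have e2 := h.memLp_innov (G := tvGain S) (memLp_const 0) k
  refine integral_coord_sub e1 (memLp_act _ e2) (h.integral_coord_predErr_tv k)
    (integral_coord_act _ e2 ?_) l
  exact integral_coord_add (memLp_act _ e1) (h.memLp_v k)
    (integral_coord_act _ e1 (h.integral_coord_predErr_tv k)) (integral_coord_of_hasLaw (h.law_v k))

/-- The orthogonality principle: the gain solves G (C X Cᵀ + V) = X Cᵀ with X the covariance of the
actual prediction error. -/
theorem crossMom_filtErr_innov (h : LoopNoise S μ x0 w v σ s) (hS : S.Regular) (k : ℕ) :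
    crossMom μ (filtErr S (tvGain S) (fun _ => 0) w v k) (innov S (tvGain S) (fun _ => 0) w v k) =
      0 := by
  have e1 := h.memLp_predErr (G := tvGain S) (memLp_const 0) k
  have e2 := h.memLp_innov (G := tvGain S) (memLp_const 0) k
  have ev := h.memLp_v k
  have hc := h.crossMom_v (measurable_predErr_pastInfo (G := tvGain S) (S := S)
    (e0 := fun _ => 0) measurable_const k)
  have h1 : crossMom μ (predErr S (tvGain S) (fun _ => 0) w v k)
      (innov S (tvGain S) (fun _ => 0) w v k) = S.riccatiSeq k * S.Cᵀ := by
    change crossMom μ _ (fun ω => act S.C (predErr S (tvGain S) (fun _ => 0) w v k ω) + v k ω) = _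
    rw [crossMom_add_right e1 (memLp_act _ e1) ev, crossMom_act_right _ e1 e1, hc,
      h.crossMom_predErr_tv hS, add_zero]
  have h2 : crossMom μ (innov S (tvGain S) (fun _ => 0) w v k)
      (innov S (tvGain S) (fun _ => 0) w v k) = S.innovCov (S.riccatiSeq k) := by
    change crossMom μ (fun ω => act S.C (predErr S (tvGain S) (fun _ => 0) w v k ω) + v k ω)
      (fun ω => act S.C (predErr S (tvGain S) (fun _ => 0) w v k ω) + v k ω) = _
    rw [crossMom_add_self (memLp_act _ e1) ev, crossMom_act_self _ e1, h.crossMom_predErr_tv hS,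
      crossMom_self_of_hasLaw hS.V_posDef.posSemidef (h.law_v k), Loop.innovCov]
    rw [crossMom_act_left _ e1 ev, hc, Matrix.mul_zero]
  change crossMom μ (fun ω => predErr S (tvGain S) (fun _ => 0) w v k ω -
    act (tvGain S k) (innov S (tvGain S) (fun _ => 0) w v k ω)) _ = 0
  rw [crossMom_sub_left e1 (memLp_act _ e2) e2, crossMom_act_left _ e2 e2, h1, h2,
    Loop.filterGain_mul_innovCov hS (Loop.riccatiSeq_posSemidef hS k), sub_self]

/-- One step of the Kalman filter preserves Gaussianity and independence of the past. -/
theorem filter_step (h : LoopNoise S μ x0 w v σ s) (hS : S.Regular) (k : ℕ)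
    (hg : HasGaussianLaw (predErr S (tvGain S) (fun _ => 0) w v k) μ)
    (hi : Indep (MeasurableSpace.comap (predErr S (tvGain S) (fun _ => 0) w v k) inferInstance)
      (innovInfo x0 w v σ k) μ) :
    HasGaussianLaw (filtErr S (tvGain S) (fun _ => 0) w v k) μ ∧
      Indep (MeasurableSpace.comap (filtErr S (tvGain S) (fun _ => 0) w v k) inferInstance)
        (innovInfo x0 w v σ (k + 1)) μ := by
  have hpm := measurable_predErr_pastInfo (x0 := x0) (w := w) (v := v) (σ := σ) (G := tvGain S)
    (e0 := fun _ => 0) measurable_const k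
  have e1 := h.memLp_predErr (G := tvGain S) (memLp_const 0) k
  have e2 := h.memLp_innov (G := tvGain S) (memLp_const 0) k
  have e3 := h.memLp_filtErr (G := tvGain S) (memLp_const 0) k
  have hjoint : HasGaussianLaw (fun ω => (predErr S (tvGain S) (fun _ => 0) w v k ω, v k ω)) μ :=
    IndepFun.hasGaussianLaw hg (h.law_v k).hasGaussianLaw ((IndepFun_iff_Indep _ _ _).2
      (indep_of_indep_of_le_left (h.indep_v k).symm hpm.comap_le))
  have hpair : HasGaussianLaw (fun ω => (filtErr S (tvGain S) (fun _ => 0) w v k ω,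
      innov S (tvGain S) (fun _ => 0) w v k ω)) μ := by
    let Λ : Vec S.n × Vec S.o →L[ℝ] Vec S.o :=
      actL S.C ∘L ContinuousLinearMap.fst ℝ _ _ + ContinuousLinearMap.snd ℝ _ _
    exact hjoint.map_fun ((ContinuousLinearMap.fst ℝ _ _ - actL (tvGain S k) ∘L Λ).prod Λ)
  have hfg : HasGaussianLaw (filtErr S (tvGain S) (fun _ => 0) w v k) μ := hpair.fst
  -- Error and innovation are linear images of one Gaussian pair, so orthogonality upgrades to
  -- independence.
  have hind := indepFun_of_crossMom_eq_zero hpair e3 e2 (h.integral_coord_filtErr_tv k)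
    (h.crossMom_filtErr_innov hS k)
  refine ⟨hfg, ?_⟩
  have hY := (innovInfo_le_pastInfo (x0 := x0) (w := w) (v := v) (σ := σ) k)
  have hY0 := hY.trans (h.pastInfo_le k)
  have hp0 := hpm.comap_le.trans (h.pastInfo_le k)
  -- Past innovations are independent of the prediction error together with `v k`, hence of the new
  -- filtering error and new innovation jointly.
  have hi2 := indep_sup_right hY0 hp0 (h.measurable_v k).comap_le hi.symm
    (indep_of_indep_of_le_left (h.indep_v k).symm (sup_le hY hpm.comap_le))
  have hm1 : Measurable[MeasurableSpace.comap (predErr S (tvGain S) (fun _ => 0) w v k)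
      inferInstance ⊔ MeasurableSpace.comap (v k) inferInstance]
      (predErr S (tvGain S) (fun _ => 0) w v k) := measurable_iff_comap_le.2 le_sup_left
  have hm2 : Measurable[MeasurableSpace.comap (predErr S (tvGain S) (fun _ => 0) w v k)
      inferInstance ⊔ MeasurableSpace.comap (v k) inferInstance] (v k) :=
    measurable_iff_comap_le.2 le_sup_right
  have hF := (measurable_filtErr hm1 hm2).comap_le
  have hI := (measurable_innov hm1 hm2).comap_le
  have h0 := sup_le hp0 (h.measurable_v k).comap_le
  exact indep_sup_right (hF.trans h0) (hI.trans h0) hY0 ((IndepFun_iff_Indep _ _ _).1 hind)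
    (indep_of_indep_of_le_right hi2 (sup_le hF hI)).symm

/-- The induction starts from the constant error 0, which is Gaussian and independent of everything,
so the law of x_0 plays no role. -/
theorem predErr_tv (h : LoopNoise S μ x0 w v σ s) (hS : S.Regular) (k : ℕ) :
    HasGaussianLaw (predErr S (tvGain S) (fun _ => 0) w v k) μ ∧
      Indep (MeasurableSpace.comap (predErr S (tvGain S) (fun _ => 0) w v k) inferInstance)
        (innovInfo x0 w v σ k) μ := by
  induction k with
  | zero =>
    constructor
    · exact HasGaussianLaw.mk (by
        simp only [predErr]
        rw [Measure.map_const, measure_univ, one_smul]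
        infer_instance)
    · simp only [predErr]
      rw [MeasurableSpace.comap_const]
      exact indep_bot_left _
  | succ k ih =>
    obtain ⟨h1, h2⟩ := h.filter_step hS k ih.1 ih.2
    have hfm := (measurable_filtErr_pastInfo (x0 := x0) (w := w) (v := v) (σ := σ) (G := tvGain S)
      (e0 := fun _ => 0) measurable_const k).comap_le
    have hsup := sup_le (innovInfo_succ_le (x0 := x0) (w := w) (v := v) (σ := σ) k) hfm
    constructor
    · have hjoint : HasGaussianLaw (fun ω => (filtErr S (tvGain S) (fun _ => 0) w v k ω, w k ω)) μ :=
        IndepFun.hasGaussianLaw h1 (h.law_w k).hasGaussianLaw ((IndepFun_iff_Indep _ _ _).2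
          (indep_of_indep_of_le_left (h.indep_w k).symm hfm))
      exact hjoint.map_fun (actL S.A ∘L ContinuousLinearMap.fst ℝ _ _ + ContinuousLinearMap.snd ℝ _ _)
    · have h3 := indep_sup_right
        ((innovInfo_le_pastInfo (x0 := x0) (w := w) (v := v) (σ := σ) (k + 1)).trans
          (h.pastInfo_le (k + 1))) (hfm.trans (h.pastInfo_sup_le k)) (h.measurable_w k).comap_le
        h2.symm (indep_of_indep_of_le_left (h.indep_w k).symm hsup)
      refine (indep_of_indep_of_le_right h3 ?_).symm
      exact (measurable_predErr_succ (measurable_iff_comap_le.2 le_sup_left)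
        (measurable_iff_comap_le.2 le_sup_right)).comap_le

theorem filtErr_tv_indep (h : LoopNoise S μ x0 w v σ s) (hS : S.Regular) (k : ℕ) :
    Indep (MeasurableSpace.comap (filtErr S (tvGain S) (fun _ => 0) w v k) inferInstance)
        (innovInfo x0 w v σ (k + 1)) μ :=
  (h.filter_step hS k (h.predErr_tv hS k).1 (h.predErr_tv hS k).2).2

end LoopNoise

end Innovations

-- Information that depends on whether an event occurs.

section MixedInformation

variable {Ω : Type*}

/-- The σ-algebra that agrees with `m₁` on `E` and with `m₂` off `E`. -/
@[reducible]
def mixInfo (E : Set Ω) (m₁ m₂ : MeasurableSpace Ω) : MeasurableSpace Ω where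
  MeasurableSet' t := ∃ t₁ t₂, MeasurableSet[m₁] t₁ ∧ MeasurableSet[m₂] t₂ ∧
    t = t₁ ∩ E ∪ t₂ ∩ Eᶜ
  measurableSet_empty := ⟨∅, ∅, @MeasurableSet.empty Ω m₁, @MeasurableSet.empty Ω m₂, by simp⟩
  measurableSet_compl := by
    rintro _ ⟨t₁, t₂, h₁, h₂, rfl⟩
    refine ⟨t₁ᶜ, t₂ᶜ, @MeasurableSet.compl Ω _ m₁ h₁, @MeasurableSet.compl Ω _ m₂ h₂, ?_⟩
    ext ω
    by_cases hω : ω ∈ E <;> simp [hω]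
  measurableSet_iUnion := by
    intro f hf
    choose f₁ f₂ h₁ h₂ hff using hf
    refine ⟨⋃ n, f₁ n, ⋃ n, f₂ n, @MeasurableSet.iUnion Ω _ m₁ _ _ h₁,
      @MeasurableSet.iUnion Ω _ m₂ _ _ h₂, ?_⟩
    simp_rw [hff, Set.iUnion_union_distrib, Set.iUnion_inter]

theorem mixInfo_le {E : Set Ω} {m₁ m₂ m : MeasurableSpace Ω} (h₁ : m₁ ≤ m) (h₂ : m₂ ≤ m)
    (hE : MeasurableSet[m] E) : mixInfo E m₁ m₂ ≤ m := by
  rintro _ ⟨t₁, t₂, ht₁, ht₂, rfl⟩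
  exact @MeasurableSet.union Ω m _ _ (@MeasurableSet.inter Ω m _ _ (h₁ _ ht₁) hE)
    (@MeasurableSet.inter Ω m _ _ (h₂ _ ht₂) (@MeasurableSet.compl Ω _ m hE))

theorem le_mixInfo {E : Set Ω} {m₁ m₂ m : MeasurableSpace Ω} (h₁ : m ≤ m₁) (h₂ : m ≤ m₂) :
    m ≤ mixInfo E m₁ m₂ := fun t ht =>
  ⟨t, t, h₁ _ ht, h₂ _ ht, (Set.inter_union_compl t E).symm⟩

theorem measurable_mixInfo {E : Set Ω} {m₁ m₂ : MeasurableSpace Ω} {β : Type*} [MeasurableSpace β]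
    {f g k : Ω → β} (hf : Measurable[m₁] f) (hg : Measurable[m₂] g) (h1 : ∀ ω ∈ E, k ω = f ω)
    (h2 : ∀ ω ∉ E, k ω = g ω) : Measurable[mixInfo E m₁ m₂] k := by
  refine fun t ht => ⟨f ⁻¹' t, g ⁻¹' t, hf ht, hg ht, ?_⟩
  ext ω
  by_cases hω : ω ∈ E <;> simp [hω, h1, h2]

end MixedInformation

section Orthogonality

variable {Ω : Type*} {m0 : MeasurableSpace Ω} {μ : Measure Ω} [IsProbabilityMeasure μ]

/-- A vector whose integral over every event of `m` vanishes is uncorrelated with `m`. -/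
theorem crossMom_eq_zero_of_setIntegral {a b : ℕ} {m : MeasurableSpace Ω} (hm : m ≤ m0)
    {X : Ω → Vec a} {Y : Ω → Vec b} (hX : MemLp X 2 μ) (hY : MemLp Y 2 μ) (hXm : Measurable[m] X)
    (h : ∀ t, MeasurableSet[m] t → ∀ l, ∫ ω in t, Y ω l ∂μ = 0) : crossMom μ X Y = 0 := by
  ext k l
  have c : Measurable fun x : Vec a => x k := by fun_prop
  have hYi : Integrable (fun ω => Y ω l) μ := (memLp_coord hY l).integrable one_le_two
  have hXY := integrable_coord_mul hX hY k l
  have h1 : (fun _ => (0 : ℝ)) =ᵐ[μ] μ[fun ω => Y ω l | m] :=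
    ae_eq_condExp_of_forall_setIntegral_eq hm hYi (fun _ _ _ => integrableOn_zero)
      (fun t ht _ => by simp [h t ht l]) (stronglyMeasurable_const.aestronglyMeasurable)
  have h2 := condExp_mul_of_stronglyMeasurable_left (m := m) (μ := μ) (f := fun ω => X ω k)
    (g := fun ω => Y ω l) (c.comp hXm).stronglyMeasurable hXY hYi
  simp only [crossMom, of_apply, Matrix.zero_apply]
  rw [← integral_condExp hm]
  have h3 : μ[fun ω => X ω k * Y ω l | m] =ᵐ[μ] fun _ => 0 := by
    refine h2.trans ?_
    filter_upwards [h1] with ω hω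
    simp [← hω]
  rw [integral_congr_ae h3]
  simp

end Orthogonality

-- The enlarged information of the controller and the orthogonality of the remote error.

section ControllerInformation

variable {Ω : Type*} {S : Loop}

/-- An upper bound for the information of the controller before time `k`: the initial state, all
transmission successes, and the innovations up to the last success before time `k`. -/
@[reducible]
noncomputable def remoteInfo (x0 : Ω → Vec S.n) (w : ℕ → Ω → Vec S.n) (v : ℕ → Ω → Vec S.o)
    (σ : ℕ → Ω → ℝ) : ℕ → MeasurableSpace Ω
  | 0 => innovInfo x0 w v σ 0
  | k + 1 => mixInfo {ω | σ k ω = 1} (innovInfo x0 w v σ (k + 1)) (remoteInfo x0 w v σ k)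

variable {x0 : Ω → Vec S.n} {w : ℕ → Ω → Vec S.n} {v : ℕ → Ω → Vec S.o} {σ : ℕ → Ω → ℝ}

namespace LoopNoise

theorem measurableSet_success (k l : ℕ) :
    MeasurableSet[innovInfo x0 w v σ l] {ω | σ k ω = 1} := by
  have h : MeasurableSpace.comap (σ k) inferInstance ≤ innovInfo x0 w v σ l :=
    le_trans (le_sup_of_le_right
      (le_iSup (fun l => MeasurableSpace.comap (σ l) inferInstance) k)) (innovInfo_mono (Nat.zero_le l))
  exact h _ ⟨{1}, measurableSet_singleton 1, rfl⟩

theorem remoteInfo_le_innovInfo (k : ℕ) : remoteInfo x0 w v σ k ≤ innovInfo x0 w v σ k := by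
  induction k with
  | zero => exact le_rfl
  | succ k ih =>
    exact mixInfo_le le_rfl (ih.trans (innovInfo_mono k.le_succ)) (measurableSet_success k (k + 1))

theorem remoteInfo_mono {k l : ℕ} (hkl : k ≤ l) : remoteInfo x0 w v σ k ≤ remoteInfo x0 w v σ l :=
  monotone_nat_of_le_succ (f := remoteInfo x0 w v σ)
    (fun k => le_mixInfo ((remoteInfo_le_innovInfo k).trans (innovInfo_mono k.le_succ)) le_rfl) hkl

theorem comap_σ_le_remoteInfo (k l : ℕ) :
    MeasurableSpace.comap (σ k) inferInstance ≤ remoteInfo x0 w v σ l :=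
  le_trans (le_sup_of_le_right
    (le_iSup (fun l => MeasurableSpace.comap (σ l) inferInstance) k))
    (remoteInfo_mono (Nat.zero_le l))

theorem measurable_x0_remoteInfo (l : ℕ) : Measurable[remoteInfo x0 w v σ l] x0 :=
  measurable_iff_comap_le.2 (le_sup_left.trans (remoteInfo_mono (Nat.zero_le l)))

section Admissible

variable {F : Matrix (Fin S.n) (Fin S.o) ℝ} {u : ℕ → Ω → Vec S.m}

/-- The claims need a simultaneous induction: the input depends on received estimates, which depend
on earlier inputs. State minus error is the estimate of the comparison filter, computable from x_0,
inputs and innovations. The actual filter, with another gain and start, is computable from the same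
data, so whatever it transmits is covered too. -/
theorem admissible_aux (hσ : ∀ k ω, σ k ω = 0 ∨ σ k ω = 1)
    (hu : IsAdmissibleControl S F x0 w v σ u) (k : ℕ) :
    (∀ l < k, Measurable[remoteInfo x0 w v σ (l + 1)] (u l)) ∧
    (∀ l < k, Measurable[remoteInfo x0 w v σ (l + 1)] (fun ω => σ l ω •
      S.filterEst F (x0 ω) (fun t => w t ω) (fun t => v t ω) (fun t => u t ω) l)) ∧
    Measurable[innovInfo x0 w v σ k] (fun ω =>
      stateProc S x0 w u k ω - predErr S (tvGain S) (fun _ => 0) w v k ω) ∧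
    Measurable[innovInfo x0 w v σ k] (fun ω =>
      S.filterPred F (x0 ω) (fun t => w t ω) (fun t => v t ω) (fun t => u t ω) k) ∧
    Measurable[remoteInfo x0 w v σ k] (fun ω =>
      stateProc S x0 w u k ω - remotePredErr S (tvGain S) (fun _ => 0) w v σ k ω) ∧
    (∀ l < k, Measurable[remoteInfo x0 w v σ (l + 1)] (fun ω =>
      stateProc S x0 w u l ω - remoteErr S (tvGain S) (fun _ => 0) w v σ l ω)) := by
  induction k with
  | zero =>
    refine ⟨by simp, by simp, ?_, measurable_const, ?_, by simp⟩
    · have : Measurable[innovInfo x0 w v σ 0] x0 := measurable_x0_remoteInfo 0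
      simpa [stateProc, Loop.state, predErr] using this
    · have : Measurable[remoteInfo x0 w v σ 0] x0 := measurable_x0_remoteInfo 0
      simpa [stateProc, Loop.state, remotePredErr] using this
  | succ k ih =>
    obtain ⟨ihu, ihe, ihx, ihp, ihr, ihr'⟩ := ih
    have hinn : Measurable[innovInfo x0 w v σ (k + 1)] (innov S (tvGain S) (fun _ => 0) w v k) :=
      measurable_iff_comap_le.2 le_sup_left
    have hle : innovInfo x0 w v σ k ≤ innovInfo x0 w v σ (k + 1) := le_sup_right
    have ihx' := ihx.mono hle le_rfl
    have ihp' := ihp.mono hle le_rfl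
    have hest : Measurable[innovInfo x0 w v σ (k + 1)] (fun ω =>
        S.filterEst F (x0 ω) (fun t => w t ω) (fun t => v t ω) (fun t => u t ω) k) := by
      -- The measurement is recovered as y_k = C(x_k - prediction error) + innovation.
      have h1 := ihp'.add ((measurable_act F).comp ((((measurable_act S.C).comp ihx').add hinn).sub
        ((measurable_act S.C).comp ihp')))
      convert h1 using 2 with ω
      simp only [Loop.filterEst, Loop.filterUpdate, Pi.add_apply, Pi.sub_apply, Function.comp_apply,
        innov, act_sub, stateProc]
      abel_nf
    have hz : Measurable[remoteInfo x0 w v σ (k + 1)] (fun ω => σ k ω •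
        S.filterEst F (x0 ω) (fun t => w t ω) (fun t => v t ω) (fun t => u t ω) k) := by
      refine measurable_mixInfo hest (measurable_const (a := 0)) (fun ω hω => ?_) (fun ω hω => ?_)
      · have hω' : σ k ω = 1 := hω
        simp [hω']
      · have hω' : σ k ω = 0 := (hσ k ω).resolve_right hω
        simp [hω']
    have hz' : ∀ l < k + 1, Measurable[remoteInfo x0 w v σ (l + 1)] (fun ω => σ l ω •
        S.filterEst F (x0 ω) (fun t => w t ω) (fun t => v t ω) (fun t => u t ω) l) := fun l hl => by
      obtain h | rfl := Nat.lt_succ_iff_lt_or_eq.1 hl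
      · exact ihe l h
      · exact hz
    have huk : Measurable[remoteInfo x0 w v σ (k + 1)] (u k) := by
      refine (hu k).mono (iSup₂_le fun l hl => sup_le (comap_σ_le_remoteInfo l (k + 1)) ?_) le_rfl
      have hl' : l ≤ k := hl
      exact (hz' l (by omega)).comap_le.trans (remoteInfo_mono (by omega))
    have hfe : Measurable[innovInfo x0 w v σ (k + 1)] (fun ω => stateProc S x0 w u k ω -
        filtErr S (tvGain S) (fun _ => 0) w v k ω) := by
      have h1 := ihx'.add ((measurable_act (tvGain S k)).comp hinn)
      convert h1 using 2 with ω
      simp only [filtErr, Pi.add_apply, Function.comp_apply]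
      abel
    have hre : Measurable[remoteInfo x0 w v σ (k + 1)] (fun ω => stateProc S x0 w u k ω -
        remoteErr S (tvGain S) (fun _ => 0) w v σ k ω) := by
      -- A success resets the remote error to the filtering error, where `mixInfo` supplies all
      -- innovations; otherwise the old remote information suffices.
      refine measurable_mixInfo hfe ihr (fun ω hω => ?_) (fun ω hω => ?_)
      · have hω' : σ k ω = 1 := hω
        simp [remoteErr, Loop.remoteUpdate, hω']
      · have hω' : ¬ σ k ω = 1 := hω
        simp [remoteErr, Loop.remoteUpdate, hω']
    have huk' := huk.mono (remoteInfo_le_innovInfo (k + 1)) le_rfl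
    refine ⟨fun l hl => ?_, hz', ?_, ?_, ?_, fun l hl => ?_⟩
    · obtain h | rfl := Nat.lt_succ_iff_lt_or_eq.1 hl
      · exact ihu l h
      · exact huk
    · have h1 := ((measurable_act S.A).comp hfe).add ((measurable_act S.B).comp huk')
      convert h1 using 2 with ω
      simp only [predErr_succ, stateProc, Loop.state, Pi.add_apply, Function.comp_apply, act_sub]
      abel
    · exact ((measurable_act S.A).comp hest).add ((measurable_act S.B).comp huk')
    · have h1 := ((measurable_act S.A).comp hre).add ((measurable_act S.B).comp huk)
      convert h1 using 2 with ω
      simp only [remotePredErr_succ, stateProc, Loop.state, Pi.add_apply, Function.comp_apply, act_sub]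
      abel
    · obtain h | rfl := Nat.lt_succ_iff_lt_or_eq.1 hl
      · exact ihr' l h
      · exact hre

theorem measurable_control (hσ : ∀ k ω, σ k ω = 0 ∨ σ k ω = 1)
    (hu : IsAdmissibleControl S F x0 w v σ u) (k : ℕ) :
    Measurable[remoteInfo x0 w v σ (k + 1)] (u k) :=
  (admissible_aux hσ hu (k + 1)).1 k k.lt_succ_self

theorem measurable_state_sub_remoteErr (hσ : ∀ k ω, σ k ω = 0 ∨ σ k ω = 1)
    (hu : IsAdmissibleControl S F x0 w v σ u) (k : ℕ) :
    Measurable[remoteInfo x0 w v σ (k + 1)] (fun ω =>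
      stateProc S x0 w u k ω - remoteErr S (tvGain S) (fun _ => 0) w v σ k ω) :=
  (admissible_aux hσ hu (k + 1)).2.2.2.2.2 k k.lt_succ_self

theorem remoteInfo_succ_le_pastInfo (k : ℕ) : remoteInfo x0 w v σ (k + 1) ≤
    pastInfo x0 w v σ k ⊔ MeasurableSpace.comap (v k) inferInstance :=
  (remoteInfo_le_innovInfo (k + 1)).trans (innovInfo_succ_le k)

theorem measurable_state_pastInfo (hσ : ∀ k ω, σ k ω = 0 ∨ σ k ω = 1)
    (hu : IsAdmissibleControl S F x0 w v σ u) (k : ℕ) :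
    Measurable[pastInfo x0 w v σ k] (stateProc S x0 w u k) := by
  have h1 := ((admissible_aux hσ hu k).2.2.1.mono (innovInfo_le_pastInfo k) le_rfl).add
    (measurable_predErr_pastInfo (x0 := x0) (w := w) (v := v) (σ := σ) (G := tvGain S)
      (e0 := fun _ => 0) measurable_const k)
  convert h1 using 1
  ext1 ω
  simp

end Admissible

section Estimation

variable {m0 : MeasurableSpace Ω} {μ : Measure Ω} [IsProbabilityMeasure μ] {s : ℝ}

omit [IsProbabilityMeasure μ] in
theorem remoteInfo_le (h : LoopNoise S μ x0 w v σ s) (k : ℕ) : remoteInfo x0 w v σ k ≤ m0 :=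
  (remoteInfo_le_innovInfo k).trans ((innovInfo_le_pastInfo k).trans (h.pastInfo_le k))

/-- An event of the mixed information splits along success. On the success part the centred
filtering error is independent of the event; the failure part is an event of the previous remote
information, covered by the hypothesis. -/
theorem setIntegral_remoteErr_of_remotePredErr (h : LoopNoise S μ x0 w v σ s) (hS : S.Regular)
    (k : ℕ) (ih : ∀ t, MeasurableSet[remoteInfo x0 w v σ k] t → ∀ l,
      ∫ ω in t, remotePredErr S (tvGain S) (fun _ => 0) w v σ k ω l ∂μ = 0) :
    ∀ t, MeasurableSet[remoteInfo x0 w v σ (k + 1)] t → ∀ l,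
      ∫ ω in t, remoteErr S (tvGain S) (fun _ => 0) w v σ k ω l ∂μ = 0 := by
  rintro _ ⟨t₁, t₂, h₁, h₂, rfl⟩ l
  have hE := measurableSet_success (x0 := x0) (w := w) (v := v) (σ := σ) k (k + 1)
  -- The success at time `k` is already known at the previous stage because all successes were
  -- included from the start.
  have hEr : MeasurableSet[remoteInfo x0 w v σ k] {ω | σ k ω = 1} :=
    comap_σ_le_remoteInfo k k _ ⟨{1}, measurableSet_singleton 1, rfl⟩
  have hA := @MeasurableSet.inter Ω (innovInfo x0 w v σ (k + 1)) _ _ h₁ hE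
  have hB := @MeasurableSet.inter Ω (remoteInfo x0 w v σ k) _ _ h₂
    (@MeasurableSet.compl Ω _ (remoteInfo x0 w v σ k) hEr)
  have hY0 := (innovInfo_le_pastInfo (x0 := x0) (w := w) (v := v) (σ := σ) (k + 1)).trans
    (h.pastInfo_le (k + 1))
  have hA0 := hY0 _ hA
  have hB0 := h.remoteInfo_le k _ hB
  have hmem := h.memLp_remoteErr (G := tvGain S) (memLp_const 0) k
  have hint := (memLp_coord hmem l).integrable one_le_two
  have hf := h.memLp_filtErr (G := tvGain S) (memLp_const 0) k
  have c : Measurable fun x : Vec S.n => x l := by fun_prop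
  rw [setIntegral_union (Set.disjoint_left.2 fun ω hω hω' => hω'.2 hω.2) hB0 hint.integrableOn
    hint.integrableOn]
  have e1 : ∫ ω in t₁ ∩ {ω | σ k ω = 1}, remoteErr S (tvGain S) (fun _ => 0) w v σ k ω l ∂μ =
      ∫ ω in t₁ ∩ {ω | σ k ω = 1}, filtErr S (tvGain S) (fun _ => 0) w v k ω l ∂μ :=
    setIntegral_congr_fun hA0 fun ω hω => by
      have hω' : σ k ω = 1 := hω.2
      simp [remoteErr, Loop.remoteUpdate, hω']
  have e2 : ∫ ω in t₂ ∩ {ω | σ k ω = 1}ᶜ, remoteErr S (tvGain S) (fun _ => 0) w v σ k ω l ∂μ =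
      ∫ ω in t₂ ∩ {ω | σ k ω = 1}ᶜ, remotePredErr S (tvGain S) (fun _ => 0) w v σ k ω l ∂μ :=
    setIntegral_congr_fun hB0 fun ω hω => by
      have hω' : ¬ σ k ω = 1 := hω.2
      simp [remoteErr, Loop.remoteUpdate, hω']
  have e3 := setIntegral_eq_mul_of_indep ((measurable_filtErr_pastInfo (x0 := x0) (w := w)
    (v := v) (σ := σ) (G := tvGain S) (e0 := fun _ => 0) measurable_const k).comap_le.trans
      (h.pastInfo_sup_le k)) hY0 (h.filtErr_tv_indep hS k) (c.comp (comap_measurable _))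
      ((memLp_coord hf l).integrable one_le_two) hA
  rw [e1, e2, ih _ hB l, add_zero]
  refine e3.trans ?_
  have := h.integral_coord_filtErr_tv k l
  simp only [Function.comp_def, this, mul_zero]

/-- The remote error of the Kalman filter for a known initial state averages to zero over every
event known to the controller. -/
theorem setIntegral_remotePredErr (h : LoopNoise S μ x0 w v σ s) (hS : S.Regular) (k : ℕ) :
    ∀ t, MeasurableSet[remoteInfo x0 w v σ k] t → ∀ l,
      ∫ ω in t, remotePredErr S (tvGain S) (fun _ => 0) w v σ k ω l ∂μ = 0 := by
  induction k with
  | zero => simp [remotePredErr]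
  | succ k ih =>
    intro t ht l
    have hr := h.setIntegral_remoteErr_of_remotePredErr hS k ih t ht
    have hmem := h.memLp_remoteErr (G := tvGain S) (memLp_const 0) k
    have hw := h.memLp_w k
    have c : Measurable fun x : Vec S.n => x l := by fun_prop
    have e1 := setIntegral_eq_mul_of_indep (h.measurable_w k).comap_le (h.pastInfo_sup_le k)
      (h.indep_w k) (c.comp (comap_measurable _)) ((memLp_coord hw l).integrable one_le_two)
      (remoteInfo_succ_le_pastInfo k _ ht)
    have e2 := integral_coord_of_hasLaw (h.law_w k) l
    simp only [Function.comp_def, e2, mul_zero] at e1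
    simp only [remotePredErr_succ, PiLp.add_apply]
    rw [integral_add ((memLp_coord (memLp_act S.A hmem) l).integrable one_le_two).integrableOn
      ((memLp_coord hw l).integrable one_le_two).integrableOn, e1, add_zero]
    simp only [act_apply]
    rw [integral_finsetSum _ fun j _ =>
      (((memLp_coord hmem j).integrable one_le_two).const_mul _).integrableOn]
    simp [integral_const_mul, hr]

theorem crossMom_remoteErr_eq_zero (h : LoopNoise S μ x0 w v σ s) (hS : S.Regular) {k a : ℕ}
    {X : Ω → Vec a} (hX : MemLp X 2 μ) (hm : Measurable[remoteInfo x0 w v σ (k + 1)] X) :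
    crossMom μ X (remoteErr S (tvGain S) (fun _ => 0) w v σ k) = 0 :=
  crossMom_eq_zero_of_setIntegral (h.remoteInfo_le (k + 1)) hX
    (h.memLp_remoteErr (memLp_const 0) k) hm
    (h.setIntegral_remoteErr_of_remotePredErr hS k (h.setIntegral_remotePredErr hS k))

end Estimation

end LoopNoise

end ControllerInformation

-- The cost as a sum of squared deviations from the optimal state feedback.

section Cost

open scoped Matrix.Norms.L2Operator Topology

variable {Ω : Type*} {m0 : MeasurableSpace Ω} {μ : Measure Ω} [IsProbabilityMeasure μ]
  {S : Loop} {x0 : Ω → Vec S.n} {w : ℕ → Ω → Vec S.n} {v : ℕ → Ω → Vec S.o} {σ : ℕ → Ω → ℝ} {s : ℝ}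
  {P Θ : Matrix (Fin S.n) (Fin S.n) ℝ} {F : Matrix (Fin S.n) (Fin S.o) ℝ} {u : ℕ → Ω → Vec S.m}

theorem stateProc_succ (k : ℕ) (ω : Ω) : stateProc S x0 w u (k + 1) ω =
    act S.A (stateProc S x0 w u k ω) + act S.B (u k ω) + w k ω := rfl

/-- The expected cost of stage `k`. -/
noncomputable def stageCost (S : Loop) (μ : Measure Ω) (x0 : Ω → Vec S.n) (w : ℕ → Ω → Vec S.n)
    (u : ℕ → Ω → Vec S.m) (k : ℕ) : ℝ :=
  ∫ ω, quad S.Q (stateProc S x0 w u k ω) ∂μ + ∫ ω, quad S.R (u k ω) ∂μ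

omit [IsProbabilityMeasure μ] in
theorem stageCost_nonneg (hS : S.Regular) (k : ℕ) : 0 ≤ stageCost S μ x0 w u k :=
  add_nonneg (integral_nonneg fun _ => quad_nonneg hS.Q_posSemidef _)
    (integral_nonneg fun _ => quad_nonneg hS.R_posDef.posSemidef _)

omit [IsProbabilityMeasure μ] in
theorem lintegral_enorm_sq {a : ℕ} {X : Ω → Vec a} (hX : MemLp X 2 μ) :
    ∫⁻ ω, ‖X ω‖ₑ ^ 2 ∂μ = ENNReal.ofReal (∫ ω, ‖X ω‖ ^ 2 ∂μ) := by
  rw [ofReal_integral_eq_lintegral_ofReal (integrable_norm_sq hX)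
    (Eventually.of_forall fun _ => by positivity)]
  refine lintegral_congr fun ω => ?_
  rw [ENNReal.ofReal_pow (norm_nonneg _), ofReal_norm]

omit [IsProbabilityMeasure μ] in
theorem eLpNorm_two_sq {a : ℕ} (X : Ω → Vec a) :
    eLpNorm X 2 μ ^ 2 = ∫⁻ ω, ‖X ω‖ₑ ^ 2 ∂μ := by
  have := eLpNorm_nnreal_pow_eq_lintegral (f := X) (μ := μ) (p := 2) (by norm_num)
  norm_num at this
  exact_mod_cast this

namespace LoopNoise

omit [IsProbabilityMeasure μ] in
theorem memLp_state (h : LoopNoise S μ x0 w v σ s) (hu : ∀ k, MemLp (u k) 2 μ) (k : ℕ) :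
    MemLp (stateProc S x0 w u k) 2 μ := by
  induction k with
  | zero => exact h.memLp_x0
  | succ k ih => exact ((memLp_act S.A ih).add (memLp_act S.B (hu k))).add (h.memLp_w k)

omit [IsProbabilityMeasure μ] in
theorem lintegral_cost (h : LoopNoise S μ x0 w v σ s) (hS : S.Regular)
    (hu : ∀ k, MemLp (u k) 2 μ) (T : ℕ) :
    ∫⁻ ω, ENNReal.ofReal (∑ k ∈ Finset.range T,
      (quad S.Q (stateProc S x0 w u k ω) + quad S.R (u k ω))) ∂μ =
      ENNReal.ofReal (∑ k ∈ Finset.range T, stageCost S μ x0 w u k) := by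
  have hi : ∀ k, Integrable (fun ω => quad S.Q (stateProc S x0 w u k ω) + quad S.R (u k ω)) μ :=
    fun k => (integrable_quad _ (h.memLp_state hu k)).add (integrable_quad _ (hu k))
  rw [← ofReal_integral_eq_lintegral_ofReal (integrable_finsetSum _ fun k _ => hi k)
    (Eventually.of_forall fun ω => Finset.sum_nonneg fun k _ => add_nonneg
      (quad_nonneg hS.Q_posSemidef _) (quad_nonneg hS.R_posDef.posSemidef _)),
    integral_finsetSum _ fun k _ => hi k]
  congr 1
  exact Finset.sum_congr rfl fun k _ =>
    integral_add (integrable_quad _ (h.memLp_state hu k)) (integrable_quad _ (hu k))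

/-- The completed square in expectation. The disturbance contributes tr(PW) because it is orthogonal
to the current state and input. -/
theorem stage_identity (h : LoopNoise S μ x0 w v σ s) (hS : S.Regular) (hP : S.IsControlRiccati P)
    (hadm : IsAdmissibleControl S F x0 w v σ u) (hu : ∀ k, MemLp (u k) 2 μ) (k : ℕ) :
    ∫ ω, quad P (stateProc S x0 w u (k + 1) ω) ∂μ + stageCost S μ x0 w u k =
      ∫ ω, quad P (stateProc S x0 w u k ω) ∂μ +
      ∫ ω, quad (S.inputWeight P) (u k ω - act (S.controlGain P) (stateProc S x0 w u k ω)) ∂μ +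
      (P * S.W).trace := by
  have hx := h.memLp_state hu k
  have hz : MemLp (fun ω => act S.A (stateProc S x0 w u k ω) + act S.B (u k ω)) 2 μ :=
    (memLp_act S.A hx).add (memLp_act S.B (hu k))
  have hd : MemLp (fun ω => u k ω - act (S.controlGain P) (stateProc S x0 w u k ω)) 2 μ :=
    (hu k).sub (memLp_act _ hx)
  have hc : crossMom μ (fun ω => act S.A (stateProc S x0 w u k ω) + act S.B (u k ω)) (w k) = 0 := by
    have hxm : Measurable[pastInfo x0 w v σ k ⊔ MeasurableSpace.comap (v k) inferInstance]
        (stateProc S x0 w u k) :=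
      (measurable_state_pastInfo h.zero_or_one hadm k).mono le_sup_left le_rfl
    have hum : Measurable[pastInfo x0 w v σ k ⊔ MeasurableSpace.comap (v k) inferInstance] (u k) :=
      (measurable_control h.zero_or_one hadm k).mono (remoteInfo_succ_le_pastInfo k) le_rfl
    exact h.crossMom_w (((measurable_act S.A).comp hxm).add ((measurable_act S.B).comp hum))
  have h1 : ∫ ω, quad P (stateProc S x0 w u (k + 1) ω) ∂μ =
      ∫ ω, quad P (act S.A (stateProc S x0 w u k ω) + act S.B (u k ω)) ∂μ + (P * S.W).trace := by
    simp only [stateProc_succ]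
    have hzw : MemLp (fun ω => act S.A (stateProc S x0 w u k ω) + act S.B (u k ω) + w k ω) 2 μ :=
      hz.add (h.memLp_w k)
    rw [integral_quad P hzw, crossMom_add_self hz (h.memLp_w k) hc, Matrix.mul_add, trace_add,
      ← integral_quad P hz, crossMom_self_of_hasLaw hS.W_posDef.posSemidef (h.law_w k)]
  have h2 : ∫ ω, quad P (act S.A (stateProc S x0 w u k ω) + act S.B (u k ω)) ∂μ +
      stageCost S μ x0 w u k = ∫ ω, quad P (stateProc S x0 w u k ω) ∂μ +
      ∫ ω, quad (S.inputWeight P) (u k ω - act (S.controlGain P) (stateProc S x0 w u k ω)) ∂μ := by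
    have hi : Integrable (fun ω => quad P (act S.A (stateProc S x0 w u k ω) + act S.B (u k ω)) +
        quad S.Q (stateProc S x0 w u k ω)) μ := (integrable_quad _ hz).add (integrable_quad _ hx)
    rw [stageCost, ← add_assoc, ← integral_add (integrable_quad _ hz) (integrable_quad _ hx),
      ← integral_add hi (integrable_quad _ (hu k)),
      ← integral_add (integrable_quad _ hx) (integrable_quad _ hd)]
    exact integral_congr_ae (Eventually.of_forall fun ω => hP.complete_square hS _ _)
  linarith

theorem cost_identity (h : LoopNoise S μ x0 w v σ s) (hS : S.Regular) (hP : S.IsControlRiccati P)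
    (hadm : IsAdmissibleControl S F x0 w v σ u) (hu : ∀ k, MemLp (u k) 2 μ) (T : ℕ) :
    ∑ k ∈ Finset.range T, stageCost S μ x0 w u k + ∫ ω, quad P (stateProc S x0 w u T ω) ∂μ =
      ∫ ω, quad P (x0 ω) ∂μ + ∑ k ∈ Finset.range T, ∫ ω, quad (S.inputWeight P)
        (u k ω - act (S.controlGain P) (stateProc S x0 w u k ω)) ∂μ + T * (P * S.W).trace := by
  induction T with
  | zero => simp [stateProc, Loop.state]
  | succ T ih =>
    rw [Finset.sum_range_succ, Finset.sum_range_succ]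
    have := h.stage_identity hS hP hadm hu T
    push_cast
    linarith

omit [IsProbabilityMeasure μ] in
theorem integral_quad_inputWeight {D : Ω → Vec S.n} (hD : MemLp D 2 μ) :
    ∫ ω, quad (S.inputWeight P) (act (S.controlGain P) (D ω)) ∂μ =
      (S.gainWeight P * crossMom μ D D).trace := by
  rw [← integral_quad _ hD]
  refine integral_congr_ae (Eventually.of_forall fun ω => ?_)
  change quad (S.inputWeight P) (act (S.controlGain P) (D ω)) = _
  rw [quad_act]
  rfl

/-- No admissible control deviates less from the optimal state feedback than permitted by the
remote error of the Kalman filter for a known initial state. -/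
theorem le_integral_deviation (h : LoopNoise S μ x0 w v σ s) (hS : S.Regular)
    (hP : P.PosSemidef) (hadm : IsAdmissibleControl S F x0 w v σ u)
    (hu : ∀ k, MemLp (u k) 2 μ) (k : ℕ) :
    (S.gainWeight P * crossMom μ (remoteErr S (tvGain S) (fun _ => 0) w v σ k)
      (remoteErr S (tvGain S) (fun _ => 0) w v σ k)).trace ≤
    ∫ ω, quad (S.inputWeight P)
      (u k ω - act (S.controlGain P) (stateProc S x0 w u k ω)) ∂μ := by
  have hx := h.memLp_state hu k
  have hD := h.memLp_remoteErr (G := tvGain S) (memLp_const 0) k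
  -- Deviation from feedback of the comparison filter's remote estimate. It is known under the
  -- enlarged information, hence orthogonal to that filter's remote error.
  let Z : Ω → Vec S.m := fun ω => u k ω - act (S.controlGain P)
    (stateProc S x0 w u k ω - remoteErr S (tvGain S) (fun _ => 0) w v σ k ω)
  have hZ : MemLp Z 2 μ := (hu k).sub (memLp_act _ (hx.sub hD))
  have hZm : Measurable[remoteInfo x0 w v σ (k + 1)] Z :=
    (measurable_control h.zero_or_one hadm k).sub ((measurable_act _).comp
      (measurable_state_sub_remoteErr h.zero_or_one hadm k))
  have hc : crossMom μ Z (fun ω => act (S.controlGain P)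
      (remoteErr S (tvGain S) (fun _ => 0) w v σ k ω)) = 0 := by
    rw [crossMom_act_right _ hZ hD, h.crossMom_remoteErr_eq_zero hS hZ hZm, Matrix.zero_mul]
  have he : ∀ ω, u k ω - act (S.controlGain P) (stateProc S x0 w u k ω) =
      Z ω - act (S.controlGain P) (remoteErr S (tvGain S) (fun _ => 0) w v σ k ω) := fun ω => by
    simp only [Z, act_sub]
    abel
  simp_rw [he]
  have hKD := memLp_act (S.controlGain P) hD
  have hsub : MemLp (fun ω => Z ω - act (S.controlGain P)
    (remoteErr S (tvGain S) (fun _ => 0) w v σ k ω)) 2 μ := hZ.sub hKD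
  rw [integral_quad _ hsub, crossMom_sub_self hZ hKD hc, Matrix.mul_add, trace_add,
    ← integral_quad _ hZ, ← integral_quad _ hKD, integral_quad_inputWeight hD]
  have : 0 ≤ ∫ ω, quad (S.inputWeight P) (Z ω) ∂μ :=
    integral_nonneg fun ω => quad_nonneg (Loop.inputWeight_posDef hS hP).posSemidef _
  linarith

end LoopNoise

end Cost

/-! ### The certainty equivalence control -/

section Feedback

open scoped Matrix.Norms.L2Operator Topology

variable {Ω : Type*} {S : Loop} {x0 : Ω → Vec S.n} {w : ℕ → Ω → Vec S.n} {v : ℕ → Ω → Vec S.o}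
  {σ : ℕ → Ω → ℝ} {s : ℝ}
  {P Θ : Matrix (Fin S.n) (Fin S.n) ℝ} {F : Matrix (Fin S.n) (Fin S.o) ℝ}
  {K : Matrix (Fin S.m) (Fin S.n) ℝ}

/-- The remote estimate under certainty equivalence control. -/
theorem feedbackControl_eq (k : ℕ) (ω : Ω) :
    feedbackControl S K F x0 w v σ k ω = act K
      (stateProc S x0 w (feedbackControl S K F x0 w v σ) k ω - remoteErr S (fun _ => F) x0 w v σ k ω) := by
  rw [← state_sub_remoteEst S w v σ F x0 (feedbackControl S K F x0 w v σ) k ω, sub_sub_cancel]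
  exact S.feedbackInput_eq K F (x0 ω) (fun t => w t ω) (fun t => v t ω) (fun t => σ t ω) k

/-- The remote estimate is computed recursively from received data and earlier inputs, which are
themselves functions of received data. -/
theorem isAdmissibleControl_feedbackControl :
    IsAdmissibleControl S F x0 w v σ (feedbackControl S K F x0 w v σ) := by
  set u := feedbackControl S K F x0 w v σ with hu
  let I := controllerInfo S F x0 w v σ u
  have hmono : ∀ k, I k ≤ I (k + 1) := fun k =>
    biSup_mono fun l (hl : l ≤ k) => (by exact hl.trans k.le_succ)
  have hσm : ∀ k, Measurable[I k] (σ k) := fun k => measurable_iff_comap_le.2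
    (le_sup_left.trans (le_biSup (f := fun l => MeasurableSpace.comap (σ l) inferInstance ⊔
      MeasurableSpace.comap (fun ω => σ l ω •
          S.filterEst F (x0 ω) (fun t => w t ω) (fun t => v t ω) (fun t => u t ω) l)
        inferInstance) (Set.mem_Iic.2 le_rfl)))
  have hem : ∀ k, Measurable[I k] (fun ω => σ k ω •
      S.filterEst F (x0 ω) (fun t => w t ω) (fun t => v t ω) (fun t => u t ω) k) := fun k =>
    measurable_iff_comap_le.2
    (le_sup_right.trans (le_biSup (f := fun l => MeasurableSpace.comap (σ l) inferInstance ⊔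
      MeasurableSpace.comap (fun ω => σ l ω •
          S.filterEst F (x0 ω) (fun t => w t ω) (fun t => v t ω) (fun t => u t ω) l)
        inferInstance) (Set.mem_Iic.2 le_rfl)))
  have hest : ∀ k, Measurable[I k] (fun ω => S.remotePred F (x0 ω) (fun t => w t ω)
      (fun t => v t ω) (fun t => σ t ω) (fun t => u t ω) k) →
      Measurable[I k] (fun ω => S.remoteEst F (x0 ω) (fun t => w t ω)
      (fun t => v t ω) (fun t => σ t ω) (fun t => u t ω) k) := fun k hk => by
    -- On success σ_k x̂ equals x̂, so the generator σ_k x̂ of the information reveals the estimate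
    -- just when it is used.
    have h1 : Measurable[I k] (fun ω => if σ k ω = 1 then σ k ω •
      S.filterEst F (x0 ω) (fun t => w t ω) (fun t => v t ω) (fun t => u t ω) k else
        S.remotePred F (x0 ω) (fun t => w t ω)
      (fun t => v t ω) (fun t => σ t ω) (fun t => u t ω) k) :=
      Measurable.ite (hσm k (measurableSet_singleton 1)) (hem k) hk
    convert h1 using 2 with ω
    by_cases hω : σ k ω = 1 <;> simp [Loop.remoteEst, Loop.remoteUpdate, hω]
  have hu' : ∀ k, u k = fun ω => act K (S.remoteEst F (x0 ω) (fun t => w t ω)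
      (fun t => v t ω) (fun t => σ t ω) (fun t => u t ω) k) := fun k => funext fun ω =>
    S.feedbackInput_eq K F (x0 ω) (fun t => w t ω) (fun t => v t ω) (fun t => σ t ω) k
  have hpred : ∀ k, Measurable[I k] (fun ω => S.remotePred F (x0 ω) (fun t => w t ω)
      (fun t => v t ω) (fun t => σ t ω) (fun t => u t ω) k) := fun k => by
    induction k with
    | zero => exact measurable_const
    | succ k ih =>
      have h1 := hest k ih
      have h2 : Measurable[I k] (u k) := by
        rw [hu' k]
        exact (measurable_act K).comp h1
      exact (((measurable_act S.A).comp h1).add ((measurable_act S.B).comp h2)).mono (hmono k) le_rfl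
  intro k
  rw [hu' k]
  exact (measurable_act K).comp (hest k (hpred k))

variable {m0 : MeasurableSpace Ω} {μ : Measure Ω}

theorem LoopNoise.memLp_feedback (h : LoopNoise S μ x0 w v σ s) (k : ℕ) :
    MemLp (stateProc S x0 w (feedbackControl S K F x0 w v σ) k) 2 μ ∧
      MemLp (feedbackControl S K F x0 w v σ k) 2 μ := by
  have step : ∀ k, MemLp (stateProc S x0 w (feedbackControl S K F x0 w v σ) k) 2 μ →
      MemLp (feedbackControl S K F x0 w v σ k) 2 μ := fun k hk => by
    rw [funext (feedbackControl_eq (K := K) k)]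
    exact memLp_act K (hk.sub (h.memLp_remoteErr h.memLp_x0 k))
  induction k with
  | zero => exact ⟨h.memLp_x0, step 0 h.memLp_x0⟩
  | succ k ih =>
    have : MemLp (stateProc S x0 w (feedbackControl S K F x0 w v σ) (k + 1)) 2 μ :=
      ((memLp_act S.A ih.1).add (memLp_act S.B ih.2)).add (h.memLp_w k)
    exact ⟨this, step _ this⟩

theorem eLpNorm_act_le {a b : ℕ} (M : Matrix (Fin a) (Fin b) ℝ) (X : Ω → Vec b) :
    eLpNorm (fun ω => act M (X ω)) 2 μ ≤ ENNReal.ofReal ‖M‖ * eLpNorm X 2 μ :=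
  eLpNorm_le_mul_eLpNorm_of_ae_le_mul (Eventually.of_forall fun ω => norm_act_le M (X ω)) 2

/-- A stable linear system driven by inputs with bounded second moments has bounded second
moments. -/
theorem boundedSecondMoments_of_recursion {M : Matrix (Fin S.n) (Fin S.n) ℝ}
    (hM : Summable fun j => ‖M ^ j‖) {x n : ℕ → Ω → Vec S.n}
    (hx : ∀ k ω, x (k + 1) ω = act M (x k ω) + n k ω) (hx0 : MemLp (x 0) 2 μ)
    (hn : ∀ k, MemLp (n k) 2 μ) {b : ℝ} (hb : ∀ k, ∫ ω, ‖n k ω‖ ^ 2 ∂μ ≤ b) :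
    BoundedSecondMoments S μ x := by
  have hpow : ∀ j y, ((Matrix.toEuclideanLin M ^ j : Vec S.n →ₗ[ℝ] Vec S.n)) y = act (M ^ j) y := by
    intro j y
    induction j with
    | zero => simp [one_act]
    | succ j ih =>
      rw [pow_succ', Module.End.mul_apply, ih, pow_succ_act]
      rfl
  have hsol : ∀ k, x k = (fun ω => act (M ^ k) (x 0 ω)) +
      ∑ j ∈ Finset.range k, fun ω => act (M ^ j) (n (k - 1 - j) ω) := fun k => by
    ext1 ω
    have := linear_recursion_eq (Matrix.toEuclideanLin M) (d := fun k => x k ω)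
      (e := fun k => n k ω) (fun k => hx k ω) k
    simp only [hpow] at this
    simpa using this
  -- The bound is taken in L² norm, so that Minkowski's inequality and summability of ‖M^j‖ suffice
  -- without any orthogonality in time.
  obtain ⟨B, hB⟩ : ∃ B : ℝ≥0, ∀ k, eLpNorm (n k) 2 μ ≤ B := by
    refine ⟨NNReal.sqrt b.toNNReal, fun k => ?_⟩
    have h1 : eLpNorm (n k) 2 μ ^ 2 ≤ (NNReal.sqrt b.toNNReal : ℝ≥0∞) ^ 2 := by
      rw [eLpNorm_two_sq, lintegral_enorm_sq (hn k), ← ENNReal.coe_pow, NNReal.sq_sqrt]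
      exact ENNReal.ofReal_le_ofReal (hb k)
    exact (ENNReal.pow_le_pow_left_iff two_ne_zero).1 h1
  set C := ∑' j, ‖M ^ j‖ with hC
  have hbound : ∀ k, eLpNorm (x k) 2 μ ≤ ENNReal.ofReal C * (eLpNorm (x 0) 2 μ + B) := fun k => by
    have hterm : ∀ j, MemLp (fun ω => act (M ^ j) (n (k - 1 - j) ω)) 2 μ := fun j =>
      memLp_act _ (hn _)
    rw [hsol k]
    calc _ ≤ eLpNorm (fun ω => act (M ^ k) (x 0 ω)) 2 μ +
          ∑ j ∈ Finset.range k, eLpNorm (fun ω => act (M ^ j) (n (k - 1 - j) ω)) 2 μ :=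
          (eLpNorm_add_le (memLp_act _ hx0).1
            (Finset.aestronglyMeasurable_sum _ fun j _ => (hterm j).1) one_le_two).trans
            (add_le_add le_rfl (eLpNorm_sum_le (fun j _ => (hterm j).1) one_le_two))
      _ ≤ ENNReal.ofReal C * eLpNorm (x 0) 2 μ +
          ∑ j ∈ Finset.range k, ENNReal.ofReal ‖M ^ j‖ * B := by
          gcongr with j
          · refine (eLpNorm_act_le _ _).trans ?_
            gcongr
            exact hM.le_tsum k fun _ _ => norm_nonneg _
          · exact (eLpNorm_act_le _ _).trans (by gcongr; exact hB _)
      _ ≤ ENNReal.ofReal C * eLpNorm (x 0) 2 μ + ENNReal.ofReal C * B := by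
          rw [← Finset.sum_mul, ← ENNReal.ofReal_sum_of_nonneg fun _ _ => norm_nonneg _]
          gcongr
          exact hM.sum_le_tsum _ fun _ _ => norm_nonneg _
      _ = _ := by rw [mul_add]
  have hfin : ENNReal.ofReal C * (eLpNorm (x 0) 2 μ + B) ≠ ∞ :=
    ENNReal.mul_ne_top ENNReal.ofReal_ne_top (ENNReal.add_ne_top.2 ⟨hx0.2.ne, ENNReal.coe_ne_top⟩)
  refine ⟨((ENNReal.ofReal C * (eLpNorm (x 0) 2 μ + B)) ^ 2).toNNReal, fun k => ?_⟩
  rw [ENNReal.coe_toNNReal (ENNReal.pow_ne_top hfin), ← eLpNorm_two_sq]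
  exact pow_le_pow_left' (hbound k) 2

variable [IsProbabilityMeasure μ]

/-- The loop closed by certainty equivalence control has bounded second moments. -/
theorem LoopNoise.boundedSecondMoments_feedback (h : LoopNoise S μ x0 w v σ s) (hS : S.Regular)
    (hP : S.IsControlRiccati P) (hΘ : S.IsFilterRiccati Θ)
    (hM : Summable fun j => ‖(√(1 - s) • S.A) ^ j‖) :
    BoundedSecondMoments S μ (stateProc S x0 w
      (feedbackControl S (S.controlGain P) (S.filterGain (S.predCov Θ)) x0 w v σ)) := by
  set F := S.filterGain (S.predCov Θ) with hF
  have hD := h.memLp_remoteErr (G := fun _ => F) h.memLp_x0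
  have hKD := fun k => memLp_act (S.B * S.controlGain P) (hD k)
  -- Since u = K(x - e), the state evolves with the stable matrix A + BK and forcing w - BKe, where
  -- e is the remote error.
  let n : ℕ → Ω → Vec S.n := fun k ω =>
    w k ω - act (S.B * S.controlGain P) (remoteErr S (fun _ => F) x0 w v σ k ω)
  have hlim := h.tendsto_crossMom_remoteErr hS hM (comap_measurable x0) h.memLp_x0
    (h.tendsto_crossMom_filtErr_stationary hS hΘ)
  have hc : Continuous fun X : Matrix (Fin S.n) (Fin S.n) ℝ =>
      (S.W + S.B * S.controlGain P * X * (S.B * S.controlGain P)ᵀ).trace := by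
    fun_prop
  obtain ⟨b, hb⟩ := ((hc.tendsto _).comp hlim).bddAbove_range
  refine boundedSecondMoments_of_recursion (hP.summable hS) (n := n) (fun k ω => ?_) h.memLp_x0
    (fun k => (h.memLp_w k).sub (hKD k)) (b := b) (fun k => ?_)
  · rw [stateProc_succ, feedbackControl_eq, add_act, mul_act, act_sub, act_sub]
    simp only [n, mul_act]
    abel
  · have hcr : crossMom μ (w k) (fun ω => act (S.B * S.controlGain P)
        (remoteErr S (fun _ => F) x0 w v σ k ω)) = 0 := by
      have hm : Measurable[pastInfo x0 w v σ k ⊔ MeasurableSpace.comap (v k) inferInstance]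
          (fun ω => act (S.B * S.controlGain P) (remoteErr S (fun _ => F) x0 w v σ k ω)) :=
        (measurable_act _).comp (measurable_remoteErr_pastInfo (comap_measurable x0) k)
      rw [← crossMom_transpose, h.crossMom_w hm, transpose_zero]
    have hn : MemLp (n k) 2 μ := (h.memLp_w k).sub (hKD k)
    have h1 : ∫ ω, ‖n k ω‖ ^ 2 ∂μ = (S.W + S.B * S.controlGain P *
        crossMom μ (remoteErr S (fun _ => F) x0 w v σ k) (remoteErr S (fun _ => F) x0 w v σ k) *
        (S.B * S.controlGain P)ᵀ).trace := by
      simp_rw [← quad_one]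
      rw [integral_quad 1 hn, Matrix.one_mul, crossMom_sub_self (h.memLp_w k) (hKD k) hcr,
        crossMom_self_of_hasLaw hS.W_posDef.posSemidef (h.law_w k), crossMom_act_self _ (hD k)]
    rw [h1]
    exact hb ⟨k, rfl⟩

end Feedback

-- The value of certainty equivalence and the lower bound for all admissible controls.

section AverageCost

open scoped Matrix.Norms.L2Operator Topology

/-- If the stored energy `b` is controlled by the next `n` stage costs `c`, then an energy balance
`∑ c + b ≥ ∑ g + T t` bounds the growth rate of the accumulated cost from below. -/
theorem le_rate_of_energy_balance {b c g : ℕ → ℝ} {G t y D d : ℝ} {n : ℕ} (hc : ∀ k, 0 ≤ c k)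
    (hD : 0 ≤ D) (hg : Tendsto g atTop (𝓝 G))
    (hbal : ∀ T : ℕ, ∑ k ∈ Finset.range T, g k + T * t ≤ ∑ k ∈ Finset.range T, c k + b T)
    (hb : ∀ T, b T ≤ D * (∑ k ∈ Finset.range n, c (T + k) + d))
    (hy : ∀ᶠ T : ℕ in atTop, ∑ k ∈ Finset.range T, c k ≤ y * T) : G + t ≤ y := by
  by_contra! hlt
  -- If the rate `y` were below `G + t`, the balance would force `b` to grow at least linearly.
  have hb_top : Tendsto b atTop atTop := by
    have h1 : Tendsto (fun T : ℕ => (T : ℝ) * ((T : ℝ)⁻¹ * ∑ k ∈ Finset.range T, g k + t - y))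
        atTop atTop :=
      tendsto_natCast_atTop_atTop.atTop_mul_pos (show 0 < G + t - y by linarith)
        ((hg.cesaro.add_const t).sub_const y)
    refine tendsto_atTop_mono' atTop ?_ h1
    filter_upwards [hy, eventually_gt_atTop 0] with T hT hT0
    have hT0' : (T : ℝ) ≠ 0 := by positivity
    have : (T : ℝ) * ((T : ℝ)⁻¹ * ∑ k ∈ Finset.range T, g k + t - y) =
        ∑ k ∈ Finset.range T, g k + T * t - y * T := by
      field_simp
    linarith [hbal T]
  -- Every stage cost lies in at most `n` of the windows, so the accumulated energy is at most a
  -- multiple of the accumulated cost plus a linear term.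
  have hsum : ∀ M : ℕ, ∑ T ∈ Finset.range M, b T ≤
      D * (n * ∑ k ∈ Finset.range (M + n), c k + M * d) := fun M => by
    have h2 : ∑ T ∈ Finset.range M, ∑ k ∈ Finset.range n, c (T + k) ≤
        n * ∑ k ∈ Finset.range (M + n), c k := by
      rw [Finset.sum_comm, ← nsmul_eq_mul]
      refine (Finset.sum_le_card_nsmul _ _ (∑ k ∈ Finset.range (M + n), c k) fun k hk => ?_).trans
        (by rw [Finset.card_range])
      rw [Finset.mem_range] at hk
      have h3 : ∑ T ∈ Finset.range M, c (T + k) ≤ ∑ l ∈ Finset.range (k + M), c l := by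
        rw [Finset.sum_range_add]
        simp_rw [add_comm k]
        exact le_add_of_nonneg_left (Finset.sum_nonneg fun l _ => hc l)
      exact h3.trans (Finset.sum_le_sum_of_subset_of_nonneg
        (Finset.range_mono (by omega)) fun l _ _ => hc l)
    calc _ ≤ ∑ T ∈ Finset.range M, D * (∑ k ∈ Finset.range n, c (T + k) + d) :=
          Finset.sum_le_sum fun T _ => hb T
      _ = D * (∑ T ∈ Finset.range M, ∑ k ∈ Finset.range n, c (T + k) + M * d) := by
          rw [← Finset.mul_sum, Finset.sum_add_distrib]
          simp
      _ ≤ _ := by gcongr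
  have hy0 : ∀ᶠ M : ℕ in atTop, (M : ℝ)⁻¹ * ∑ T ∈ Finset.range M, b T ≤
      D * (n * (y * (1 + n * (M : ℝ)⁻¹)) + d) := by
    filter_upwards [(tendsto_add_atTop_nat n).eventually hy, eventually_gt_atTop 0] with M hM hM0
    have hM0' : (M : ℝ) ≠ 0 := by positivity
    calc _ ≤ (M : ℝ)⁻¹ * (D * (n * (y * (M + n : ℕ)) + M * d)) := by
          refine mul_le_mul_of_nonneg_left ((hsum M).trans ?_) (by positivity)
          gcongr
      _ = _ := by
          push_cast
          field_simp
  set C := D * (n * (y * (1 + n * 0)) + d) with hC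
  have hlim : Tendsto (fun M : ℕ => D * (n * (y * (1 + n * (M : ℝ)⁻¹)) + d)) atTop (𝓝 C) :=
    ((((((tendsto_inv_atTop_nhds_zero_nat (𝕜 := ℝ)).const_mul _).const_add 1).const_mul
      y).const_mul _).add_const d).const_mul D
  -- Truncating at `C + 1` gives a finite limit to which Cesàro averaging applies, contradicting the
  -- upper bound by averages tending to `C`.
  have hmin : Tendsto (fun T => min (b T) (C + 1)) atTop (𝓝 (C + 1)) := by
    refine tendsto_const_nhds.congr' ?_
    filter_upwards [hb_top.eventually_ge_atTop (C + 1)] with T hT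
    rw [min_eq_right hT]
  have := le_of_tendsto_of_tendsto hmin.cesaro hlim (hy0.mono fun M hM => le_trans ?_ hM)
  · linarith
  · exact mul_le_mul_of_nonneg_left (Finset.sum_le_sum fun T _ => min_le_left _ _) (by positivity)

variable {Ω : Type*} {m0 : MeasurableSpace Ω} {μ : Measure Ω} [IsProbabilityMeasure μ]
  {S : Loop} {x0 : Ω → Vec S.n} {w : ℕ → Ω → Vec S.n} {v : ℕ → Ω → Vec S.o} {σ : ℕ → Ω → ℝ} {s : ℝ}
  {P Θ : Matrix (Fin S.n) (Fin S.n) ℝ} {F : Matrix (Fin S.n) (Fin S.o) ℝ} {u : ℕ → Ω → Vec S.m}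

omit [IsProbabilityMeasure μ] in
theorem integral_quad_le {a : ℕ} (M : Matrix (Fin a) (Fin a) ℝ) {X : Ω → Vec a}
    (hX : MemLp X 2 μ) : ∫ ω, quad M (X ω) ∂μ ≤ ‖M‖ * ∫ ω, ‖X ω‖ ^ 2 ∂μ := by
  rw [← integral_const_mul]
  exact integral_mono (integrable_quad M hX) ((integrable_norm_sq hX).const_mul _)
    fun ω => (le_abs_self _).trans (quad_le_norm M (X ω))

theorem natCast_inv_mul_ofReal {T : ℕ} (hT : 0 < T) (c : ℝ) :
    (T : ℝ≥0∞)⁻¹ * ENNReal.ofReal c = ENNReal.ofReal ((T : ℝ)⁻¹ * c) := by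
  rw [ENNReal.ofReal_mul (by positivity), ENNReal.ofReal_inv_of_pos (by positivity),
    ENNReal.ofReal_natCast]

namespace LoopNoise

/-- Here the deviation is exactly -K times the remote error and stability removes the terminal term,
so the limsup is a limit. -/
theorem averageCost_feedback (h : LoopNoise S μ x0 w v σ s) (hS : S.Regular)
    (hP : S.IsControlRiccati P) (hΘ : S.IsFilterRiccati Θ)
    (hM : Summable fun j => ‖(√(1 - s) • S.A) ^ j‖) :
    averageCost S μ x0 w
      (feedbackControl S (S.controlGain P) (S.filterGain (S.predCov Θ)) x0 w v σ) =
      ENNReal.ofReal ((P * S.W).trace + (S.gainWeight P * remoteCov S Θ s).trace) := by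
  obtain ⟨C, hC⟩ := h.boundedSecondMoments_feedback hS hP hΘ hM
  set F := S.filterGain (S.predCov Θ) with hF
  set u := feedbackControl S (S.controlGain P) F x0 w v σ with hu
  have hu2 : ∀ k, MemLp (u k) 2 μ := fun k => (h.memLp_feedback k).2
  have hx2 := h.memLp_state hu2
  have hdev : ∀ k, ∫ ω, quad (S.inputWeight P)
      (u k ω - act (S.controlGain P) (stateProc S x0 w u k ω)) ∂μ =
      (S.gainWeight P * crossMom μ (remoteErr S (fun _ => F) x0 w v σ k)
        (remoteErr S (fun _ => F) x0 w v σ k)).trace := fun k => by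
    rw [← integral_quad_inputWeight (h.memLp_remoteErr h.memLp_x0 k)]
    refine integral_congr_ae (Eventually.of_forall fun ω => ?_)
    simp only [hu]
    rw [feedbackControl_eq, act_sub, sub_sub_cancel_left, quad_neg]
  have hg : Tendsto (fun k => ∫ ω, quad (S.inputWeight P)
      (u k ω - act (S.controlGain P) (stateProc S x0 w u k ω)) ∂μ) atTop
      (𝓝 (S.gainWeight P * remoteCov S Θ s).trace) := by
    simp_rw [hdev]
    have hc : Continuous fun X : Matrix (Fin S.n) (Fin S.n) ℝ => (S.gainWeight P * X).trace := by
      fun_prop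
    exact (hc.tendsto _).comp (h.tendsto_crossMom_remoteErr hS hM (comap_measurable x0) h.memLp_x0
      (h.tendsto_crossMom_filtErr_stationary hS hΘ))
  have hb : Tendsto (fun T : ℕ => (T : ℝ)⁻¹ * ∫ ω, quad P (stateProc S x0 w u T ω) ∂μ) atTop
      (𝓝 0) := by
    have hx : ∀ k, ∫ ω, ‖stateProc S x0 w u k ω‖ ^ 2 ∂μ ≤ C := fun k => by
      have := hC k
      rw [lintegral_enorm_sq (hx2 k)] at this
      rw [← ENNReal.ofReal_coe_nnreal] at this
      exact (ENNReal.ofReal_le_ofReal_iff C.2).1 this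
    have hlim : Tendsto (fun T : ℕ => (T : ℝ)⁻¹ * (‖P‖ * C)) atTop (𝓝 0) := by
      simpa using (tendsto_inv_atTop_nhds_zero_nat (𝕜 := ℝ)).mul_const (‖P‖ * (C : ℝ))
    refine squeeze_zero (fun T => mul_nonneg (by positivity)
      (integral_nonneg fun ω => quad_nonneg hP.1 _)) (fun T => ?_) hlim
    gcongr
    exact (integral_quad_le P (hx2 T)).trans (by gcongr; exact hx T)
  have hlim : Tendsto (fun T : ℕ => (T : ℝ)⁻¹ * ∑ k ∈ Finset.range T, stageCost S μ x0 w u k) atTop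
      (𝓝 ((P * S.W).trace + (S.gainWeight P * remoteCov S Θ s).trace)) := by
    have h0 : Tendsto (fun T : ℕ => (T : ℝ)⁻¹ * ∫ ω, quad P (x0 ω) ∂μ) atTop (𝓝 0) := by
      simpa using (tendsto_inv_atTop_nhds_zero_nat (𝕜 := ℝ)).mul_const (∫ ω, quad P (x0 ω) ∂μ)
    have h1 := ((h0.add hg.cesaro).sub hb).const_add (P * S.W).trace
    rw [zero_add, sub_zero] at h1
    refine h1.congr' ?_
    filter_upwards [eventually_gt_atTop 0] with T hT
    have hT0 : (T : ℝ) ≠ 0 := by positivity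
    rw [eq_sub_of_add_eq (h.cost_identity hS hP (isAdmissibleControl_feedbackControl (F := F)) hu2 T)]
    field_simp
    ring
  refine Tendsto.limsup_eq (((ENNReal.continuous_ofReal.tendsto _).comp hlim).congr' ?_)
  filter_upwards [eventually_gt_atTop 0] with T hT
  rw [h.lintegral_cost hS hu2, natCast_inv_mul_ofReal hT]
  rfl

/-- The expected energy of the state is controlled by the cost of the next `n` stages. -/
theorem integral_quad_state_le (h : LoopNoise S μ x0 w v σ s) (hS : S.Regular) :
    ∃ D, 0 ≤ D ∧ ∀ u : ℕ → Ω → Vec S.m, (∀ k, MemLp (u k) 2 μ) → ∀ T,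
      ∫ ω, quad P (stateProc S x0 w u T ω) ∂μ ≤
        D * (∑ k ∈ Finset.range S.n, stageCost S μ x0 w u (T + k) + S.n * S.W.trace) := by
  obtain ⟨c, hc, hobs⟩ := Loop.exists_norm_sq_le_sum hS
  refine ⟨‖P‖ * c, by positivity, fun u hu T => ?_⟩
  have hx := h.memLp_state hu
  have hiQ := fun k => integrable_quad S.Q (hx (T + k))
  have hiR := fun k => integrable_quad S.R (hu (T + k))
  have hiW := fun k => integrable_norm_sq (h.memLp_w (T + k))
  have hiQR : ∀ k, Integrable (fun ω => quad S.Q (stateProc S x0 w u (T + k) ω) +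
      quad S.R (u (T + k) ω)) μ := fun k => (hiQ k).add (hiR k)
  have hi : ∀ k, Integrable (fun ω => quad S.Q (stateProc S x0 w u (T + k) ω) +
      quad S.R (u (T + k) ω) + ‖w (T + k) ω‖ ^ 2) μ := fun k => (hiQR k).add (hiW k)
  have hW : ∀ k, ∫ ω, ‖w k ω‖ ^ 2 ∂μ = S.W.trace := fun k => by
    simp_rw [← quad_one]
    rw [integral_quad 1 (h.memLp_w k), crossMom_self_of_hasLaw hS.W_posDef.posSemidef (h.law_w k),
      Matrix.one_mul]
  have h1 : ∫ ω, ‖stateProc S x0 w u T ω‖ ^ 2 ∂μ ≤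
      c * (∑ k ∈ Finset.range S.n, stageCost S μ x0 w u (T + k) + S.n * S.W.trace) := by
    calc _ ≤ ∫ ω, c * ∑ k ∈ Finset.range S.n, (quad S.Q (stateProc S x0 w u (T + k) ω) +
          quad S.R (u (T + k) ω) + ‖w (T + k) ω‖ ^ 2) ∂μ := by
          refine integral_mono (integrable_norm_sq (hx T))
            ((integrable_finsetSum _ fun k _ => hi k).const_mul c) fun ω => ?_
          exact hobs (fun k => stateProc S x0 w u (T + k) ω) (fun k => u (T + k) ω)
            (fun k => w (T + k) ω) fun k => stateProc_succ (T + k) ω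
      _ = _ := by
          rw [integral_const_mul, integral_finsetSum _ fun k _ => hi k]
          congr 1
          have hconst : (S.n : ℝ) * S.W.trace = ∑ _k ∈ Finset.range S.n, S.W.trace := by simp
          rw [hconst, ← Finset.sum_add_distrib]
          refine Finset.sum_congr rfl fun k _ => ?_
          rw [integral_add (hiQR k) (hiW k), integral_add (hiQ k) (hiR k), hW]
          rfl
  calc _ ≤ ‖P‖ * ∫ ω, ‖stateProc S x0 w u T ω‖ ^ 2 ∂μ := integral_quad_le P (hx T)
    _ ≤ _ := by
      rw [mul_assoc]
      gcongr

omit [IsProbabilityMeasure μ] in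
/-- Inputs with finite expected costs are square integrable. -/
theorem memLp_control_of_cost (hS : S.Regular) (hum : ∀ k, Measurable (u k))
    (hfin : ∃ᶠ T : ℕ in atTop, ∫⁻ ω, ENNReal.ofReal (∑ k ∈ Finset.range T,
      (quad S.Q (stateProc S x0 w u k ω) + quad S.R (u k ω))) ∂μ < ∞) (k : ℕ) :
    MemLp (u k) 2 μ := by
  -- One finite horizon beyond `k` is enough, since all stage costs are nonnegative.
  obtain ⟨T, hkT, hT⟩ := (frequently_atTop.1 hfin) (k + 1)
  obtain ⟨ρ, hρ, hR⟩ := exists_pos_mul_le_quad_of_posDef hS.R_posDef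
  refine ⟨(hum k).aestronglyMeasurable, ?_⟩
  have hle : ENNReal.ofReal ρ * ∫⁻ ω, ‖u k ω‖ₑ ^ 2 ∂μ ≤ ∫⁻ ω, ENNReal.ofReal (∑ k ∈ Finset.range T,
      (quad S.Q (stateProc S x0 w u k ω) + quad S.R (u k ω))) ∂μ := by
    rw [← lintegral_const_mul _ ((hum k).enorm.pow_const 2)]
    refine lintegral_mono fun ω => ?_
    rw [← ofReal_norm, ← ENNReal.ofReal_pow (norm_nonneg _), ← ENNReal.ofReal_mul hρ.le]
    refine ENNReal.ofReal_le_ofReal (((hR (u k ω)).trans (le_add_of_nonneg_left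
      (quad_nonneg hS.Q_posSemidef (stateProc S x0 w u k ω)))).trans ?_)
    exact Finset.single_le_sum (f := fun k => quad S.Q (stateProc S x0 w u k ω) + quad S.R (u k ω))
      (fun k _ => add_nonneg (quad_nonneg hS.Q_posSemidef _)
        (quad_nonneg hS.R_posDef.posSemidef _)) (Finset.mem_range.2 hkT)
  have h1 : eLpNorm (u k) 2 μ ^ 2 < ∞ := by
    rw [eLpNorm_two_sq]
    by_contra! htop
    rw [top_le_iff.1 htop, ENNReal.mul_top (by simpa using hρ)] at hle
    exact (hle.trans_lt hT).ne rfl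
  exact (ENNReal.pow_lt_top_iff.1 h1).resolve_right two_ne_zero

/-- A control beating the bound has finite horizon costs, so its inputs are square integrable and
the energy balance applies. The deviations are bounded below through the filter that knows x_0,
whose remote covariance has the same limit. -/
theorem le_averageCost (h : LoopNoise S μ x0 w v σ s) (hS : S.Regular)
    (hP : S.IsControlRiccati P) (hΘ : S.IsFilterRiccati Θ)
    (hM : Summable fun j => ‖(√(1 - s) • S.A) ^ j‖)
    (hadm : IsAdmissibleControl S F x0 w v σ u) :
    ENNReal.ofReal ((P * S.W).trace + (S.gainWeight P * remoteCov S Θ s).trace) ≤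
      averageCost S μ x0 w u := by
  by_contra! hlt
  obtain ⟨z, hz1, hz2⟩ := exists_between hlt
  have hz : z ≠ ∞ := (hz2.trans ENNReal.ofReal_lt_top).ne
  have hev := eventually_lt_of_limsup_lt hz1
  have hfin : ∀ᶠ T : ℕ in atTop, ∫⁻ ω, ENNReal.ofReal (∑ k ∈ Finset.range T,
      (quad S.Q (stateProc S x0 w u k ω) + quad S.R (u k ω))) ∂μ < ∞ := by
    filter_upwards [hev, eventually_gt_atTop 0] with T hT hT0
    by_contra! htop
    rw [top_le_iff.1 htop, ENNReal.mul_top (by simp)] at hT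
    exact not_top_lt hT
  have hum : ∀ k, Measurable (u k) := fun k =>
    (measurable_control h.zero_or_one hadm k).mono (h.remoteInfo_le _) le_rfl
  have hu2 := memLp_control_of_cost hS hum hfin.frequently
  obtain ⟨D, hD, hDle⟩ := h.integral_quad_state_le (P := P) hS
  have hc : Continuous fun X : Matrix (Fin S.n) (Fin S.n) ℝ => (S.gainWeight P * X).trace := by
    fun_prop
  have hg := (hc.tendsto _).comp (h.tendsto_crossMom_remoteErr hS hM measurable_const
    (memLp_const 0) (h.tendsto_crossMom_filtErr_tv hS hΘ))
  have hrate := le_rate_of_energy_balance (b := fun T => ∫ ω, quad P (stateProc S x0 w u T ω) ∂μ)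
    (y := z.toReal) (t := (P * S.W).trace) (stageCost_nonneg hS) hD hg (fun T => ?_) (hDle u hu2) ?_
  · have : ENNReal.ofReal ((P * S.W).trace + (S.gainWeight P * remoteCov S Θ s).trace) ≤ z := by
      rw [← ENNReal.ofReal_toReal hz, add_comm]
      exact ENNReal.ofReal_le_ofReal hrate
    exact this.not_gt hz2
  · have h0 : 0 ≤ ∫ ω, quad P (x0 ω) ∂μ := integral_nonneg fun ω => quad_nonneg hP.1 _
    have h1 := Finset.sum_le_sum fun k (_ : k ∈ Finset.range T) =>
      h.le_integral_deviation hS hP.1 hadm hu2 k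
    have h2 := h.cost_identity hS hP hadm hu2 T
    simp only [Function.comp_def]
    linarith
  · filter_upwards [hev, eventually_gt_atTop 0] with T hT hT0
    rw [h.lintegral_cost hS hu2, natCast_inv_mul_ofReal hT0] at hT
    have hT' := (ENNReal.ofReal_le_iff_le_toReal hz).1 hT.le
    rwa [inv_mul_le_iff₀ (by positivity), mul_comm] at hT'

end LoopNoise

end AverageCost

end SharedNetwork

-- The theorem, assembled from the single-loop results.

theorem lemma1 {N : ℕ} (L : Fin N → SharedNetwork.Loop) (hL : ∀ j, (L j).Regular)
    {Ω : Type*} [MeasurableSpace Ω] (μ : MeasureTheory.Measure Ω)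
    [MeasureTheory.IsProbabilityMeasure μ]
    (X : SharedNetwork.Primitives L Ω) (hX : X.Regular μ)
    (δ : Fin N → ℕ → Ω → ℝ) (hδ : ∀ j, X.IsAdmissibleScheduler j (δ j))
    (p : Fin N → ℝ) (hp : ∀ j, SharedNetwork.HasTransmissionProb μ δ j (p j))
    (i : Fin N) (hi : X.IsPurelyStochastic μ i (δ i) (p i))
    (P Θ : Matrix (Fin (L i).n) (Fin (L i).n) ℝ)
    (hP : (L i).IsControlRiccati P) (hΘ : (L i).IsFilterRiccati Θ)
    (q : ℝ) (hq : q = ∏ j ∈ Finset.univ.erase i, (1 - p j))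
    (K : Matrix (Fin (L i).m) (Fin (L i).n) ℝ) (hK : K = (L i).controlGain P)
    (F : Matrix (Fin (L i).n) (Fin (L i).o) ℝ) (hF : F = (L i).kalmanGain Θ)
    (σ : ℕ → Ω → ℝ) (hσ : σ = SharedNetwork.success δ i)
    (u : ℕ → Ω → SharedNetwork.Vec (L i).m)
    (hu : u = SharedNetwork.feedbackControl (L i) K F (X.x0 i) (X.w i) (X.v i) σ)
    (hstab : SharedNetwork.matSpectralRadius (Real.sqrt (1 - q * p i) • (L i).A) < 1) :
    SharedNetwork.IsMeanSquareStable (L i) μ K F (X.w i) (X.v i) σ ∧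
    SharedNetwork.BoundedSecondMoments (L i) μ
      (SharedNetwork.stateProc (L i) (X.x0 i) (X.w i) u) ∧
    Summable (SharedNetwork.seriesTerm (L i) P Θ (q * p i)) ∧
    SharedNetwork.averageCost (L i) μ (X.x0 i) (X.w i) u =
      ENNReal.ofReal ((P * (L i).W).trace +
        ∑' j, SharedNetwork.seriesTerm (L i) P Θ (q * p i) j) ∧
    SharedNetwork.IsAdmissibleControl (L i) F (X.x0 i) (X.w i) (X.v i) σ u ∧
    ∀ u' : ℕ → Ω → SharedNetwork.Vec (L i).m,
      SharedNetwork.IsAdmissibleControl (L i) F (X.x0 i) (X.w i) (X.v i) σ u' →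
      SharedNetwork.averageCost (L i) μ (X.x0 i) (X.w i) u ≤
        SharedNetwork.averageCost (L i) μ (X.x0 i) (X.w i) u' := by
  subst hq hK hF hσ hu
  have h := SharedNetwork.loopNoise_of_regular hX hδ hp i hi
  have hM := SharedNetwork.summable_norm_pow_of_spectralRadius hstab
  have hsum := SharedNetwork.hasSum_seriesTerm (L i) P Θ h.s_le_one hM
  have hcost := h.averageCost_feedback (hL i) hP hΘ hM
  -- A deterministic start keeps the single-loop assumptions, as only x_0 is replaced. The gain
  -- `kalmanGain Θ` is `filterGain (predCov Θ)` by unfolding.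
  refine ⟨fun z => (h.const z).boundedSecondMoments_feedback (hL i) hP hΘ hM,
    h.boundedSecondMoments_feedback (hL i) hP hΘ hM, hsum.summable, ?_,
    SharedNetwork.isAdmissibleControl_feedbackControl, fun u' hu' => ?_⟩
  · rw [hsum.tsum_eq]
    exact hcost
  · exact hcost.trans_le (h.le_averageCost (hL i) hP hΘ hM hu')
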